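/- **Setting.** Let $\mathfrak g$ be a simple complex Lie algebra of rank $N$, $I=\{0,1,\dots,N\}$, $A=(a_{ij})_{i,j\in I}$ the untwisted affine Cartan matrix of $\mathfrak g$, $a_{ij}=\langle\alpha_j,h_i\rangle$, and $d_i$ $(i\in I)$ positive integers with $b_{ij}:=d_ia_{ij}=b_{ji}$. Let $m_{ij}=\delta_{i,j+1}-\delta_{i+1,j}$ (indices modulo $N+1$) if $\mathfrak g$ is of type $A_N$, and $m_{ij}=0$ otherwise. Let $q,\kappa\in\mathbb C^\times$, $q$ not a root of unity, and let $p$ be a formal variable. Put $q_i=q^{d_i}$, $[n]_i=\frac{q_i^n-q_i^{-n}}{q_i-q_i^{-1}}$, $\left[{n\atop r}\right]_i=\frac{[n]_i!}{[n-r]_i![r]_i!}$, $\delta(z)=\sum_{n\in\mathbb Z}z^n$. **The quantum toroidal algebra.** $U_{q,\kappa}(\mathfrak g_{tor})$ is the unital $\mathbb C$-algebra with generators $a^\vee_{i,l},X^\pm_{i,n},k_i^{\pm1},q^{\pm c/2},q^{\pm d}$ $(i\in I,\ l\in\mathbb Z\setminus\{0\},\ n\in\mathbb Z)$ where, with $X_i^\pm(z)=\sum_nX^\pm_{i,n}z^{-n}$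 and $\Phi_i^\pm(z)=k_i^{\pm1}\exp\bigl(\pm(q_i-q_i^{-1})\sum_{n>0}a^\vee_{i,\pm n}z^{\mp n}\bigr)$, the relations are: $q^{\pm c/2}$ are central and mutually inverse; $\prod_ik_i^{\pm c_i}$ is central for all $c\in\mathbb N^I$ with $Ac=0$; $k_i^{\pm1}$ (and $q^{\pm d}$) are mutually inverse; $k_i$ commutes with $k_j,a^\vee_{j,l},q^d$; $$q^da^\vee_{i,l}q^{-d}=q^la^\vee_{i,l},\quad q^dX_i^\pm(z)q^{-d}=X_i^\pm(q^{-1}z),\quad k_iX_j^\pm(z)k_i^{-1}=q^{\pm b_{ij}}X_j^\pm(z),$$ $$[a^\vee_{i,l},a^\vee_{j,m}]=\delta_{l+m,0}\tfrac{[a_{ij}l]_i}{l}\tfrac{q^{lc}-q^{-lc}}{q_j-q_j^{-1}}\kappa^{-lm_{ij}},\qquad [a^\vee_{i,l},X_j^\pm(z)]=\pm\tfrac{[a_{ij}l]_i}{l}q^{\mp|l|c/2}\kappa^{-lm_{ij}}z^lX_j^\pm(z),$$ $$(\kappa^{m_{ij}}z-q^{\pm b_{ij}}w)X_i^\pm(z)X_j^\pm(w)=(\kappa^{m_{ij}}q^{\pm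 b_{ij}}z-w)X_j^\pm(w)X_i^\pm(z),$$ $$[X_i^+(z),X_j^-(w)]=\tfrac{\delta_{ij}}{q_i-q_i^{-1}}\bigl(\delta(q^cw/z)\Phi_i^+(q^{c/2}w)-\delta(q^cz/w)\Phi_i^-(q^{c/2}z)\bigr),$$ $$\sum_{\sigma\in\mathfrak S_a}\sum_{r=0}^a(-1)^r\left[{a\atop r}\right]_iX_i^\pm(z_{\sigma(1)})\cdots X_i^\pm(z_{\sigma(r)})X_j^\pm(w)X_i^\pm(z_{\sigma(r+1)})\cdots X_i^\pm(z_{\sigma(a)})=0\quad(i\ne j,\ a=1-a_{ij}).$$ It is graded by the root lattice $\bigoplus_i\mathbb Z\alpha_i$ with $\mathrm{wt}(X^\pm_{i,n})=\pm\alpha_i$ and the other generators of weight $0$. **Meromorphic functions.** Let $\mathfrak h$ be the $(N+2)$-dimensional Cartan subalgebra with basis $h_1,\dots,h_N,c,d$, so that $\langle\alpha_j,h_i\rangle=a_{ij}$, $\langle\alpha_j,c\rangle=0$, $\langle\alpha_j,d\rangle=\delta_{j,0}$. Let $H_P$ have basis $P_0,\dots,P_N$, let $H=\mathfrak h\oplus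 H_P$, and let $\mathcal F$ be the field of meromorphic functions on $H^*$, written $g(h,P)$. Let $\mathcal R_Q=\bigoplus_{i\in I}\mathbb ZQ_i$ be free, paired with $H_P$ by $\langle Q_j,P_i\rangle=a_{ij}$; for $\alpha=\sum c_i\alpha_i$ put $Q_\alpha=\sum c_iQ_i$, and let $e^{Q_\alpha}$ be the basis of the group algebra $\mathbb C[\mathcal R_Q]$. **The smash product.** $(U_{q,\kappa}(\mathfrak g_{tor})\otimes\mathcal F[[p]])\sharp\mathbb C[\mathcal R_Q]$ is the $p$-adic completion of this tensor product over $\mathbb C$, i.e. the power series in the central variable $p$ over $U_{q,\kappa}(\mathfrak g_{tor})\otimes\mathcal F\otimes\mathbb C[\mathcal R_Q]$, with the product determined, for $a$ homogeneous, by $$g(h,P)a\otimes e^{Q_\alpha}\cdot f(h,P)b\otimes e^{Q_\beta}=g(h,P)f(h-\langle\mathrm{wt}(a),h\rangle,P-\langle Q_\alpha,P\rangle)\,ab\otimes e^{Q_\alpha+Q_\beta}.$$ **The elliptic quantum toroidal algebra.** $U_{q,\kappa,p}(\mathfrak g_{tor})$ is the $p$-adically complete (Hausdorff) topological algebra generated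 by $\mathcal F[[p]]$ ($p$ central), $\alpha^\vee_{i,l},x^\pm_{i,n},K_i^\pm,q^{\pm c/2},q^{\pm d}$ and $e^{Q_\alpha}$ $(i\in I,\ l\in\mathbb Z\setminus\{0\},\ n\in\mathbb Z,\ Q_\alpha\in\mathcal R_Q)$, where with $p^*=pq^{-2c}$, $x_i^\pm(z)=\sum_nx^\pm_{i,n}z^{-n}$, $$\phi_i^+(q^{c/2}z)=K_i^+\exp\Bigl(-(q_i-q_i^{-1})\sum_{n>0}\tfrac{p^n\alpha^\vee_{i,-n}}{1-p^n}z^n\Bigr)\exp\Bigl((q_i-q_i^{-1})\sum_{n>0}\tfrac{\alpha^\vee_{i,n}}{1-p^n}z^{-n}\Bigr),$$ $$\phi_i^-(q^{-c/2}z)=K_i^-\exp\Bigl(-(q_i-q_i^{-1})\sum_{n>0}\tfrac{\alpha^\vee_{i,-n}}{1-p^n}z^n\Bigr)\exp\Bigl((q_i-q_i^{-1})\sum_{n>0}\tfrac{p^n\alpha^\vee_{i,n}}{1-p^n}z^{-n}\Bigr),$$ $$g_{ij}(z;s)=\exp\Bigl(-\sum_{m>0}\tfrac1m\tfrac{q^{b_{ij}m}-q^{-b_{ij}m}}{1-s^m}(sz)^m\Bigr),$$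 the defining relations, read coefficientwise in $z,w,z_1,z_2,\dots$ with sums converging $p$-adically, are: $q^{\pm c/2}$ are central and mutually inverse; $\prod_i(K_i^\pm)^{c_i}$ is central for all $c\in\mathbb N^I$ with $Ac=0$; $q^{\pm d}$ are mutually inverse; the $K_i^\pm$ commute with each other, with $\alpha^\vee_{j,m}$ and with $q^d$; $g(h,P)$ commutes with $\alpha^\vee_{i,m}$ and $q^d$; $$g(h,P)x_j^+(z)=x_j^+(z)g(h+\langle\alpha_j,h\rangle,P-\langle Q_j,P\rangle),\quad g(h,P)x_j^-(z)=x_j^-(z)g(h-\langle\alpha_j,h\rangle,P),\quad g(h,P)K_j^\pm=K_j^\pm g(h,P-\langle Q_j,P\rangle);$$ $e^{Q_\alpha}e^{Q_\beta}=e^{Q_\alpha+Q_\beta}$, $e^0=1$, $e^{Q_\alpha}$ commutes with $x^\pm_{i,n},\alpha^\vee_{i,l},K_i^\pm,q^d$, $e^{Q_\alpha}g(h,P)=g(h,P-\langle Q_\alpha,P\rangle)e^{Q_\alpha}$, and $K_i^+K_i^-=e^{-2Q_i}$; $$q^d\alpha^\vee_{j,m}q^{-d}=q^m\alpha^\vee_{j,m},\quad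 q^dx_j^\pm(z)q^{-d}=x_j^\pm(q^{-1}z),\quad K_i^{\epsilon}x_j^{\epsilon'}(z)=q^{\epsilon\epsilon'b_{ij}}x_j^{\epsilon'}(z)K_i^{\epsilon}\ (\epsilon,\epsilon'=\pm),$$ $$[\alpha^\vee_{i,l},\alpha^\vee_{j,m}]=\delta_{l+m,0}\tfrac{[a_{ij}l]_i}{l}\tfrac{q^{lc}-q^{-lc}}{q_j-q_j^{-1}}\tfrac{1-p^l}{1-p^{*l}}\kappa^{-lm_{ij}}q^{-lc},$$ $$[\alpha^\vee_{i,l},x_j^+(z)]=\tfrac{[a_{ij}l]_i}{l}\tfrac{1-p^l}{1-p^{*l}}q^{-lc}\kappa^{-lm_{ij}}z^lx_j^+(z),\qquad[\alpha^\vee_{i,l},x_j^-(z)]=-\tfrac{[a_{ij}l]_i}{l}\kappa^{-lm_{ij}}z^lx_j^-(z),$$ $$(\kappa^{m_{ij}}z-q^{b_{ij}}w)g_{ij}(\kappa^{-m_{ij}}\tfrac wz;p^*)x_i^+(z)x_j^+(w)=(\kappa^{m_{ij}}q^{b_{ij}}z-w)g_{ij}(\kappa^{m_{ij}}\tfrac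 zw;p^*)x_j^+(w)x_i^+(z),$$ $$(\kappa^{m_{ij}}z-q^{-b_{ij}}w)g_{ij}(\kappa^{-m_{ij}}\tfrac wz;p)^{-1}x_i^-(z)x_j^-(w)=(\kappa^{m_{ij}}q^{-b_{ij}}z-w)g_{ij}(\kappa^{m_{ij}}\tfrac zw;p)^{-1}x_j^-(w)x_i^-(z),$$ $$[x_i^+(z),x_j^-(w)]=\tfrac{\delta_{ij}}{q_i-q_i^{-1}}\bigl(\delta(q^cw/z)\phi_i^+(q^{c/2}w)-\delta(q^{-c}w/z)\phi_i^-(q^{c/2}z)\bigr),$$ and, for $i\neq j$ and $a=1-a_{ij}$, with $G_{ij}=g_{ij}(\,\cdot\,;p^*)$ for the sign $+$ and $G_{ij}=g_{ij}(\,\cdot\,;p)^{-1}$ for the sign $-$, $$\sum_{\sigma\in\mathfrak S_a}\prod_{k<m}G_{ii}\bigl(\tfrac{z_{\sigma(m)}}{z_{\sigma(k)}}\bigr)\sum_{r=0}^a(-1)^r\left[{a\atop r}\right]_i\prod_{s\le r}G_{ij}\bigl(\kappa^{-m_{ij}}\tfrac w{z_{\sigma(s)}}\bigr)\prod_{s>r}G_{ij}\bigl(\kappa^{m_{ij}}\tfrac{z_{\sigma(s)}}w\bigr)x_i^\pm(z_{\sigma(1)})\cdots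 x_i^\pm(z_{\sigma(r)})x_j^\pm(w)x_i^\pm(z_{\sigma(r+1)})\cdots x_i^\pm(z_{\sigma(a)})=0.$$ **Theorem.** Put $$u_i^+(z,p)=\exp\Bigl(-(q_i-q_i^{-1})\sum_{n>0}\tfrac{a^\vee_{i,-n}}{1-p^{*n}}(q^{c/2}p^*z)^n\Bigr),\qquad u_i^-(z,p)=\exp\Bigl((q_i-q_i^{-1})\sum_{n>0}\tfrac{a^\vee_{i,n}}{1-p^n}(q^{c/2}p^{-1}z)^{-n}\Bigr).$$ There is an algebra isomorphism $$U_{q,\kappa,p}(\mathfrak g_{tor})\ \cong\ (U_{q,\kappa}(\mathfrak g_{tor})\otimes\mathcal F[[p]])\sharp\mathbb C[\mathcal R_Q]$$ which is the identity on $\mathcal F[[p]]$, $q^{\pm c/2}$, $q^{\pm d}$ and $e^{Q_\alpha}$, and is given by $$x_i^+(z)\mapsto u_i^+(z,p)X_i^+(z)e^{-Q_i},\qquad x_i^-(z)\mapsto X_i^-(z)u_i^-(z,p),\qquad \phi_i^\pm(z)\mapsto u_i^+(q^{\pm c/2}z,p)\Phi_i^\pm(z)u_i^-(q^{\mp c/2}z,p)e^{-Q_i};$$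 moreover $K_i^\pm\mapsto k_i^{\pm1}e^{-Q_i}$, $\alpha^\vee_{i,n}\mapsto q^{-nc/2}a^\vee_{i,n}$ and $\alpha^\vee_{i,-n}\mapsto q^{-nc/2}\frac{1-p^n}{1-p^{*n}}a^\vee_{i,-n}$ for $n>0$. -/

import Mathlib

open scoped PowerSeries TensorProduct
open PowerSeries (coeff invOfUnit)

noncomputable section

namespace EllTor

/-! ### Simple Lie algebras and untwisted affine Cartan matrices -/

/-- Cartan-Killing types of the simple complex Lie algebras. -/
inductive SimpleType : Type
  | A (N : ℕ) (h : 1 ≤ N)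
  | B (N : ℕ) (h : 3 ≤ N)
  | C (N : ℕ) (h : 2 ≤ N)
  | D (N : ℕ) (h : 4 ≤ N)
  | E₆
  | E₇
  | E₈
  | F₄
  | G₂

namespace SimpleType

def rank : SimpleType → ℕ
  | A N _ => N
  | B N _ => N
  | C N _ => N
  | D N _ => N
  | E₆ => 6
  | E₇ => 7
  | E₈ => 8
  | F₄ => 4
  | G₂ => 2

/-- The finite Cartan matrix `a_{ij} = ⟨α_j, h_i⟩`.  Mathlib's matrices follow the convention
`⟨α_i, h_j⟩`, whence the transposes.  Nodes are numbered as in Bourbaki (for `G₂`: `α_1` long). -/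
def cartan : (t : SimpleType) → Matrix (Fin t.rank) (Fin t.rank) ℤ
  | A N _ => (CartanMatrix.A N).transpose
  | B N _ => (CartanMatrix.B N).transpose
  | C N _ => (CartanMatrix.C N).transpose
  | D N _ => (CartanMatrix.D N).transpose
  | E₆ => CartanMatrix.E₆.transpose
  | E₇ => CartanMatrix.E₇.transpose
  | E₈ => CartanMatrix.E₈.transpose
  | F₄ => CartanMatrix.F₄.transpose
  | G₂ => CartanMatrix.G₂.transpose

/-- The entries `a_{0,j} = -⟨α_j, θ^∨⟩`, `θ` the highest root.
The argument `j : Fin N` stands for the node `j + 1`. -/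
def zeroRow : (t : SimpleType) → Fin t.rank → ℤ
  | A N _ => fun j => if N = 1 then -2 else if j.val = 0 ∨ j.val + 1 = N then -1 else 0
  | B _ _ => fun j => if j.val = 1 then -1 else 0
  | C _ _ => fun j => if j.val = 0 then -1 else 0
  | D _ _ => fun j => if j.val = 1 then -1 else 0
  | E₆ => fun j => if j.val = 1 then -1 else 0
  | E₇ => fun j => if j.val = 0 then -1 else 0
  | E₈ => fun j => if j.val = 7 then -1 else 0
  | F₄ => fun j => if j.val = 0 then -1 else 0
  | G₂ => fun j => if j.val = 0 then -1 else 0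

/-- The entries `a_{j,0} = -⟨θ, h_j⟩`; they agree with `a_{0,j}` except in type `C`. -/
def zeroCol : (t : SimpleType) → Fin t.rank → ℤ
  | C _ _ => fun j => if j.val = 0 then -2 else 0
  | t => t.zeroRow

/-- The untwisted affine Cartan matrix, indexed by `I = {0, 1, …, N}`. -/
def affineCartan (t : SimpleType) : Matrix (Fin (t.rank + 1)) (Fin (t.rank + 1)) ℤ :=
  Matrix.of (Fin.cons (Fin.cons 2 t.zeroRow) fun i => Fin.cons (t.zeroCol i) (t.cartan i))

/-- `m_{ij} = δ_{i,j+1} - δ_{i+1,j}` (indices modulo `N + 1`) in type `A_N`, and `0` otherwise. -/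
def mMatrix : (t : SimpleType) → Fin (t.rank + 1) → Fin (t.rank + 1) → ℤ
  | A _ _ => fun i j => (if i = j + 1 then 1 else 0) - (if i + 1 = j then 1 else 0)
  | _ => fun _ _ => 0

end SimpleType

/-- The numerical input of the two families of algebras. -/
structure Datum where
  N : ℕ
  A : Matrix (Fin (N + 1)) (Fin (N + 1)) ℤ
  d : Fin (N + 1) → ℕ
  m : Fin (N + 1) → Fin (N + 1) → ℤ
  q : ℂ
  κ : ℂ

def SimpleType.datum (t : SimpleType) (d : Fin (t.rank + 1) → ℕ) (q κ : ℂ) : Datum where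
  N := t.rank
  A := t.affineCartan
  d := d
  m := t.mMatrix
  q := q
  κ := κ

namespace Datum
variable (D : Datum)

abbrev I : Type := Fin (D.N + 1)

/-- `b_{ij} = d_i a_{ij}`. -/
def b (i j : D.I) : ℤ := D.d i * D.A i j

/-- `q_i = q^{d_i}`. -/
def qi (i : D.I) : ℂ := D.q ^ D.d i

/-- `q_i - q_i⁻¹`. -/
def qdiff (i : D.I) : ℂ := D.qi i - (D.qi i)⁻¹

/-- `[n]_i`. -/
def qint (i : D.I) (n : ℤ) : ℂ := (D.qi i ^ n - D.qi i ^ (-n)) / D.qdiff i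

def qfact (i : D.I) (n : ℕ) : ℂ := ∏ k ∈ Finset.range n, D.qint i (k + 1)

def qbinom (i : D.I) (n r : ℕ) : ℂ := D.qfact i n / (D.qfact i (n - r) * D.qfact i r)

/-- `[a_{ij} l]_i / l · κ^{-l m_{ij}}`. -/
def str (i j : D.I) (l : ℤ) : ℂ := D.qint i (D.A i j * l) / l * D.κ ^ (-(l * D.m i j))

end Datum

/-! ### The central element `q^{c/2}` -/

/-- `ℂ[q^{c/2}, q^{-c/2}]`.  The generators `q^{±c/2}` are central and mutually inverse in both
algebras, so both are defined over this ring; `cpow n` is `q^{nc/2}`. -/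
abbrev Coef : Type := LaurentPolynomial ℂ

def cpow (n : ℤ) : Coef := LaurentPolynomial.T n

def scal (z : ℂ) : Coef := LaurentPolynomial.C z

/-- The formal variable `p`. -/
def pp : Coef⟦X⟧ := PowerSeries.X

/-- `p^* = p q^{-2c}`. -/
def pstar : Coef⟦X⟧ := PowerSeries.C (cpow (-4)) * PowerSeries.X

/-- `1 / (1 - s^n)` for `s = p` or `s = p^*` and `n > 0`, expanded in powers of `p`. -/
def invOneSub (s : Coef⟦X⟧) (n : ℕ) : Coef⟦X⟧ := invOfUnit (1 - s ^ n) 1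

/-- `(1 - p^l) / (1 - p^{*l})`.  For `l = -n < 0` it equals `q^{-2nc} (1 - p^n) / (1 - p^{*n})`. -/
def ratio (l : ℤ) : Coef⟦X⟧ :=
  (if l < 0 then PowerSeries.C (cpow (4 * l)) else 1) *
    ((1 - pp ^ l.natAbs) * invOneSub pstar l.natAbs)

/-! ### Formal series with coefficients in a noncommutative ring -/

section Series
variable {R : Type} [Ring R] [Algebra Coef R]

/-- The exponential of a power series without constant term. -/
def pexp (f : R⟦X⟧) : R⟦X⟧ :=
  PowerSeries.mk fun n => ∑ k ∈ Finset.range (n + 1), scal ((k.factorial : ℂ)⁻¹) • coeff n (f ^ k)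

/-- Coefficients in `ℂ[q^{±c/2}][[p]]` regarded in `R[[p]]`. -/
def ofCoef : Coef⟦X⟧ →+* R⟦X⟧ := PowerSeries.map (algebraMap Coef R)

/-! A formal distribution `F(z) = ∑ F_n z^{-n}` in one variable is the function `n ↦ F_n`. -/

/-- A power series in `z` as a formal distribution. -/
def inZ (f : R⟦X⟧) : ℤ → R := fun n => if n ≤ 0 then coeff (-n).toNat f else 0

/-- A power series in `z⁻¹` as a formal distribution. -/
def inZInv (f : R⟦X⟧) : ℤ → R := fun n => if 0 ≤ n then coeff n.toNat f else 0

/-- The power series `∑_{n > 0} a_n t^n`. -/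
def posSer (a : ℕ → R) : R⟦X⟧ := PowerSeries.mk fun n => if n = 0 then 0 else a n

/-- `F(q^{kc/2} z)`. -/
def scaleArg (k : ℤ) (F : ℤ → R) : ℤ → R := fun n => cpow (-(k * n)) • F n

/-- The product `F(z) G(z)` of distributions with coefficients in `R[[p]]`, the infinite sums
being `p`-adically convergent (for each power of `p` only finitely many terms contribute). -/
def mulDist (F G : ℤ → R⟦X⟧) : ℤ → R⟦X⟧ :=
  fun n => PowerSeries.mk fun e => ∑ᶠ r : ℤ, coeff e (F (n - r) * G r)

/-- `Φ^ε(z) = k^ε exp(ε c ∑_{n>0} a_{εn} z^{-εn})`, where the argument `k` is `k^ε`. -/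
def trigPhi (c : ℂ) (ε : ℤˣ) (k : R) (a : ℤ → R) : ℤ → R :=
  let e := pexp (posSer fun n => scal ((ε : ℤ) * c) • a (ε * n))
  fun n => k * (if ε = 1 then inZInv e else inZ e) n

end Series

/-- Laurent polynomials in the variables `z_v`, `v : ι`, over `ℂ[q^{±c/2}]`. -/
abbrev LP (ι : Type) : Type := AddMonoidAlgebra Coef (ι → ℤ)

/-- The variable `z_v`. -/
def LP.var {ι : Type} [DecidableEq ι] (v : ι) : LP ι := AddMonoidAlgebra.single (Pi.single v 1) 1

/-- `r z_v / z_w`. -/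
def LP.frac {ι : Type} [DecidableEq ι] (r : ℂ) (v w : ι) : LP ι :=
  AddMonoidAlgebra.single (Pi.single v 1 - Pi.single w 1) (scal r)

/-- Product of a series in `p` whose coefficients are Laurent polynomials with a formal
distribution `F` in several variables; here `F ν` is the coefficient of `z^ν`. -/
def act {R ι : Type} [Ring R] [Algebra Coef R] (G : (LP ι)⟦X⟧) (F : (ι → ℤ) → R)
    (ν : ι → ℤ) : R⟦X⟧ :=
  PowerSeries.mk fun e => (coeff e G).coeff.sum fun μ r => r • F (ν - μ)

namespace Datum
variable (D : Datum)

/-- `exp(-∑_{m>0} (1/m) (q^{bm} - q^{-bm}) / (1 - s^m) (s ζ)^m)`, `s = p` or `p^*`.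
For `b = b_{ij}` this is `g_{ij}(ζ; s)`, and for `b = -b_{ij}` it is `g_{ij}(ζ; s)⁻¹`. -/
def gSer {ι : Type} (b : ℤ) (s : Coef⟦X⟧) (ζ : LP ι) : (LP ι)⟦X⟧ :=
  pexp (PowerSeries.mk fun n => -∑ m ∈ Finset.Icc (1 : ℕ) n,
    (scal ((D.q ^ (b * (m : ℤ)) - D.q ^ (-(b * (m : ℤ)))) / (m : ℂ)) * coeff n (invOneSub s m * s ^ m)) • ζ ^ m)

/-! ### The quantum toroidal algebra -/

/-- Generators `a^∨_{i,l}`, `X^±_{i,n}`, `k_i^{±1}`, `q^{±d}`. -/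
inductive Gen : Type
  | a (i : D.I) (l : {l : ℤ // l ≠ 0})
  | X (ε : ℤˣ) (i : D.I) (n : ℤ)
  | k (ε : ℤˣ) (i : D.I)
  | qd (ε : ℤˣ)

abbrev TFree : Type := FreeAlgebra Coef D.Gen

namespace TFree
variable {D}
def gen (g : D.Gen) : D.TFree := FreeAlgebra.ι Coef g
def a (i : D.I) (l : ℤ) : D.TFree := if h : l ≠ 0 then gen (.a i ⟨l, h⟩) else 0
def X (ε : ℤˣ) (i : D.I) (n : ℤ) : D.TFree := gen (.X ε i n)
def k (ε : ℤˣ) (i : D.I) : D.TFree := gen (.k ε i)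
def qd (ε : ℤˣ) : D.TFree := gen (.qd ε)
def Phi (ε : ℤˣ) (i : D.I) : ℤ → D.TFree := trigPhi (D.qdiff i) ε (k ε i) (a i)
end TFree

open TFree in
/-- Defining relations of the quantum toroidal algebra, written for the coefficients of the
currents. -/
inductive TRel : D.TFree → D.TFree → Prop
  /-- `∏ k_i^{± c_i}` is central; the `c ∈ ℕ^I` with `A c = 0` are the multiples of the vector of
  labels of the affine diagram. -/
  | central (ε : ℤˣ) (c : D.I → ℕ) (hc : D.A.mulVec (fun i => (c i : ℤ)) = 0) (g : D.Gen) :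
      TRel ((List.ofFn fun i => k ε i ^ c i).prod * gen g)
        (gen g * (List.ofFn fun i => k ε i ^ c i).prod)
  | k_inv (ε : ℤˣ) (i) : TRel (k ε i * k (-ε) i) 1
  | k_k (ε ε' : ℤˣ) (i j) : TRel (k ε i * k ε' j) (k ε' j * k ε i)
  | k_a (ε : ℤˣ) (i j) (l : ℤ) : TRel (k ε i * a j l) (a j l * k ε i)
  | qd_inv (ε : ℤˣ) : TRel (qd ε * qd (-ε)) 1
  | qd_k (ε ε' : ℤˣ) (i) : TRel (qd ε * k ε' i) (k ε' i * qd ε)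
  | qd_a (i) (l : ℤ) : TRel (qd 1 * a i l) (scal (D.q ^ l) • (a i l * qd 1))
  | qd_X (ε : ℤˣ) (i) (n : ℤ) : TRel (qd 1 * X ε i n) (scal (D.q ^ n) • (X ε i n * qd 1))
  | k_X (ε : ℤˣ) (i j) (n : ℤ) :
      TRel (k 1 i * X ε j n) (scal (D.q ^ (ε * D.b i j)) • (X ε j n * k 1 i))
  | a_a (i j) (l m : ℤ) (hl : l ≠ 0) (hm : m ≠ 0) :
      TRel (a i l * a j m - a j m * a i l)
        (if l + m = 0 then
          (scal (D.str i j l / D.qdiff j) * (cpow (2 * l) - cpow (-(2 * l)))) • 1 else 0)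
  | a_X (ε : ℤˣ) (i j) (l n : ℤ) (hl : l ≠ 0) :
      TRel (a i l * X ε j n - X ε j n * a i l)
        ((scal (ε * D.str i j l) * cpow (-(ε * |l|))) • X ε j (n + l))
  /-- `(κ^{m_{ij}} z - q^{±b_{ij}} w) X_i^±(z) X_j^±(w)
  = (κ^{m_{ij}} q^{±b_{ij}} z - w) X_j^±(w) X_i^±(z)`. -/
  | X_X (ε : ℤˣ) (i j) (n l : ℤ) :
      TRel (scal (D.κ ^ D.m i j) • (X ε i (n + 1) * X ε j l)
          - scal (D.q ^ (ε * D.b i j)) • (X ε i n * X ε j (l + 1)))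
        (scal (D.κ ^ D.m i j * D.q ^ (ε * D.b i j)) • (X ε j l * X ε i (n + 1))
          - X ε j (l + 1) * X ε i n)
  /-- The coefficient of `z^{-n} w^{-l}` in
  `[X_i^+(z), X_j^-(w)] = δ_{ij} / (q_i - q_i⁻¹) *
  (δ(q^c w/z) Φ_i^+(q^{c/2} w) - δ(q^c z/w) Φ_i^-(q^{c/2} z))`. -/
  | Xp_Xm (i j) (n l : ℤ) :
      TRel (X 1 i n * X (-1) j l - X (-1) j l * X 1 i n)
        (if i = j then scal (D.qdiff i)⁻¹ •
          (cpow (n - l) • Phi 1 i (n + l) - cpow (l - n) • Phi (-1) i (n + l)) else 0)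
  /-- The Serre relations, `a = 1 - a_{ij}`; coefficient of `z_1^{-n_1} … z_a^{-n_a} w^{-l}`. -/
  | serre (ε : ℤˣ) (i j) (hij : i ≠ j) (s : ℕ) (hs : (s : ℤ) = 1 - D.A i j)
      (n : Fin s → ℤ) (l : ℤ) :
      TRel (∑ σ : Equiv.Perm (Fin s), ∑ r ∈ Finset.range (s + 1),
        scal ((-1) ^ r * D.qbinom i s r) •
          (((List.ofFn fun t => X ε i (n (σ t))).take r).prod * X ε j l *
            ((List.ofFn fun t => X ε i (n (σ t))).drop r).prod)) 0

/-- The quantum toroidal algebra `U_{q,κ}(g_tor)`. -/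
def UTor : Type := RingQuot D.TRel

instance : Ring D.UTor := inferInstanceAs (Ring (RingQuot D.TRel))

instance : Algebra Coef D.UTor := inferInstanceAs (Algebra Coef (RingQuot D.TRel))

instance : Algebra ℂ D.UTor := Algebra.compHom D.UTor (algebraMap ℂ Coef)

instance : IsScalarTower ℂ Coef D.UTor := IsScalarTower.of_algebraMap_eq' rfl

def UTor.gen (g : D.Gen) : D.UTor := RingQuot.mkAlgHom Coef D.TRel (TFree.gen g)

/-- Weights in the root lattice `ℤ^I`. -/
def Gen.wt {D : Datum} : D.Gen → D.I → ℤ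
  | .X ε i _ => Pi.single i (ε : ℤ)
  | _ => 0

/-- The weight space of weight `β`: the span of the monomials of weight `β` in the generators. -/
def wtSpace (β : D.I → ℤ) : Submodule Coef D.UTor :=
  Submodule.span Coef {u | ∃ w : List D.Gen, (w.map Gen.wt).sum = β ∧ (w.map (UTor.gen D)).prod = u}

/-! ### Meromorphic functions on `H^*` -/

/-- `H^* = h^* ⊕ H_P^*`, with `μ` represented by its values
`(⟨μ, h_i⟩)_{1 ≤ i ≤ N}`, `⟨μ, c⟩`, `⟨μ, d⟩`, `(⟨μ, P_i⟩)_{i ∈ I}`. -/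
abbrev HDual : Type := (Fin D.N → ℂ) × ℂ × ℂ × (D.I → ℂ)

/-- The simple root `α_j`: `⟨α_j, h_i⟩ = a_{ij}`, `⟨α_j, c⟩ = 0`, `⟨α_j, d⟩ = δ_{j,0}`. -/
def rootVec (j : D.I) : D.HDual := (fun i => (D.A i.succ j : ℂ), 0, if j = 0 then 1 else 0, 0)

/-- `Q_j`: `⟨Q_j, P_i⟩ = a_{ij} = ⟨α_j, h_i⟩`. -/
def QVec (j : D.I) : D.HDual := (0, 0, 0, fun i => (D.A i j : ℂ))

/-- Entire functions on `H^*`. -/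
def Entire : Subalgebra ℂ (D.HDual → ℂ) where
  carrier := {f | AnalyticOnNhd ℂ f Set.univ}
  mul_mem' hf hg := hf.mul hg
  add_mem' hf hg := hf.add hg
  algebraMap_mem' _ := analyticOnNhd_const

instance : IsDomain D.Entire :=
  have : Nontrivial D.Entire := ⟨0, 1, fun h => by
    have := congrFun (congrArg Subtype.val h) 0
    simp at this⟩
  have : NoZeroDivisors D.Entire := ⟨by
    intro f g h
    by_contra! hne
    obtain ⟨hf, hg⟩ := hne
    obtain ⟨x, hx⟩ : ∃ x, f.1 x ≠ 0 := by
      by_contra! hx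
      exact hf (Subtype.ext (funext hx))
    refine hg (Subtype.ext (funext fun y => ?_))
    have hev : ∀ᶠ y in nhds x, f.1 y ≠ 0 :=
      (f.2 x (Set.mem_univ x)).continuousAt.eventually_ne hx
    have hz : g.1 =ᶠ[nhds x] 0 := hev.mono fun y hy => by
      have := congrFun (congrArg Subtype.val h) y
      exact (mul_eq_zero.mp (by simpa using this)).resolve_left hy
    exact g.2.eqOn_zero_of_preconnected_of_eventuallyEq_zero isPreconnected_univ
      (Set.mem_univ x) hz (Set.mem_univ y)⟩
  NoZeroDivisors.to_isDomain _

/-- The field of meromorphic functions on `H^*` (on a finite-dimensional complex vector space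
every meromorphic function is a quotient of two entire functions). -/
abbrev Mer : Type := FractionRing D.Entire

/-- `f(μ) ↦ f(μ + v)` on entire functions, as an algebra homomorphism. -/
def entireTrans (v : D.HDual) : D.Entire →ₐ[ℂ] D.Entire where
  toFun f := ⟨fun μ => f.1 (μ + v), fun μ _ =>
    (f.2 (μ + v) (Set.mem_univ _)).comp_of_eq (analyticAt_id.add analyticAt_const) rfl⟩
  map_one' := rfl
  map_mul' _ _ := rfl
  map_zero' := rfl
  map_add' _ _ := rfl
  commutes' _ := rfl

theorem entireTrans_add (v w : D.HDual) (f : D.Entire) :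
    D.entireTrans v (D.entireTrans w f) = D.entireTrans (v + w) f :=
  Subtype.ext (funext fun μ => congrArg f.1 (add_assoc μ v w))

theorem entireTrans_zero (f : D.Entire) : D.entireTrans 0 f = f :=
  Subtype.ext (funext fun μ => congrArg f.1 (add_zero μ))

/-- `f(μ) ↦ f(μ + v)` on entire functions, as an algebra automorphism. -/
def entireShift (v : D.HDual) : D.Entire ≃ₐ[ℂ] D.Entire :=
  AlgEquiv.ofAlgHom (D.entireTrans v) (D.entireTrans (-v))
    (AlgHom.ext fun f => by simp [entireTrans_add, entireTrans_zero])
    (AlgHom.ext fun f => by simp [entireTrans_add, entireTrans_zero])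

/-- `f(μ) ↦ f(μ + v)` on meromorphic functions. -/
def shift (v : D.HDual) : D.Mer ≃ₐ[ℂ] D.Mer :=
  IsFractionRing.fieldEquivOfAlgEquiv ℂ D.Mer D.Mer (D.entireShift v)

theorem shift_zero : D.shift 0 = AlgEquiv.refl := by
  have h : D.entireShift 0 = AlgEquiv.refl := AlgEquiv.ext D.entireTrans_zero
  rw [shift, h]
  exact IsFractionRing.fieldEquivOfAlgEquiv_refl ℂ D.Entire ℂ D.Mer

theorem shift_add (v w : D.HDual) : D.shift (v + w) = (D.shift w).trans (D.shift v) := by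
  have h : D.entireShift (v + w) = (D.entireShift w).trans (D.entireShift v) :=
    AlgEquiv.ext fun f => (D.entireTrans_add v w f).symm
  rw [shift, h]
  exact IsFractionRing.fieldEquivOfAlgEquiv_trans ℂ D.Mer D.Mer D.Mer _ _

/-! ### The smash product -/

/-- Pairs `(β, α)` of an element of the root lattice and an element of `R_Q = ⊕ ℤ Q_i`,
written multiplicatively. -/
abbrev Lat : Type := Multiplicative ((D.I → ℤ) × (D.I → ℤ))

/-- The vector `∑ β_i α_i + ∑ α_i Q_i` of `H^*`. -/
def latVec : (D.I → ℤ) × (D.I → ℤ) →+ D.HDual where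
  toFun x := ∑ i, x.1 i • D.rootVec i + ∑ i, x.2 i • D.QVec i
  map_zero' := by simp
  map_add' x y := by simp [add_smul, Finset.sum_add_distrib]; abel

/-- The automorphism `a ⊗ f(μ) ↦ a ⊗ f(μ + v)` of `U ⊗ F`. -/
def tensorShift (v : D.HDual) : D.UTor ⊗[ℂ] D.Mer →ₐ[Coef] D.UTor ⊗[ℂ] D.Mer :=
  Algebra.TensorProduct.map (AlgHom.id Coef D.UTor) (D.shift v).toAlgHom

theorem tensorShift_zero : D.tensorShift 0 = AlgHom.id Coef _ := by
  apply Algebra.TensorProduct.ext'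
  intro a f
  simp [tensorShift, shift_zero]

theorem tensorShift_add (v w : D.HDual) :
    D.tensorShift (v + w) = (D.tensorShift v).comp (D.tensorShift w) := by
  apply Algebra.TensorProduct.ext'
  intro a f
  simp [tensorShift, shift_add]

/-- `(β, α)` acts on `U ⊗ F` by
`a ⊗ f(h, P) ↦ a ⊗ f(h - ⟨β, h⟩, P - ⟨Q_α, P⟩)`. -/
instance latAction : MulSemiringAction D.Lat (D.UTor ⊗[ℂ] D.Mer) where
  smul x y := D.tensorShift (-D.latVec x.toAdd) y
  one_smul y := by
    change D.tensorShift (-D.latVec 0) y = y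
    simp [tensorShift_zero]
  mul_smul x x' y := by
    change D.tensorShift (-D.latVec (x.toAdd + x'.toAdd)) y =
      D.tensorShift (-D.latVec x.toAdd) (D.tensorShift (-D.latVec x'.toAdd) y)
    rw [map_add, neg_add, tensorShift_add]; rfl
  smul_zero _ := map_zero _
  smul_add _ := map_add _
  smul_one _ := map_one _
  smul_mul _ := map_mul _

instance : SMulCommClass D.Lat Coef (D.UTor ⊗[ℂ] D.Mer) where
  smul_comm x r y := map_smul (D.tensorShift (-D.latVec x.toAdd)) r y

/-- The skew group algebra of `U ⊗ F` over the group of pairs `(β, α)`. -/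
def Skew : Type := SkewMonoidAlgebra (D.UTor ⊗[ℂ] D.Mer) D.Lat

instance : Ring D.Skew := inferInstanceAs (Ring (SkewMonoidAlgebra (D.UTor ⊗[ℂ] D.Mer) D.Lat))

instance : Algebra Coef D.Skew :=
  inferInstanceAs (Algebra Coef (SkewMonoidAlgebra (D.UTor ⊗[ℂ] D.Mer) D.Lat))

/-- The element `g(h, P) a ⊗ e^{Q_α}`, for `a` of weight `β`. -/
def skewElt (β α : D.I → ℤ) (a : D.UTor) (g : D.Mer) : D.Skew :=
  SkewMonoidAlgebra.single (Multiplicative.ofAdd (β, α)) (a ⊗ₜ[ℂ] g)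

/-- The multiplication rule of the smash product. -/
theorem skewElt_mul (β α β' α' : D.I → ℤ) (a b : D.UTor) (g f : D.Mer) :
    D.skewElt β α a g * D.skewElt β' α' b f =
      D.skewElt (β + β') (α + α') (a * b) (g * D.shift (-D.latVec (β, α)) f) := by
  have h : (Multiplicative.ofAdd (β, α) : D.Lat) • (b ⊗ₜ[ℂ] f : D.UTor ⊗[ℂ] D.Mer) =
      b ⊗ₜ[ℂ] D.shift (-D.latVec (β, α)) f := by
    change D.tensorShift (-D.latVec (β, α)) (b ⊗ₜ[ℂ] f) = _
    simp [tensorShift]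
  refine Eq.trans (SkewMonoidAlgebra.single_mul_single (k := D.UTor ⊗[ℂ] D.Mer) (G := D.Lat)) ?_
  rw [h, Algebra.TensorProduct.tmul_mul_tmul]
  rfl

variable {D} in
theorem mem_wtSpace_one : (1 : D.UTor) ∈ D.wtSpace 0 :=
  Submodule.subset_span ⟨[], by simp⟩

variable {D} in
theorem mem_wtSpace_mul {β β' : D.I → ℤ} {a b : D.UTor} (ha : a ∈ D.wtSpace β)
    (hb : b ∈ D.wtSpace β') : a * b ∈ D.wtSpace (β + β') := by
  have h := Submodule.mul_mem_mul ha hb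
  rw [wtSpace, wtSpace, Submodule.span_mul_span] at h
  refine Submodule.span_mono ?_ h
  rintro _ ⟨_, ⟨w, hw, rfl⟩, _, ⟨w', hw', rfl⟩, rfl⟩
  exact ⟨w ++ w', by simp [hw, hw'], by simp⟩

variable {D} in
theorem mem_wtSpace_gen (g : D.Gen) : UTor.gen D g ∈ D.wtSpace g.wt :=
  Submodule.subset_span ⟨[g], by simp⟩

/-- The elements `g(h, P) a ⊗ e^{Q_α}` with `a` homogeneous. -/
def smashSet : Set D.Skew :=
  {x | ∃ β α a g, a ∈ D.wtSpace β ∧ D.skewElt β α a g = x}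

/-- The subalgebra generated by the elements `g(h, P) a ⊗ e^{Q_α}` with `a` homogeneous; by
`skewElt_mul` it is their span. -/
def smashAlg : Subalgebra Coef D.Skew := Algebra.adjoin Coef D.smashSet

/-- The smash product `(U ⊗ F) ♯ ℂ[R_Q]`.  Since `U` is the direct sum of its weight spaces `U_β`,
the vector space `U ⊗ F ⊗ ℂ[R_Q]` is the direct sum over all `(β, α)` of copies of `U_β ⊗ F`;
this is the span, inside the skew group algebra, of the elements `g(h, P) a ⊗ e^{Q_α}`, `a ∈ U_β`,
which are multiplied by `skewElt_mul`. -/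
def Smash : Type := D.smashAlg

instance : Ring D.Smash := inferInstanceAs (Ring D.smashAlg)

instance : Algebra Coef D.Smash := inferInstanceAs (Algebra Coef D.smashAlg)

namespace Smash
variable {D}

/-- The element `g(h, P) a ⊗ e^{Q_α}`, `a ∈ U_β`. -/
def elt (β α : D.I → ℤ) (a : D.UTor) (ha : a ∈ D.wtSpace β) (g : D.Mer) : D.Smash :=
  ⟨D.skewElt β α a g, Algebra.subset_adjoin ⟨β, α, a, g, ha, rfl⟩⟩

def gen (g : D.Gen) : D.Smash := elt g.wt 0 (UTor.gen D g) (mem_wtSpace_gen g) 1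
def a (i : D.I) (l : ℤ) : D.Smash := if h : l ≠ 0 then gen (.a i ⟨l, h⟩) else 0
def X (ε : ℤˣ) (i : D.I) (n : ℤ) : D.Smash := gen (.X ε i n)
def k (ε : ℤˣ) (i : D.I) : D.Smash := gen (.k ε i)
def qd (ε : ℤˣ) : D.Smash := gen (.qd ε)

/-- `g(h, P) ∈ F`. -/
def fn (g : D.Mer) : D.Smash := elt 0 0 1 mem_wtSpace_one g

/-- `e^{Q_α}`. -/
def eQ (α : D.I → ℤ) : D.Smash := elt 0 α 1 mem_wtSpace_one 1

/-! Elements of, and distributions with coefficients in, the `p`-adic completion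
`(U ⊗ F[[p]]) ♯ ℂ[R_Q]`, that is, power series in the central variable `p` over the smash
product. -/

def cur (ε : ℤˣ) (i : D.I) (n : ℤ) : D.Smash⟦X⟧ := PowerSeries.C (X ε i n)

def Phi (ε : ℤˣ) (i : D.I) : ℤ → D.Smash⟦X⟧ :=
  trigPhi (D.qdiff i) ε (PowerSeries.C (k ε i)) fun l => PowerSeries.C (a i l)

/-- `u_i^+(z, p) = exp(-(q_i - q_i⁻¹) ∑_{n>0} a^∨_{i,-n} / (1 - p^{*n}) (q^{c/2} p^* z)^n)`. -/
def uPlus (i : D.I) : ℤ → D.Smash⟦X⟧ :=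
  inZ (pexp (posSer fun n => ofCoef (PowerSeries.C (scal (-D.qdiff i) * cpow n) *
    (invOneSub pstar n * pstar ^ n)) * PowerSeries.C (a i (-n))))

/-- `u_i^-(z, p) = exp((q_i - q_i⁻¹) ∑_{n>0} a^∨_{i,n} / (1 - p^n) (q^{c/2} p⁻¹ z)^{-n})`. -/
def uMinus (i : D.I) : ℤ → D.Smash⟦X⟧ :=
  inZInv (pexp (posSer fun n => ofCoef (PowerSeries.C (scal (D.qdiff i) * cpow (-n)) *
    (invOneSub pp n * pp ^ n)) * PowerSeries.C (a i n)))

end Smash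

/-! ### The elliptic quantum toroidal algebra -/

/-- Generators `α^∨_{i,l}`, `x^±_{i,n}`, `K_i^±`, `q^{±d}`, `e^{Q_α}` and `g(h, P) ∈ F`. -/
inductive EGen : Type
  | al (i : D.I) (l : {l : ℤ // l ≠ 0})
  | x (ε : ℤˣ) (i : D.I) (n : ℤ)
  | K (ε : ℤˣ) (i : D.I)
  | qd (ε : ℤˣ)
  | eQ (α : D.I → ℤ)
  | fn (g : D.Mer)

abbrev EFree : Type := FreeAlgebra Coef D.EGen

namespace EFree
variable {D}
def gen (g : D.EGen) : D.EFree := FreeAlgebra.ι Coef g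
def al (i : D.I) (l : ℤ) : D.EFree := if h : l ≠ 0 then gen (.al i ⟨l, h⟩) else 0
def x (ε : ℤˣ) (i : D.I) (n : ℤ) : D.EFree := gen (.x ε i n)
def K (ε : ℤˣ) (i : D.I) : D.EFree := gen (.K ε i)
def qd (ε : ℤˣ) : D.EFree := gen (.qd ε)
def eQ (α : D.I → ℤ) : D.EFree := gen (.eQ α)
def fn (g : D.Mer) : D.EFree := gen (.fn g)

/-- `exp(c ∑_{n>0} α^∨_{i,-n} / (1 - p^n) (t z)^n)` for `t = 1` or `t = p`. -/
def expNeg (c : ℂ) (t : Coef⟦X⟧) (i : D.I) : ℤ → D.EFree⟦X⟧ :=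
  inZ (pexp (posSer fun n => ofCoef (PowerSeries.C (scal c) * (t ^ n * invOneSub pp n)) *
    PowerSeries.C (al i (-n))))

/-- `exp(c ∑_{n>0} α^∨_{i,n} / (1 - p^n) (z / t)^{-n})` for `t = 1` or `t = p`. -/
def expPos (c : ℂ) (t : Coef⟦X⟧) (i : D.I) : ℤ → D.EFree⟦X⟧ :=
  inZInv (pexp (posSer fun n => ofCoef (PowerSeries.C (scal c) * (t ^ n * invOneSub pp n)) *
    PowerSeries.C (al i n)))

/-- `φ_i^±(q^{±c/2} z)`, by its defining formula. -/
def phiShifted (ε : ℤˣ) (i : D.I) : ℤ → D.EFree⟦X⟧ := fun n =>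
  PowerSeries.C (K ε i) * mulDist (expNeg (-D.qdiff i) (if ε = 1 then pp else 1) i)
    (expPos (D.qdiff i) (if ε = 1 then 1 else pp) i) n

/-- `φ_i^±(z)`. -/
def phi (ε : ℤˣ) (i : D.I) : ℤ → D.EFree⟦X⟧ := scaleArg (-(ε : ℤ)) (phiShifted ε i)

/-- `p^*` for the currents `x^+`, `p` for the currents `x^-`. -/
def nome (ε : ℤˣ) : Coef⟦X⟧ := if ε = 1 then pstar else pp

/-- `g_{ij}(ζ; p^*)` for `ε = 1` and `g_{ij}(ζ; p)⁻¹` for `ε = -1`. -/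
def gg {ι : Type} (ε : ℤˣ) (i j : D.I) (ζ : LP ι) : (LP ι)⟦X⟧ :=
  D.gSer (ε * D.b i j) (nome ε) ζ

/-- The factor `∏_{k<m} g_{ii}(z_{σ(m)}/z_{σ(k)}) ∏_{t ≤ r} g_{ij}(κ^{-m_{ij}} w/z_{σ(t)})
∏_{t > r} g_{ij}(κ^{m_{ij}} z_{σ(t)}/w)` of the elliptic Serre relations.
The variables are `z_t = some t` and `w = none`. -/
def serreFactor (ε : ℤˣ) (i j : D.I) (s : ℕ) (σ : Equiv.Perm (Fin s)) (r : ℕ) :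
    (LP (Option (Fin s)))⟦X⟧ :=
  (∏ k : Fin s, ∏ m : Fin s,
      if k < m then gg ε i i (LP.frac 1 (some (σ m)) (some (σ k))) else 1) *
    ∏ t : Fin s, if t.val < r then gg ε i j (LP.frac (D.κ ^ (-D.m i j)) none (some (σ t)))
      else gg ε i j (LP.frac (D.κ ^ D.m i j) (some (σ t)) none)

/-- `x_i(z_{σ(1)}) ⋯ x_i(z_{σ(r)}) x_j(w) x_i(z_{σ(r+1)}) ⋯ x_i(z_{σ(s)})`. -/
def serreWord (ε : ℤˣ) (i j : D.I) (s : ℕ) (σ : Equiv.Perm (Fin s)) (r : ℕ)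
    (ν : Option (Fin s) → ℤ) : D.EFree :=
  ((List.ofFn fun t => x ε i (-ν (some (σ t)))).take r).prod * x ε j (-ν none) *
    ((List.ofFn fun t => x ε i (-ν (some (σ t)))).drop r).prod

end EFree

open EFree in
/-- The defining relations without infinite sums. -/
inductive ERelFin : D.EFree → D.EFree → Prop
  | fn_add (f g) : ERelFin (fn (f + g)) (fn f + fn g)
  | fn_mul (f g) : ERelFin (fn (f * g)) (fn f * fn g)
  | fn_const (z : ℂ) : ERelFin (fn (algebraMap ℂ D.Mer z)) (algebraMap Coef _ (scal z))
  | eQ_zero : ERelFin (eQ 0) 1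
  | eQ_add (α β) : ERelFin (eQ (α + β)) (eQ α * eQ β)
  | eQ_fn (α) (f) : ERelFin (eQ α * fn f) (fn (D.shift (-D.latVec (0, α)) f) * eQ α)
  | eQ_al (α) (i) (l : ℤ) : ERelFin (eQ α * al i l) (al i l * eQ α)
  | eQ_x (α) (ε : ℤˣ) (i) (n : ℤ) : ERelFin (eQ α * x ε i n) (x ε i n * eQ α)
  | eQ_K (α) (ε : ℤˣ) (i) : ERelFin (eQ α * K ε i) (K ε i * eQ α)
  | eQ_qd (α) (ε : ℤˣ) : ERelFin (eQ α * qd ε) (qd ε * eQ α)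
  /-- `K_i^+ K_i^- = e^{-2 Q_i}`. -/
  | K_inv (i) : ERelFin (K 1 i * K (-1) i) (eQ (Pi.single i (-2)))
  | central (ε : ℤˣ) (c : D.I → ℕ) (hc : D.A.mulVec (fun i => (c i : ℤ)) = 0) (g : D.EGen) :
      ERelFin ((List.ofFn fun i => K ε i ^ c i).prod * gen g)
        (gen g * (List.ofFn fun i => K ε i ^ c i).prod)
  /-- `g(h, P) x_j^+(z) = x_j^+(z) g(h + ⟨α_j, h⟩, P - ⟨Q_j, P⟩)`. -/
  | fn_xp (f) (j) (n : ℤ) :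
      ERelFin (fn f * x 1 j n) (x 1 j n * fn (D.shift (D.rootVec j - D.QVec j) f))
  /-- `g(h, P) x_j^-(z) = x_j^-(z) g(h - ⟨α_j, h⟩, P)`. -/
  | fn_xm (f) (j) (n : ℤ) : ERelFin (fn f * x (-1) j n) (x (-1) j n * fn (D.shift (-D.rootVec j) f))
  | fn_al (f) (i) (l : ℤ) : ERelFin (fn f * al i l) (al i l * fn f)
  | fn_qd (f) (ε : ℤˣ) : ERelFin (fn f * qd ε) (qd ε * fn f)
  /-- `g(h, P) K_j^± = K_j^± g(h, P - ⟨Q_j, P⟩)`. -/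
  | fn_K (f) (ε : ℤˣ) (j) : ERelFin (fn f * K ε j) (K ε j * fn (D.shift (-D.QVec j) f))
  | qd_inv (ε : ℤˣ) : ERelFin (qd ε * qd (-ε)) 1
  | qd_K (ε ε' : ℤˣ) (i) : ERelFin (qd ε * K ε' i) (K ε' i * qd ε)
  | qd_al (i) (l : ℤ) : ERelFin (qd 1 * al i l) (scal (D.q ^ l) • (al i l * qd 1))
  | qd_x (ε : ℤˣ) (i) (n : ℤ) : ERelFin (qd 1 * x ε i n) (scal (D.q ^ n) • (x ε i n * qd 1))
  | K_K (ε ε' : ℤˣ) (i j) : ERelFin (K ε i * K ε' j) (K ε' j * K ε i)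
  | K_al (ε : ℤˣ) (i j) (l : ℤ) : ERelFin (K ε i * al j l) (al j l * K ε i)
  | K_x (ε ε' : ℤˣ) (i j) (n : ℤ) :
      ERelFin (K ε i * x ε' j n)
        (scal (D.q ^ ((ε : ℤ) * (ε' : ℤ) * D.b i j)) • (x ε' j n * K ε i))

open EFree in
/-- All defining relations, in the algebra of power series in `p` over the free algebra. -/
inductive ERel : D.EFree⟦X⟧ → D.EFree⟦X⟧ → Prop
  | fin (u v : D.EFree) (h : D.ERelFin u v) : ERel (PowerSeries.C u) (PowerSeries.C v)
  | al_al (i j) (l m : ℤ) (hl : l ≠ 0) (hm : m ≠ 0) :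
      ERel (PowerSeries.C (al i l * al j m - al j m * al i l))
        (if l + m = 0 then
          ofCoef (PowerSeries.C (scal (D.str i j l / D.qdiff j) *
            (cpow (2 * l) - cpow (-(2 * l))) * cpow (-(2 * l))) * ratio l) else 0)
  | al_xp (i j) (l n : ℤ) (hl : l ≠ 0) :
      ERel (PowerSeries.C (al i l * x 1 j n - x 1 j n * al i l))
        (ofCoef (PowerSeries.C (scal (D.str i j l) * cpow (-(2 * l))) * ratio l) *
          PowerSeries.C (x 1 j (n + l)))
  | al_xm (i j) (l n : ℤ) (hl : l ≠ 0) :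
      ERel (PowerSeries.C (al i l * x (-1) j n - x (-1) j n * al i l))
        (PowerSeries.C (scal (-D.str i j l) • x (-1) j (n + l)))
  /-- The quadratic relations; the variables are `z = z_0`, `w = z_1`. -/
  | x_x (ε : ℤˣ) (i j) (ν : Fin 2 → ℤ) :
      ERel
        (act (PowerSeries.C (scal (D.κ ^ D.m i j) • LP.var 0 - scal (D.q ^ (ε * D.b i j)) • LP.var 1)
            * gg ε i j (LP.frac (D.κ ^ (-D.m i j)) 1 0))
          (fun ν => x ε i (-ν 0) * x ε j (-ν 1)) ν)
        (act (PowerSeries.C (scal (D.κ ^ D.m i j * D.q ^ (ε * D.b i j)) • LP.var 0 - LP.var 1)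
            * gg ε i j (LP.frac (D.κ ^ D.m i j) 0 1))
          (fun ν => x ε j (-ν 1) * x ε i (-ν 0)) ν)
  /-- The coefficient of `z^{-n} w^{-l}` in
  `[x_i^+(z), x_j^-(w)] = δ_{ij} / (q_i - q_i⁻¹) *
  (δ(q^c w/z) φ_i^+(q^{c/2} w) - δ(q^{-c} w/z) φ_i^-(q^{c/2} z))`. -/
  | xp_xm (i j) (n l : ℤ) :
      ERel (PowerSeries.C (x 1 i n * x (-1) j l - x (-1) j l * x 1 i n))
        (if i = j then scal (D.qdiff i)⁻¹ •
          (cpow (n - l) • phi 1 i (n + l) - cpow (l - n) • phi (-1) i (n + l)) else 0)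
  | serre (ε : ℤˣ) (i j) (hij : i ≠ j) (s : ℕ) (hs : (s : ℤ) = 1 - D.A i j)
      (ν : Option (Fin s) → ℤ) :
      ERel (∑ σ : Equiv.Perm (Fin s), ∑ r ∈ Finset.range (s + 1),
        scal ((-1) ^ r * D.qbinom i s r) •
          act (serreFactor ε i j s σ r) (serreWord ε i j s σ r) ν) 0

/-- The closure, in the `p`-adic topology, of the congruence generated by the relations:
two elements are identified if for every `n` they are so modulo `p^n`. -/
def ECon : RingCon D.EFree⟦X⟧ :=
  ⨅ n : ℕ, ringConGen fun u v => D.ERel u v ∨ (u = PowerSeries.X ^ n ∧ v = 0)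

/-- The elliptic quantum toroidal algebra `U_{q,κ,p}(g_tor)`: the topological algebra generated by
the above generators over `F[[p]]`, subject to the above relations. -/
abbrev UEll : Type := D.ECon.Quotient

namespace UEll
variable {D}

/-- The class of an element of the free topological algebra. -/
def cls (u : D.EFree⟦X⟧) : D.UEll := D.ECon.mk' u

def al (i : D.I) (l : ℤ) : D.UEll := cls (PowerSeries.C (EFree.al i l))
def x (ε : ℤˣ) (i : D.I) (n : ℤ) : D.UEll := cls (PowerSeries.C (EFree.x ε i n))
def K (ε : ℤˣ) (i : D.I) : D.UEll := cls (PowerSeries.C (EFree.K ε i))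
def qd (ε : ℤˣ) : D.UEll := cls (PowerSeries.C (EFree.qd ε))
def eQ (α : D.I → ℤ) : D.UEll := cls (PowerSeries.C (EFree.eQ α))
def phi (ε : ℤˣ) (i : D.I) (n : ℤ) : D.UEll := cls (EFree.phi ε i n)

/-- The elements `∑ g_n(h, P) p^n` of `F[[p]]`. -/
def fn (g : D.Mer⟦X⟧) : D.UEll := cls (PowerSeries.mk fun n => EFree.fn (coeff n g))

end UEll

end Datum

end EllTor

end

/-!
The isomorphism rests on a twisting argument. Let `Ψ` be the homomorphism from the free topological
algebra on the generators of the elliptic algebra to the completed smash product given by the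
formulas of the theorem on generators (`ellHom`, extended to power series in `p` by `ellExt`). All
relations are checked modulo `p ^ N`, in rings in which `p ^ N = 0` and the sums over powers of `p`
are finite (`IsEval`). This suffices, since a power series over the smash product is determined by
its classes modulo the powers of `p` (`eq_of_trunc_eq`), and the congruence defining the elliptic
algebra is the intersection over `N` of those generated by its relations and `p ^ N = 0`
(`eCon_iff`).

Modulo `p ^ N`, the currents `x_i^±` are the `X_i^+(z) e^{-Q_i}` and `X_i^-(z)`, multiplied by the
exponentials `u_i^+` from the left (`twist`) and `u_i^-` from the right (`twistR`). Multiplication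
by such an exponential is an invertible operator on distributions, and moving it past another
current produces a scalar factor, which turns out to be the structure function `g_{ij}(z; p^*)`,
respectively `g_{ij}(z; p)^{-1}` (`Gop_gSer`). Hence a word in the `x^±`, times the structure
functions of all pairs of its letters, is an invertible operator, independent of the order of the
letters, applied to the word in the `X^±` (`sum_actN_word_twist_eq_zero_iff`; the case of `x^-` is
reduced to the opposite ring). So the quadratic and Serre relations for the `x^±` are equivalent to
those for the `X^±` (`X_X_iff`, `serre_iff`). In the commutator of `x_i^+` and `x_j^-` the two
exchange factors are inverse to each other (`hP_mul_sM`), which leaves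
`u_i^+(z) [X_i^+(z), X_j^-(w)] e^{-Q_i} u_j^-(w)` (`commutator_x`); comparing with
`φ_i^± = u_i^+ Φ_i^± u_i^- e^{-Q_i}` (`map_phi`) shows that this relation, too, is equivalent to the
one for the `X^±` (`Xp_Xm_iff`).

One direction of these equivalences shows that `Ψ` factors through the elliptic algebra
(`IsTor.map_eq_of_eRel`). The other shows that in the elliptic algebra modulo `p ^ N` the untwisted
generators satisfy the relations of the smash product (`IsEll.isTor`). By the universal property of
the smash product (`smashHom`) they define a homomorphism back, which inverts `Ψ` modulo `p ^ N`;
this gives injectivity (`eCon_of_ellExt_eq`). Finally, at `p = 0` the images of the generators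
generate the smash product (`exists_ellHom`), and surjectivity follows by successive approximation
(`diagHom_surjective`).
-/

noncomputable section

namespace EllTor

/-! ### Exponentials of power series over a noncommutative ring -/

section Exp
variable {R : Type} [Ring R] [Algebra Coef R]

theorem coeff_pow_eq_zero {f : R⟦X⟧} (hf : coeff 0 f = 0) {n k : ℕ} (h : n < k) :
    coeff n (f ^ k) = 0 := by
  have hX : (PowerSeries.X : R⟦X⟧) ^ k ∣ f ^ k := by
    obtain ⟨g, rfl⟩ := PowerSeries.X_dvd_iff.mpr (by simpa using hf)
    exact ⟨g ^ k, (PowerSeries.commute_X g).symm.mul_pow k⟩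
  exact PowerSeries.X_pow_dvd_iff.mp hX n h

/-- The inner sum in the definition of `pexp` may be extended, since `f ^ k` has order at
least `k`. -/
theorem coeff_pexp {f : R⟦X⟧} (hf : coeff 0 f = 0) {n K : ℕ} (h : n < K) :
    coeff n (pexp f) = ∑ k ∈ Finset.range K, scal ((k.factorial : ℂ)⁻¹) • coeff n (f ^ k) := by
  rw [pexp, PowerSeries.coeff_mk]
  refine Finset.sum_subset (Finset.range_mono h) fun k _ hk => ?_
  rw [coeff_pow_eq_zero hf (by simpa using hk), smul_zero]

theorem coeff_mul_pexp {f : R⟦X⟧} (hf : coeff 0 f = 0) (g : R⟦X⟧) {n K : ℕ} (h : n < K) :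
    coeff n (g * pexp f) =
      ∑ k ∈ Finset.range K, scal ((k.factorial : ℂ)⁻¹) • coeff n (g * f ^ k) := by
  simp only [PowerSeries.coeff_mul, Finset.smul_sum]
  rw [Finset.sum_comm]
  refine Finset.sum_congr rfl fun x hx => ?_
  have hx2 : x.2 ≤ n := (Finset.HasAntidiagonal.mem_antidiagonal.mp hx) ▸ Nat.le_add_left _ _
  rw [coeff_pexp hf (hx2.trans_lt h), Finset.mul_sum]
  simp

theorem coeff_pexp_mul {f : R⟦X⟧} (hf : coeff 0 f = 0) (g : R⟦X⟧) {n K : ℕ} (h : n < K) :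
    coeff n (pexp f * g) =
      ∑ k ∈ Finset.range K, scal ((k.factorial : ℂ)⁻¹) • coeff n (f ^ k * g) := by
  simp only [PowerSeries.coeff_mul, Finset.smul_sum]
  rw [Finset.sum_comm]
  refine Finset.sum_congr rfl fun x hx => ?_
  have hx1 : x.1 ≤ n := (Finset.HasAntidiagonal.mem_antidiagonal.mp hx) ▸ Nat.le_add_right _ _
  rw [coeff_pexp hf (hx1.trans_lt h), Finset.sum_mul]
  simp

@[simp] theorem coeff_zero_pexp (f : R⟦X⟧) : coeff 0 (pexp f) = 1 := by
  simp [pexp, scal]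

theorem pexp_zero : pexp (0 : R⟦X⟧) = 1 := by
  ext n
  rw [coeff_pexp (by simp) (Nat.lt_succ_self n), Finset.sum_range_succ']
  simp [scal]

/-- A family of additive maps, one for each degree, that is multiplicative across degrees
induces a map of power series which commutes with the exponential. -/
theorem coeff_pexp_graded {S : Type} [Ring S] [Algebra Coef S] (h : ℕ → R →+ S)
    (h_one : h 0 1 = 1) (h_mul : ∀ i j a b, h (i + j) (a * b) = h i a * h j b)
    (h_smul : ∀ n (c : Coef) a, h n (c • a) = c • h n a)
    {f : R⟦X⟧} {g : S⟦X⟧} (hg : ∀ n, coeff n g = h n (coeff n f)) (n : ℕ) :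
    coeff n (pexp g) = h n (coeff n (pexp f)) := by
  have hpow : ∀ k n, coeff n (g ^ k) = h n (coeff n (f ^ k)) := by
    intro k
    induction k with
    | zero =>
      intro n
      rw [pow_zero, pow_zero, PowerSeries.coeff_one, PowerSeries.coeff_one]
      split_ifs with hn
      · rw [hn, h_one]
      · rw [map_zero]
    | succ k ih =>
      intro n
      rw [pow_succ, pow_succ, PowerSeries.coeff_mul, PowerSeries.coeff_mul, map_sum]
      refine Finset.sum_congr rfl fun x hx => ?_
      rw [ih, hg, ← h_mul, Finset.HasAntidiagonal.mem_antidiagonal.mp hx]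
  simp only [pexp, PowerSeries.coeff_mk, map_sum, h_smul, hpow]

theorem map_pexp {S : Type} [Ring S] [Algebra Coef S] (φ : R →ₐ[Coef] S) (f : R⟦X⟧) :
    PowerSeries.map (φ : R →+* S) (pexp f) = pexp (PowerSeries.map (φ : R →+* S) f) := by
  ext n
  rw [PowerSeries.coeff_map]
  exact (coeff_pexp_graded (fun _ => (φ : R →+* S).toAddMonoidHom) (map_one φ)
    (fun _ _ a b => map_mul φ a b) (fun _ c a => map_smul φ c a)
    (fun n => PowerSeries.coeff_map _ n f) n).symm

/-- An intertwining relation passes to exponentials. -/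
theorem mul_coeff_pexp {y : R} {f g : R⟦X⟧} (h : ∀ n, y * coeff n f = coeff n g * y)
    (n : ℕ) : y * coeff n (pexp f) = coeff n (pexp g) * y := by
  have hC : PowerSeries.C y * f = g * PowerSeries.C y := by
    ext n; simpa using h n
  have hk : ∀ k, PowerSeries.C y * f ^ k = g ^ k * PowerSeries.C y := fun k =>
    (SemiconjBy.pow_right (show SemiconjBy (PowerSeries.C y) f g from hC) k)
  simp only [pexp, PowerSeries.coeff_mk, Finset.mul_sum, Finset.sum_mul]
  refine Finset.sum_congr rfl fun k _ => ?_
  have := congrArg (coeff n) (hk k)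
  rw [PowerSeries.coeff_C_mul, PowerSeries.coeff_mul_C] at this
  rw [mul_smul_comm, this, smul_mul_assoc]

theorem scal_factorial_succ (k : ℕ) (x : R) :
    scal (((k + 1).factorial : ℂ)⁻¹) • (((k + 1 : ℕ) : R) * x) =
      scal ((k.factorial : ℂ)⁻¹) • x := by
  have h1 : ((k + 1 : ℕ) : R) * x = scal ((k + 1 : ℕ) : ℂ) • x := by
    rw [← nsmul_eq_mul, show scal ((k + 1 : ℕ) : ℂ) = ((k + 1 : ℕ) : Coef) from map_natCast _ _,
      Nat.cast_smul_eq_nsmul]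
  have hk : ((k + 1 : ℕ) : ℂ) ≠ 0 := by exact_mod_cast k.succ_ne_zero
  rw [h1, smul_smul, scal, scal, ← map_mul, Nat.factorial_succ, Nat.cast_mul, mul_inv, mul_comm,
    mul_inv_cancel_left₀ hk]
  rfl

/-- If the commutator `T` of `D` with `f` commutes with `f`, then `[D, exp f] = T exp f`. -/
theorem commutator_pexp {D f T : R⟦X⟧} (hf : coeff 0 f = 0)
    (hT : D * f = f * D + T) (hTf : Commute T f) :
    D * pexp f = pexp f * D + T * pexp f := by
  have hk : ∀ k : ℕ, D * f ^ k = f ^ k * D + ((k : ℕ) : R⟦X⟧) * (T * f ^ (k - 1)) := by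
    intro k
    induction k with
    | zero => simp
    | succ k ih =>
      rw [pow_succ', ← mul_assoc, hT, add_mul, mul_assoc, ih]
      have : f * (((k : ℕ) : R⟦X⟧) * (T * f ^ (k - 1))) = ((k : ℕ) : R⟦X⟧) * (T * f ^ k) := by
        rcases k with _ | k
        · simp
        · rw [← mul_assoc, ← (Nat.cast_commute _ f).eq, mul_assoc, ← mul_assoc f, ← hTf.eq,
            mul_assoc, ← pow_succ']
          simp
      rw [mul_add, this, Nat.add_sub_cancel, Nat.cast_succ, add_mul, one_mul, mul_assoc f]
      abel
  ext n
  rw [coeff_mul_pexp hf D (Nat.lt_add_of_pos_right (n := n) (k := 2) (by norm_num)), map_add,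
    coeff_pexp_mul hf D (Nat.lt_add_of_pos_right (n := n) (k := 2) (by norm_num)),
    coeff_mul_pexp hf T (Nat.lt_succ_self n)]
  simp only [hk, map_add, smul_add, Finset.sum_add_distrib]
  congr 1
  rw [Finset.sum_range_succ']
  simp only [Nat.cast_zero, zero_mul, map_zero, smul_zero, add_zero, Nat.add_sub_cancel]
  refine Finset.sum_congr rfl fun k _ => ?_
  rw [show ((k + 1 : ℕ) : R⟦X⟧) = PowerSeries.C ((k + 1 : ℕ) : R) from (map_natCast _ _).symm,
    PowerSeries.coeff_C_mul, scal_factorial_succ]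

theorem coeff_pow_mul_pow {f g : R⟦X⟧} (hf : coeff 0 f = 0) (hg : coeff 0 g = 0) {n j k : ℕ}
    (h : n < j + k) : coeff n (f ^ j * g ^ k) = 0 := by
  rw [PowerSeries.coeff_mul]
  refine Finset.sum_eq_zero fun x hx => ?_
  have := Finset.HasAntidiagonal.mem_antidiagonal.mp hx
  rcases lt_or_ge x.1 j with h1 | h1
  · rw [coeff_pow_eq_zero hf h1, zero_mul]
  · rw [coeff_pow_eq_zero hg (show x.2 < k by omega), mul_zero]

theorem pexp_add {f g : R⟦X⟧} (hf : coeff 0 f = 0) (hg : coeff 0 g = 0) (h : Commute f g) :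
    pexp (f + g) = pexp f * pexp g := by
  ext n
  rw [coeff_pexp (by rw [map_add, hf, hg, add_zero]) (Nat.lt_succ_self n),
      coeff_pexp_mul hf _ (Nat.lt_succ_self n)]
  have h1 : ∀ j, coeff n (f ^ j * pexp g) = ∑ k ∈ Finset.range (n + 1),
      scal ((k.factorial : ℂ)⁻¹) • coeff n (f ^ j * g ^ k) := fun j =>
    coeff_mul_pexp hg _ (Nat.lt_succ_self n)
  simp only [h1, h.add_pow', map_sum, Finset.smul_sum]
  rw [← Finset.sum_product']
  rw [Finset.sum_sigma', ← Finset.sum_filter_of_ne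
      (s := Finset.range (n + 1) ×ˢ Finset.range (n + 1))
    (p := fun x => x.1 + x.2 < n + 1)]
  · refine Finset.sum_bij' (fun x _ => x.2) (fun x _ => ⟨x.1 + x.2, x⟩) ?_ ?_ ?_ ?_ ?_
    · rintro ⟨m, i, j⟩ hx
      simp only [Finset.mem_sigma, Finset.mem_range, Finset.HasAntidiagonal.mem_antidiagonal,
          Finset.mem_filter,
        Finset.mem_product] at hx ⊢
      omega
    · rintro ⟨i, j⟩ hx
      simp only [Finset.mem_sigma, Finset.mem_range, Finset.HasAntidiagonal.mem_antidiagonal,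
        Finset.mem_filter, Finset.mem_product, and_true] at hx ⊢
      omega
    · rintro ⟨m, i, j⟩ hx
      simp only [Finset.mem_sigma, Finset.HasAntidiagonal.mem_antidiagonal] at hx
      obtain ⟨_, rfl⟩ := hx
      rfl
    · rintro ⟨i, j⟩ _
      rfl
    · rintro ⟨m, i, j⟩ hx
      simp only [Finset.mem_sigma, Finset.HasAntidiagonal.mem_antidiagonal] at hx
      obtain ⟨_, rfl⟩ := hx
      have hc := Nat.choose_mul_factorial_mul_factorial (Nat.le_add_right i j)
      have hi : ((i.factorial : ℕ) : ℂ) ≠ 0 := by exact_mod_cast i.factorial_ne_zero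
      have hj : ((j.factorial : ℕ) : ℂ) ≠ 0 := by exact_mod_cast j.factorial_ne_zero
      have hij : (((i + j).factorial : ℕ) : ℂ) ≠ 0 := by exact_mod_cast (i + j).factorial_ne_zero
      have hc' : (((i + j).choose i : ℕ) : ℂ) * i.factorial * j.factorial = (i + j).factorial := by
        rw [Nat.add_sub_cancel_left] at hc
        exact_mod_cast hc
      have h2 : ((i + j).choose i) • (f ^ i * g ^ j) =
          scal (((i + j).choose i : ℕ) : ℂ) • (f ^ i * g ^ j) := by
        rw [show scal (((i + j).choose i : ℕ) : ℂ) = (((i + j).choose i : ℕ) : Coef) from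
          map_natCast _ _, Nat.cast_smul_eq_nsmul]
      simp only
      rw [h2, PowerSeries.coeff_smul, smul_smul, smul_smul, scal, scal, scal, scal, ← map_mul,
        ← map_mul]
      congr 2
      rw [← hc']
      have hch : (((i + j).choose i : ℕ) : ℂ) ≠ 0 := by
        intro h0; rw [h0, zero_mul, zero_mul] at hc'; exact hij hc'.symm
      field_simp
  · rintro ⟨i, j⟩ _ hne
    by_contra hlt
    refine hne ?_
    simp only
    rw [coeff_pow_mul_pow hf hg (by simp only at hlt; omega), smul_zero, smul_zero]

theorem pexp_neg_mul_pexp {f : R⟦X⟧} (hf : coeff 0 f = 0) : pexp (-f) * pexp f = 1 := by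
  rw [← pexp_add (by rw [map_neg, hf, neg_zero]) hf (Commute.neg_left rfl), neg_add_cancel,
      pexp_zero]

theorem pexp_mul_pexp_neg {f : R⟦X⟧} (hf : coeff 0 f = 0) : pexp f * pexp (-f) = 1 := by
  rw [← pexp_add hf (by rw [map_neg, hf, neg_zero]) (Commute.neg_right rfl), add_neg_cancel,
      pexp_zero]

@[simp] theorem coeff_zero_posSer (c : ℕ → R) : coeff 0 (posSer c) = 0 := by simp [posSer]

theorem coeff_posSer (c : ℕ → R) (n : ℕ) : coeff n (posSer c) = if n = 0 then 0 else c n := by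
  simp [posSer]

theorem commute_of_coeff {f g : R⟦X⟧} (h : ∀ m n, Commute (coeff m f) (coeff n g)) :
    Commute f g := by
  ext n
  rw [PowerSeries.coeff_mul, PowerSeries.coeff_mul, ← Finset.Nat.sum_antidiagonal_swap]
  exact Finset.sum_congr rfl fun x _ => (h _ _).eq

theorem commute_posSer {c c' : ℕ → R} (h : ∀ m n, Commute (c m) (c' n)) :
    Commute (posSer c) (posSer c') :=
  commute_of_coeff fun m n => by
    rw [coeff_posSer, coeff_posSer]
    split_ifs <;> simp [h m n]

theorem commute_coeff_pexp {y : R} {f : R⟦X⟧} (h : ∀ n, Commute y (coeff n f)) (n : ℕ) :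
    Commute y (coeff n (pexp f)) :=
  mul_coeff_pexp h n

/-- The exponential of `f(t z)`. -/
theorem coeff_pexp_posSer_smul (t : R) (ht : ∀ r, Commute t r) (c : ℕ → R) (n : ℕ) :
    coeff n (pexp (posSer fun n => t ^ n * c n)) = t ^ n * coeff n (pexp (posSer c)) := by
  refine coeff_pexp_graded (fun n => AddMonoidHom.mulLeft (t ^ n)) (by simp) ?_ ?_ ?_ n
  · intro i j a b
    simp only [AddMonoidHom.coe_mulLeft, pow_add]
    rw [mul_assoc, mul_assoc, ← mul_assoc (t ^ j), ← mul_assoc a, ((ht a).pow_left j).eq]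
  · intro n c a; simp
  · intro n
    rw [coeff_posSer, coeff_posSer]
    split_ifs <;> simp

end Exp

theorem exists_eq_sum_add {A : Type} [Ring A] (N : ℕ) (f : A⟦X⟧) :
    ∃ g, f = ∑ e ∈ Finset.range N, PowerSeries.X ^ e * PowerSeries.C (coeff e f) +
      PowerSeries.X ^ N * g := by
  have h : (PowerSeries.X : A⟦X⟧) ^ N ∣
      f - ∑ e ∈ Finset.range N, PowerSeries.X ^ e * PowerSeries.C (coeff e f) := by
    rw [PowerSeries.X_pow_dvd_iff]
    intro m hm
    rw [map_sub, map_sum, Finset.sum_eq_single_of_mem m (Finset.mem_range.mpr hm)]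
    · simp [PowerSeries.coeff_X_pow]
    · intro e _ he
      simp [PowerSeries.coeff_X_pow, he.symm]
  obtain ⟨g, hg⟩ := h
  exact ⟨g, by rw [← hg]; abel⟩

/-! ### Evaluation of power series at a nilpotent central element -/

/-- The coefficient ring `ℂ[q^{±c/2}][[p]]`. -/
abbrev Lam : Type := Coef⟦X⟧

section Eval
variable {R : Type} [Ring R] [Algebra Lam R]

variable (R) in
/-- The image of `p`. -/
def pR : R := algebraMap Lam R pp

theorem commute_pR (r : R) : Commute (pR R) r := Algebra.commutes _ _

theorem pp_pow_smul (n : ℕ) (r : R) : (pp ^ n : Lam) • r = pR R ^ n * r := by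
  rw [Algebra.smul_def, map_pow]; rfl

/-- The value of a power series at `p`, provided that `p ^ N = 0`. -/
def evp (N : ℕ) (f : R⟦X⟧) : R := ∑ e ∈ Finset.range N, pR R ^ e * coeff e f

theorem pR_pow_eq_zero {N : ℕ} (hN : pR R ^ N = 0) {n : ℕ} (h : N ≤ n) : pR R ^ n = 0 := by
  obtain ⟨k, rfl⟩ := Nat.exists_eq_add_of_le h
  rw [pow_add, hN, zero_mul]

theorem evp_eq_of_le {N K : ℕ} (hN : pR R ^ N = 0) (h : N ≤ K) (f : R⟦X⟧) :
    evp K f = evp N f := by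
  refine (Finset.sum_subset (Finset.range_mono h) fun e _ he => ?_).symm
  rw [pR_pow_eq_zero hN (by simpa using he), zero_mul]

theorem evp_add (N : ℕ) (f g : R⟦X⟧) : evp N (f + g) = evp N f + evp N g := by
  simp [evp, mul_add, Finset.sum_add_distrib]

theorem evp_zero (N : ℕ) : evp N (0 : R⟦X⟧) = 0 := by simp [evp]

theorem evp_neg (N : ℕ) (f : R⟦X⟧) : evp N (-f) = -evp N f := by simp [evp]

theorem evp_C {N : ℕ} (hN : pR R ^ N = 0) (r : R) : evp N (PowerSeries.C r) = r := by
  rw [← evp_eq_of_le hN (Nat.le_succ N), evp, Finset.sum_range_succ']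
  simp [PowerSeries.coeff_C]

theorem evp_mul {N : ℕ} (hN : pR R ^ N = 0) (f g : R⟦X⟧) :
    evp N (f * g) = evp N f * evp N g := by
  rw [← evp_eq_of_le hN (show N ≤ N + N by omega) (f * g), evp, evp, evp, Finset.sum_mul_sum]
  have h1 : ∀ i j, pR R ^ i * coeff i f * (pR R ^ j * coeff j g) =
      pR R ^ (i + j) * (coeff i f * coeff j g) := by
    intro i j
    rw [pow_add, mul_assoc, ← mul_assoc (coeff i f), ← ((commute_pR (coeff i f)).pow_left j).eq]
    simp only [mul_assoc]
  simp only [h1, PowerSeries.coeff_mul, Finset.mul_sum]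
  rw [← Finset.sum_product', Finset.sum_sigma',
    ← Finset.sum_filter_of_ne (s := (Finset.range (N + N)).sigma _)
      (p := fun x => x.2.1 < N ∧ x.2.2 < N)]
  · refine Finset.sum_bij' (fun x _ => x.2) (fun x _ => ⟨x.1 + x.2, x⟩) ?_ ?_ ?_ ?_ ?_
    · rintro ⟨m, i, j⟩ hx
      simp only [Finset.mem_sigma, Finset.mem_range, Finset.HasAntidiagonal.mem_antidiagonal,
          Finset.mem_filter,
        Finset.mem_product] at hx ⊢
      omega
    · rintro ⟨i, j⟩ hx
      simp only [Finset.mem_sigma, Finset.mem_range, Finset.HasAntidiagonal.mem_antidiagonal,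
        Finset.mem_filter, Finset.mem_product, and_true] at hx ⊢
      omega
    · rintro ⟨m, i, j⟩ hx
      simp only [Finset.mem_sigma, Finset.HasAntidiagonal.mem_antidiagonal, Finset.mem_filter] at hx
      obtain ⟨⟨_, rfl⟩, _⟩ := hx
      rfl
    · rintro ⟨i, j⟩ _
      rfl
    · rintro ⟨m, i, j⟩ hx
      simp only [Finset.mem_sigma, Finset.HasAntidiagonal.mem_antidiagonal, Finset.mem_filter] at hx
      obtain ⟨⟨_, rfl⟩, _⟩ := hx
      rfl
  · rintro ⟨m, i, j⟩ hx hne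
    simp only [Finset.mem_sigma, Finset.HasAntidiagonal.mem_antidiagonal] at hx
    by_contra hlt
    refine hne ?_
    rw [pR_pow_eq_zero hN (by have h2 := hx.2; simp only [not_and_or] at hlt h2 ⊢; omega), zero_mul]

theorem evp_one {N : ℕ} (hN : pR R ^ N = 0) : evp N (1 : R⟦X⟧) = 1 := evp_C hN 1

/-- Evaluation at `p` as a ring homomorphism. -/
def evpHom {N : ℕ} (hN : pR R ^ N = 0) : R⟦X⟧ →+* R where
  toFun := evp N
  map_one' := evp_one hN
  map_mul' := evp_mul hN
  map_zero' := evp_zero N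
  map_add' := evp_add N

/-- In a ring in which `p ^ N = 0`, a series in `Coef⟦X⟧` acts through its first `N`
coefficients. -/
theorem algebraMap_eq_sum [Algebra Coef R] [IsScalarTower Coef Lam R] {N : ℕ}
    (hN : pR R ^ N = 0) (h : Lam) :
    algebraMap Lam R h = ∑ e ∈ Finset.range N, pR R ^ e * algebraMap Coef R (coeff e h) := by
  obtain ⟨g, hg⟩ := exists_eq_sum_add N h
  conv_lhs => rw [hg]
  rw [map_add, map_mul, map_pow, show algebraMap Lam R PowerSeries.X = pR R from rfl, hN, zero_mul,
    add_zero, map_sum]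
  refine Finset.sum_congr rfl fun e _ => ?_
  rw [map_mul, map_pow, IsScalarTower.algebraMap_apply Coef Lam R]
  rfl

variable [Algebra Coef R]

/-- The truncated exponential `∑_{k < N} x^k / k!`. -/
def expN (N : ℕ) (x : R) : R := ∑ k ∈ Finset.range N, scal ((k.factorial : ℂ)⁻¹) • x ^ k

theorem evp_smul [IsScalarTower Coef Lam R] (N : ℕ) (c : Coef) (f : R⟦X⟧) :
    evp N (c • f) = c • evp N f := by
  simp [evp, Finset.smul_sum]

theorem evp_pexp [IsScalarTower Coef Lam R] {N : ℕ} (hN : pR R ^ N = 0) {f : R⟦X⟧}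
    (hf : coeff 0 f = 0) : evp N (pexp f) = expN N (evp N f) := by
  have hk : ∀ k, (evp N f) ^ k = evp N (f ^ k) := fun k => (map_pow (evpHom hN) f k).symm
  simp only [expN, hk]
  simp only [evp, Finset.smul_sum]
  rw [Finset.sum_comm]
  refine Finset.sum_congr rfl fun e he => ?_
  rw [coeff_pexp hf (Finset.mem_range.mp he), Finset.mul_sum]
  simp

theorem evp_posSer (N : ℕ) (c : ℕ → R) :
    evp N (posSer c) = ∑ n ∈ Finset.range N, if n = 0 then 0 else pR R ^ n * c n := by
  refine Finset.sum_congr rfl fun n _ => ?_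
  rw [coeff_posSer]; split_ifs <;> simp

end Eval
end EllTor

namespace EllTor

/-! ### Products over pairs and exchange relations -/

section Pairs

/-- The product of `g v w` over the pairs of entries `v`, `w` of a list with `v` before `w`. -/
def pairProd {ι B : Type} [Monoid B] (g : ι → ι → B) : List ι → B
  | [] => 1
  | v :: L => (L.map (g v)).prod * pairProd g L

theorem map_pairProd {ι B B' : Type} [Monoid B] [Monoid B'] (φ : B →* B') (g : ι → ι → B)
    (L : List ι) : φ (pairProd g L) = pairProd (fun v w => φ (g v w)) L := by
  induction L with
  | nil => simp [pairProd]
  | cons v L ih => simp [pairProd, ih, map_list_prod, Function.comp_def]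

theorem pairProd_congr {ι B : Type} [Monoid B] {g g' : ι → ι → B} {L : List ι} (hL : L.Nodup)
    (h : ∀ v w, v ≠ w → g v w = g' v w) : pairProd g L = pairProd g' L := by
  induction L with
  | nil => rfl
  | cons v L ih =>
    rw [List.nodup_cons] at hL
    rw [pairProd, pairProd, ih hL.2,
      List.map_congr_left fun w hw => h v w (by rintro rfl; exact hL.1 hw)]

theorem pairProd_append {ι B : Type} [CommMonoid B] (g : ι → ι → B) (L L' : List ι) :
    pairProd g (L ++ L') =
      pairProd g L * pairProd g L' * (L.map fun v => (L'.map (g v)).prod).prod := by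
  induction L with
  | nil => simp [pairProd]
  | cons v L ih =>
    simp only [List.cons_append, pairProd, ih, List.map_append, List.prod_append, List.map_cons,
      List.prod_cons]
    ac_rfl

theorem pairProd_reverse {ι B : Type} [CommMonoid B] (g : ι → ι → B) (L : List ι) :
    pairProd g L.reverse = pairProd (fun v w => g w v) L := by
  induction L with
  | nil => rfl
  | cons v L ih =>
    rw [List.reverse_cons, pairProd_append, ih, pairProd, pairProd, pairProd,
      ((List.reverse_perm L).map _).prod_eq]
    simp [mul_comm]

theorem commute_pairProd {ι B : Type} [Monoid B] {g : ι → ι → B} {b : B} {L : List ι}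
    (h : ∀ v ∈ L, ∀ w ∈ L, Commute b (g v w)) : Commute b (pairProd g L) := by
  induction L with
  | nil => exact Commute.one_right b
  | cons v L ih =>
    refine Commute.mul_right (Commute.list_prod_right _ _ ?_)
      (ih fun v hv w hw => h v (List.mem_cons_of_mem _ hv) w (List.mem_cons_of_mem _ hw))
    intro x hx
    obtain ⟨w, hw, rfl⟩ := List.mem_map.mp hx
    exact h v List.mem_cons_self w (List.mem_cons_of_mem _ hw)

/-- If moving `U w` to the left of `Y v` costs the factor `(g v w)⁻¹`, then a product of the
`U v * Y v` is, after multiplication by the factors of all pairs, the product of the `U v` times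
the product of the `Y v`. -/
theorem pairProd_mul_prod {ι B : Type} [Monoid B] (Y U : ι → B) (g : ι → ι → B)
    (hYU : ∀ v w, v ≠ w → g v w * (Y v * U w) = U w * Y v)
    (hgU : ∀ v w x, Commute (g v w) (U x)) (hgg : ∀ v w v' w', Commute (g v w) (g v' w'))
    (hgY : ∀ v w x, v ≠ x → w ≠ x → Commute (g v w) (Y x))
    {L : List ι} (hL : L.Nodup) :
    pairProd g L * (L.map fun v => U v * Y v).prod = (L.map U).prod * (L.map Y).prod := by
  have key : ∀ v (L : List ι), v ∉ L →
      (L.map (g v)).prod * (Y v * (L.map U).prod) = (L.map U).prod * Y v := by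
    intro v L hv
    induction L with
    | nil => simp
    | cons w L ih =>
      rw [List.mem_cons, not_or] at hv
      have h1 : Commute (g v w) (L.map (g v)).prod := Commute.list_prod_right _ _ (by
        intro x hx; obtain ⟨w', _, rfl⟩ := List.mem_map.mp hx; exact hgg _ _ _ _)
      have h2 : Commute (U w) (L.map (g v)).prod := Commute.list_prod_right _ _ (by
        intro x hx; obtain ⟨w', _, rfl⟩ := List.mem_map.mp hx; exact (hgU _ _ _).symm)
      simp only [List.map_cons, List.prod_cons]
      rw [h1.eq, mul_assoc, ← mul_assoc (Y v), ← mul_assoc (g v w), hYU v w hv.1, mul_assoc,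
        ← mul_assoc, ← h2.eq, mul_assoc, ih hv.2, mul_assoc]
  induction L with
  | nil => simp [pairProd]
  | cons v L ih =>
    rw [List.nodup_cons] at hL
    have h1 : Commute (U v) (pairProd g L) := commute_pairProd fun _ _ _ _ => (hgU _ _ _).symm
    have h2 : Commute (Y v) (pairProd g L) := commute_pairProd fun a ha b hb =>
      (hgY a b v (by rintro rfl; exact hL.1 ha) (by rintro rfl; exact hL.1 hb)).symm
    have h3 : Commute (U v) (L.map (g v)).prod := Commute.list_prod_right _ _ (by
        intro x hx; obtain ⟨w', _, rfl⟩ := List.mem_map.mp hx; exact (hgU _ _ _).symm)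
    simp only [List.map_cons, List.prod_cons, pairProd]
    rw [← mul_assoc, mul_assoc _ (pairProd g L), ← mul_assoc (pairProd g L), ← h1.eq,
      mul_assoc (U v), ← h2.eq, mul_assoc, mul_assoc, mul_assoc, ih hL.2, ← mul_assoc, ← h3.eq,
      mul_assoc, ← mul_assoc (Y v), ← mul_assoc _ (Y v * _), key v L hL.1]
    simp only [mul_assoc]

end Pairs

/-! ### Operators on formal distributions in several variables -/

section Operators
variable {ι R : Type} [DecidableEq ι] [Ring R] [Algebra Coef R] [Algebra Lam R]
  [IsScalarTower Coef Lam R]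

variable (ι R) in
/-- The algebra of operators on formal distributions; a distribution in the variables `z_v`,
`v : ι`, is the function sending `ν` to the coefficient of `z^ν`. -/
abbrev DEnd : Type := Module.End Lam ((ι → ℤ) → R)

theorem pR_pow_DEnd {N : ℕ} (hN : pR R ^ N = 0) : pR (DEnd ι R) ^ N = 0 := by
  ext F ν
  rw [pR, ← map_pow, Module.algebraMap_end_apply, Pi.smul_apply, pp_pow_smul, hN, zero_mul]
  rfl

theorem pR_pow_apply (n : ℕ) (F : (ι → ℤ) → R) (ν : ι → ℤ) :
    (pR (DEnd ι R) ^ n) F ν = pR R ^ n * F ν := by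
  rw [pR, ← map_pow, Module.algebraMap_end_apply, Pi.smul_apply, pp_pow_smul]

/-- Left multiplication by `r z^μ`. -/
def Lop (r : R) (μ : ι → ℤ) : DEnd ι R where
  toFun F ν := r * F (ν - μ)
  map_add' F G := by ext; simp [mul_add]
  map_smul' c F := by ext; simp

@[simp] theorem Lop_apply (r : R) (μ : ι → ℤ) (F : (ι → ℤ) → R) (ν : ι → ℤ) :
    Lop r μ F ν = r * F (ν - μ) := rfl

theorem Lop_mul (r s : R) (μ ρ : ι → ℤ) : Lop r μ * Lop s ρ = Lop (r * s) (μ + ρ) := by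
  ext F ν; simp [mul_assoc, sub_sub]

theorem Lop_one : Lop (1 : R) (0 : ι → ℤ) = 1 := by
  ext F ν; simp

theorem Lop_add (r s : R) (μ : ι → ℤ) : Lop (r + s) μ = Lop r μ + Lop s μ := by
  ext F ν; simp [add_mul]

theorem Lop_smul (c : Coef) (r : R) (μ : ι → ℤ) : Lop (c • r) μ = c • Lop r μ := by
  ext F ν; simp

theorem Lop_lam_smul (c : Lam) (r : R) (μ : ι → ℤ) : Lop (c • r) μ = c • Lop r μ := by
  ext F ν; simp

theorem commute_Lop {r s : R} (h : Commute r s) (μ ρ : ι → ℤ) : Commute (Lop r μ) (Lop s ρ) := by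
  rw [Commute, SemiconjBy, Lop_mul, Lop_mul, h.eq, add_comm]

/-- Multiplication by the current `y(z_v) = ∑ y_n z_v^{-n}` of the part of a distribution of
degree `0` in `z_v`. -/
def Yop (y : ℤ → R) (v : ι) : DEnd ι R where
  toFun F ν := y (-ν v) * F (Function.update ν v 0)
  map_add' F G := by ext; simp [mul_add]
  map_smul' c F := by ext; simp

@[simp] theorem Yop_apply (y : ℤ → R) (v : ι) (F : (ι → ℤ) → R) (ν : ι → ℤ) :
    Yop y v F ν = y (-ν v) * F (Function.update ν v 0) := rfl

theorem update_sub_of_apply_eq_zero {v : ι} {μ : ι → ℤ} (hμ : μ v = 0) (ν : ι → ℤ) :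
    Function.update (ν - μ) v 0 = Function.update ν v 0 - μ := by
  ext w
  by_cases hw : w = v
  · subst hw; simp [hμ]
  · simp [hw]

/-- A relation `[r, y(z)] = s z^d y(z)` as a relation between operators. -/
theorem Lop_mul_Yop {r : R} {y : ℤ → R} {s : Lam} {d : ℤ}
    (h : ∀ m, r * y m = y m * r + s • y (m + d)) {v : ι} {μ : ι → ℤ} (hμ : μ v = 0) :
    Lop r μ * Yop y v = Yop y v * Lop r μ + s • (Lop 1 (μ + Pi.single v d) * Yop y v) := by
  ext F ν
  have h2 : Function.update (ν - (μ + Pi.single v d)) v 0 = Function.update ν v 0 - μ := by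
    ext w
    by_cases hw : w = v
    · subst hw; simp [hμ]
    · simp [hw]
  simp only [Module.End.mul_apply, LinearMap.add_apply, LinearMap.smul_apply, Pi.add_apply,
    Pi.smul_apply, Lop_apply, Yop_apply, update_sub_of_apply_eq_zero hμ, h2, one_mul, ← mul_assoc]
  have e1 : -((ν - μ) v) = -ν v := by simp [hμ]
  have e2 : -((ν - (μ + Pi.single v d) : ι → ℤ) v) = -ν v + d := by simp [hμ]; ring
  rw [e1, e2, h, add_mul, smul_mul_assoc]

theorem commute_Lop_Yop {r : R} {y : ℤ → R} (h : ∀ m, Commute r (y m)) {v : ι} {μ : ι → ℤ}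
    (hμ : μ v = 0) : Commute (Lop r μ) (Yop y v) := by
  have := Lop_mul_Yop (r := r) (y := y) (s := 0) (d := 0) (fun m => by simp [(h m).eq]) hμ
  rw [Commute, SemiconjBy]
  simpa using this

variable (ι R) in
/-- Multiplication by a Laurent polynomial. -/
def Sop : LP ι →ₐ[Coef] DEnd ι R :=
  AddMonoidAlgebra.lift Coef _ _
    { toFun := fun μ => Lop 1 μ.toAdd
      map_one' := Lop_one
      map_mul' := fun μ ρ => by rw [Lop_mul, mul_one]; rfl }

theorem Sop_single (μ : ι → ℤ) (c : Coef) :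
    Sop ι R (AddMonoidAlgebra.single μ c) = c • Lop 1 μ := by
  rw [Sop, AddMonoidAlgebra.lift_single]; rfl

theorem Sop_apply (G : LP ι) (F : (ι → ℤ) → R) (ν : ι → ℤ) :
    Sop ι R G F ν = G.coeff.sum fun μ r => r • F (ν - μ) := by
  rw [Sop, AddMonoidAlgebra.lift_apply, Finsupp.sum, Finsupp.sum, LinearMap.sum_apply,
    Finset.sum_apply]
  simp

theorem commute_Sop_Lop (G : LP ι) (r : R) (μ : ι → ℤ) : Commute (Sop ι R G) (Lop r μ) := by
  induction G using AddMonoidAlgebra.induction_on with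
  | of m =>
    rw [AddMonoidAlgebra.of_apply, Sop_single]
    exact (commute_Lop (Commute.one_left r) _ _).smul_left _
  | add x y hx hy => rw [map_add]; exact hx.add_left hy
  | smul c x hx => rw [map_smul]; exact hx.smul_left c

/-- Multiplication by a power series in `p` whose coefficients are Laurent polynomials. -/
def Gop (N : ℕ) (G : (LP ι)⟦X⟧) : DEnd ι R :=
  evp N (PowerSeries.map (Sop ι R : LP ι →+* DEnd ι R) G)

variable {N : ℕ}

theorem Gop_mul (hN : pR R ^ N = 0) (G H : (LP ι)⟦X⟧) :
    (Gop N (G * H) : DEnd ι R) = Gop N G * Gop N H := by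
  rw [Gop, map_mul, evp_mul (pR_pow_DEnd hN)]; rfl

theorem Gop_one (hN : pR R ^ N = 0) : (Gop N (1 : (LP ι)⟦X⟧) : DEnd ι R) = 1 := by
  rw [Gop, map_one, evp_one (pR_pow_DEnd hN)]

theorem Gop_C (hN : pR R ^ N = 0) (A : LP ι) :
    (Gop N (PowerSeries.C A) : DEnd ι R) = Sop ι R A := by
  rw [Gop, PowerSeries.map_C, evp_C (pR_pow_DEnd hN)]; rfl

/-- The product of a power series in `p` whose coefficients are Laurent polynomials with a
distribution, at `p ^ N = 0`. -/
def actN (N : ℕ) (G : (LP ι)⟦X⟧) (F : (ι → ℤ) → R) (ν : ι → ℤ) : R :=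
  ∑ e ∈ Finset.range N, pR R ^ e * (coeff e G).coeff.sum fun μ r => r • F (ν - μ)

theorem Gop_apply (G : (LP ι)⟦X⟧) (F : (ι → ℤ) → R) : Gop N G F = actN N G F := by
  ext ν
  rw [Gop, evp, LinearMap.sum_apply, Finset.sum_apply]
  refine Finset.sum_congr rfl fun e _ => ?_
  rw [Module.End.mul_apply, pR_pow_apply, PowerSeries.coeff_map]
  exact congrArg _ (Sop_apply _ _ _)

/-! ### Currents multiplied by exponentials -/

/-- The operator of multiplication by `exp(∑_{n>0} c_n (p z_v^τ)^n)`. -/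
def Uop (N : ℕ) (τ : ℤ) (v : ι) (c : ℕ → R) : DEnd ι R :=
  evp N (pexp (posSer fun n => Lop (c n) (n • Pi.single v τ)))

/-- The current `exp(∑_{n>0} c_n (p z^τ)^n) y(z)`. -/
def twist (N : ℕ) (τ : ℤ) (c : ℕ → R) (y : ℤ → R) (n : ℤ) : R :=
  ∑ m ∈ Finset.range N, pR R ^ m * (coeff m (pexp (posSer c)) * y (n + τ * m))

/-- The current `y(z) exp(∑_{n>0} c_n (p z^τ)^n)`. -/
def twistR (N : ℕ) (τ : ℤ) (c : ℕ → R) (y : ℤ → R) (n : ℤ) : R :=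
  ∑ m ∈ Finset.range N, pR R ^ m * (y (n + τ * m) * coeff m (pexp (posSer c)))

theorem coeff_pexp_Lop (c : ℕ → R) (μ : ι → ℤ) (m : ℕ) :
    coeff m (pexp (posSer fun n => Lop (c n) (n • μ))) =
      Lop (coeff m (pexp (posSer c))) (m • μ) := by
  refine coeff_pexp_graded (fun n => ⟨⟨fun r => Lop r (n • μ), ?_⟩, ?_⟩) ?_ ?_ ?_ ?_ m
  · ext; simp
  · intro x y; exact Lop_add _ _ _
  · simp [Lop_one]
  · intro i j a b; simp [Lop_mul, add_smul]
  · intro n d a; exact Lop_smul _ _ _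
  · intro n
    rw [coeff_posSer, coeff_posSer]
    split_ifs
    · exact (map_zero _).symm
    · rfl

/-- Multiplication by a twisted current is the operator of the current followed by that of the
exponential. -/
theorem Yop_twist (τ : ℤ) (c : ℕ → R) (y : ℤ → R) (v : ι) :
    Yop (twist N τ c y) v = Uop N τ v c * Yop y v := by
  ext F ν
  rw [Module.End.mul_apply, Uop, evp, LinearMap.sum_apply, Finset.sum_apply, Yop_apply, twist,
    Finset.sum_mul]
  refine Finset.sum_congr rfl fun m _ => ?_
  rw [Module.End.mul_apply, pR_pow_apply, coeff_pexp_Lop]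
  have : Function.update (ν - m • Pi.single v τ) v 0 = Function.update ν v 0 := by
    ext w
    by_cases hw : w = v
    · subst hw; simp
    · simp [hw]
  have e1 : -((ν - m • Pi.single v τ : ι → ℤ) v) = -ν v + τ * m := by simp; ring
  rw [Lop_apply, Yop_apply, this, e1]
  simp only [mul_assoc]

theorem Uop_neg_mul (hN : pR R ^ N = 0) (τ : ℤ) (v : ι) (c : ℕ → R) :
    Uop N τ v (fun n => -c n) * Uop N τ v c = 1 := by
  have h : (posSer fun n => Lop (-c n) (n • Pi.single v τ) : (DEnd ι R)⟦X⟧) =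
      -posSer fun n => Lop (c n) (n • Pi.single v τ) := by
    ext n : 1
    rw [map_neg, coeff_posSer, coeff_posSer]
    split_ifs
    · simp
    · ext F ν; simp
  rw [Uop, Uop, ← evp_mul (pR_pow_DEnd hN), h, pexp_neg_mul_pexp (coeff_zero_posSer _),
    evp_one (pR_pow_DEnd hN)]

theorem Uop_mul_neg (hN : pR R ^ N = 0) (τ : ℤ) (v : ι) (c : ℕ → R) :
    Uop N τ v c * Uop N τ v (fun n => -c n) = 1 := by
  simpa using Uop_neg_mul hN τ v (fun n => -c n)

theorem Yop_one (y : ℤ → R) (n : ℤ) : Yop y () (fun _ => 1) (fun _ => -n) = y n := by simp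

theorem twist_eq_apply (τ : ℤ) (c : ℕ → R) (y : ℤ → R) (n : ℤ) :
    twist N τ c y n = (Uop N τ () c * Yop y ()) (fun _ => 1) (fun _ => -n) := by
  rw [← Yop_twist, Yop_one]

/-- Twisting is invertible, the inverse being twisting by the inverse exponential. -/
theorem twist_neg_twist (hN : pR R ^ N = 0) (τ : ℤ) (c : ℕ → R) (y : ℤ → R) :
    twist N τ (fun n => -c n) (twist N τ c y) = y := by
  ext n
  rw [twist_eq_apply, Yop_twist, ← mul_assoc, Uop_neg_mul hN, one_mul, Yop_one]

theorem twist_twist_neg (hN : pR R ^ N = 0) (τ : ℤ) (c : ℕ → R) (y : ℤ → R) :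
    twist N τ c (twist N τ (fun n => -c n) y) = y := by
  simpa using twist_neg_twist hN τ (fun n => -c n) y

theorem commute_Uop {B : DEnd ι R} {τ : ℤ} {v : ι} {c : ℕ → R}
    (h : ∀ n, n ≠ 0 → Commute B (Lop (c n) (n • Pi.single v τ))) : Commute B (Uop N τ v c) := by
  refine Commute.sum_right _ _ _ fun e _ => Commute.mul_right ((commute_pR B).pow_left e).symm ?_
  refine commute_coeff_pexp (fun n => ?_) e
  rw [coeff_posSer]
  split_ifs with hn
  · exact Commute.zero_right _
  · exact h n hn

/-- The factor produced by moving `exp(∑_{n>0} c_n p^n z^{nμ})` past a current `y` with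
`[c_n z^{nμ}, y] = s_n z^{nρ} y`. -/
def Eop (N : ℕ) (s : ℕ → Lam) (ρ : ι → ℤ) : DEnd ι R :=
  evp N (pexp (posSer fun n => s n • Lop 1 (n • ρ)))

/-- Moving `exp(∑ c_n (p z_w^τ)^n)` to the left of the current `y(z_v)` costs a scalar factor, the
exponential of the sum of the commutators `[c_n (p z_w^τ)^n, y(z_v)] = s_n (p (z_w / z_v)^τ)^n
y(z_v)`. -/
theorem Eop_mul_Yop_mul_Uop (hN : pR R ^ N = 0) {τ : ℤ} {c : ℕ → R} {y : ℤ → R} {s : ℕ → Lam}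
    (h : ∀ n m, n ≠ 0 → c n * y m = y m * c n + s n • y (m - τ * n)) {v w : ι} (hvw : v ≠ w) :
    Eop N s (Pi.single w τ - Pi.single v τ) * (Yop y v * Uop N τ w c) =
      Uop N τ w c * Yop y v := by
  set f : (DEnd ι R)⟦X⟧ := posSer fun n => Lop (c n) (n • Pi.single w τ)
  set g : (DEnd ι R)⟦X⟧ := posSer fun n => s n • Lop 1 (n • (Pi.single w τ - Pi.single v τ))
  have hf : coeff 0 f = 0 := coeff_zero_posSer _
  have hg : coeff 0 g = 0 := coeff_zero_posSer _
  have hfg : Commute g f := commute_posSer fun m n =>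
    (commute_Lop (Commute.one_left _) _ _).smul_left _
  have hY : ∀ n, Yop y v * coeff n f = coeff n (-g + f) * Yop y v := by
    intro n
    rw [map_add, map_neg, coeff_posSer, coeff_posSer]
    split_ifs with hn
    · simp
    · have := Lop_mul_Yop (ι := ι) (v := v) (μ := n • Pi.single w τ) (d := -(τ * n)) (s := s n)
        (fun m => by rw [h n m hn, sub_eq_add_neg]) (by simp [hvw])
      rw [show (n • Pi.single w τ + Pi.single v (-(τ * n)) : ι → ℤ) =
        n • (Pi.single w τ - Pi.single v τ) by
          rw [smul_sub, sub_eq_add_neg, Pi.single_neg]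
          congr 2
          ext x
          by_cases hx : x = v
          · subst hx; simp [mul_comm]
          · simp [hx]] at this
      have hneg : ∀ a b : DEnd ι R, -a * b = -(a * b) := fun a b => by ext; simp
      rw [add_mul, this, hneg, smul_mul_assoc]
      abel
  have hYU : Yop y v * evp N (pexp f) = evp N (pexp (-g + f)) * Yop y v := by
    rw [evp, evp, Finset.mul_sum, Finset.sum_mul]
    refine Finset.sum_congr rfl fun e _ => ?_
    rw [← mul_assoc, ← ((commute_pR (Yop y v)).pow_left e).eq, mul_assoc, mul_coeff_pexp hY,
      mul_assoc]
  have hg0 : coeff 0 (-g) = 0 := by rw [map_neg, hg, neg_zero]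
  rw [Eop, Uop, hYU, pexp_add hg0 hf hfg.neg_left, ← mul_assoc, ← evp_mul (pR_pow_DEnd hN),
    ← mul_assoc, pexp_mul_pexp_neg hg, one_mul]

theorem commute_Eop {B : DEnd ι R} {s : ℕ → Lam} {ρ : ι → ℤ}
    (h : ∀ n : ℕ, Commute B (Lop 1 (n • ρ))) : Commute B (Eop N s ρ) := by
  refine Commute.sum_right _ _ _ fun e _ => Commute.mul_right ((commute_pR B).pow_left e).symm ?_
  refine commute_coeff_pexp (fun n => ?_) e
  rw [coeff_posSer]
  split_ifs with hn
  · exact Commute.zero_right _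
  · exact (h n).smul_right _

theorem Eop_mul_Eop_of_neg (hN : pR R ^ N = 0) (s : ℕ → Lam) (ρ : ι → ℤ) :
    (Eop N (fun n => -s n) ρ : DEnd ι R) * Eop N s ρ = 1 := by
  have h : (posSer fun n => -s n • Lop 1 (n • ρ) : (DEnd ι R)⟦X⟧) =
      -posSer fun n => s n • Lop 1 (n • ρ) := by
    ext n : 1
    rw [map_neg, coeff_posSer, coeff_posSer]
    split_ifs
    · simp
    · ext F ν; simp
  rw [Eop, Eop, ← evp_mul (pR_pow_DEnd hN), h, pexp_neg_mul_pexp (coeff_zero_posSer _),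
    evp_one (pR_pow_DEnd hN)]

/-! ### Words in currents -/

/-- The distribution `∏ y_v(z_v)`, the product being taken in the order of the list. -/
def word (y : ι → ℤ → R) (L : List ι) (ν : ι → ℤ) : R := (L.map fun v => y v (-ν v)).prod

theorem prod_Yop_one (y : ι → ℤ → R) {L : List ι} (hL : L.Nodup) :
    (L.map fun v => Yop (y v) v).prod (fun _ => 1) = word y L := by
  induction L with
  | nil => ext; simp [word]
  | cons v L ih =>
    rw [List.nodup_cons] at hL
    ext ν
    rw [List.map_cons, List.prod_cons, Module.End.mul_apply, ih hL.2, Yop_apply, word, word,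
      List.map_cons, List.prod_cons]
    congr 2
    refine List.map_congr_left fun w hw => ?_
    rw [Function.update_of_ne (by rintro rfl; exact hL.1 hw)]

theorem isUnit_list_prod_Uop (hN : pR R ^ N = 0) (τ : ℤ) (c : ι → ℕ → R) (L : List ι) :
    IsUnit (L.map fun v => Uop N τ v (c v)).prod := by
  induction L with
  | nil => simp
  | cons v L ih =>
    rw [List.map_cons, List.prod_cons]
    exact (Units.mk _ _ (Uop_mul_neg hN τ v (c v)) (Uop_neg_mul hN τ v (c v))).isUnit.mul ih

/-- Sums of words in the currents `y'_v(z) = exp(∑ c_{v,n} (p z^τ)^n) y_v(z)`, multiplied by the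
exchange factors of all pairs of their letters, vanish if and only if the corresponding sums of
words in the `y_v(z)` vanish: both differ by the invertible operator
`∏_v exp(∑ c_{v,n} (p z_v^τ)^n)`. -/
theorem sum_actN_word_twist_eq_zero_iff (hN : pR R ^ N = 0) {τ : ℤ} {c : ι → ℕ → R}
    {y : ι → ℤ → R} {s : ι → ι → ℕ → Lam} {g : ι → ι → (LP ι)⟦X⟧}
    (hc : ∀ v w m n, Commute (c v m) (c w n))
    (h : ∀ v w n m, v ≠ w → n ≠ 0 →
      c w n * y v m = y v m * c w n + s v w n • y v (m - τ * n))
    (hg : ∀ v w, v ≠ w →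
      (Gop N (g v w) : DEnd ι R) = Eop N (s v w) (Pi.single w τ - Pi.single v τ))
    {K : Type} (S : Finset K) (A : K → LP ι) (L : K → List ι) (L₀ : List ι)
    (hL₀ : L₀.Nodup) (hL : ∀ k, (L k).Perm L₀) :
    ∑ k ∈ S, actN N (PowerSeries.C (A k) * pairProd g (L k))
        (word (fun v => twist N τ (c v) (y v)) (L k)) = 0 ↔
      ∑ k ∈ S, actN N (PowerSeries.C (A k)) (word y (L k)) = 0 := by
  set U : ι → DEnd ι R := fun v => Uop N τ v (c v)
  set Y : ι → DEnd ι R := fun v => Yop (y v) v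
  set e : ι → ι → DEnd ι R := fun v w => Eop N (s v w) (Pi.single w τ - Pi.single v τ)
  have heL : ∀ v w r (μ : ι → ℤ), Commute (e v w) (Lop r μ) := fun v w r μ =>
    (commute_Eop fun n => commute_Lop (Commute.one_right _) _ _).symm
  have heU : ∀ v w x, Commute (e v w) (U x) := fun v w x => commute_Uop fun n _ => heL _ _ _ _
  have hee : ∀ v w v' w', Commute (e v w) (e v' w') := fun v w v' w' =>
    commute_Eop fun n => heL _ _ _ _
  have heY : ∀ v w x, v ≠ x → w ≠ x → Commute (e v w) (Y x) := fun v w x hv hw =>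
    (commute_Eop fun n => (commute_Lop_Yop (fun m => Commute.one_left _)
      (by simp [hv.symm, hw.symm])).symm).symm
  have hUU : ∀ v w, Commute (U v) (U w) := fun v w =>
    commute_Uop fun n _ => (commute_Uop fun m _ => commute_Lop (hc _ _ _ _) _ _).symm
  have hGop : ∀ k, (Gop N (pairProd g (L k)) : DEnd ι R) = pairProd e (L k) := by
    intro k
    have h1 := map_pairProd (B' := DEnd ι R)
      (⟨⟨Gop N, Gop_one hN⟩, Gop_mul hN⟩ : (LP ι)⟦X⟧ →* DEnd ι R)
      g (L k)
    exact h1.trans (pairProd_congr ((hL k).nodup_iff.mpr hL₀) hg)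
  have key : ∀ k, actN N (PowerSeries.C (A k) * pairProd g (L k))
      (word (fun v => twist N τ (c v) (y v)) (L k)) =
      (L₀.map U).prod (actN N (PowerSeries.C (A k)) (word y (L k))) := by
    intro k
    have hnd := (hL k).nodup_iff.mpr hL₀
    have hp := pairProd_mul_prod Y U e
      (fun v w hvw => Eop_mul_Yop_mul_Uop hN (fun n m hn => h v w n m hvw hn) hvw)
      heU hee heY hnd
    have hperm : ((L k).map U).prod = (L₀.map U).prod := by
      refine ((hL k).map U).prod_eq' ?_
      rw [List.pairwise_map]
      exact List.pairwise_of_forall fun {a b} => hUU a b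
    have hSU : Commute (Sop ι R (A k)) (L₀.map U).prod := Commute.list_prod_right _ _ (by
      intro x hx
      obtain ⟨w, _, rfl⟩ := List.mem_map.mp hx
      exact commute_Uop fun n _ => commute_Sop_Lop _ _ _)
    rw [← Gop_apply, ← Gop_apply, ← prod_Yop_one _ hnd, ← prod_Yop_one _ hnd, Gop_mul hN,
      Gop_C hN, hGop, ← Module.End.mul_apply, ← Module.End.mul_apply, ← Module.End.mul_apply]
    congr 1
    simp only [Yop_twist]
    rw [mul_assoc, hp, hperm, ← mul_assoc, hSU.eq, mul_assoc]
  rw [Finset.sum_congr rfl fun k _ => key k, ← map_sum]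
  obtain ⟨u, hu⟩ := isUnit_list_prod_Uop hN τ c L₀
  constructor
  · intro h0
    have := congrArg (↑u⁻¹ : DEnd ι R) h0
    rwa [← Module.End.mul_apply, show (L₀.map U).prod = u from hu.symm, Units.inv_mul, map_zero]
      at this
  · intro h0; rw [h0, map_zero]

end Operators
end EllTor

namespace EllTor

/-! ### Right multiplication by exponentials -/

section Opposite
variable {ι R : Type} [DecidableEq ι] [Ring R] [Algebra Coef R] [Algebra Lam R]
  [IsScalarTower Coef Lam R] {N : ℕ}

open MulOpposite in
theorem pR_op : pR Rᵐᵒᵖ = op (pR R) := rfl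

open MulOpposite in
theorem pR_op_pow (n : ℕ) : pR Rᵐᵒᵖ ^ n = op (pR R ^ n) := by rw [pR_op, op_pow]

theorem pR_op_pow_eq_zero (hN : pR R ^ N = 0) : pR Rᵐᵒᵖ ^ N = 0 := by
  rw [pR_op_pow, hN]; rfl

open MulOpposite in
theorem pR_op_pow_mul (n : ℕ) (r : R) : pR Rᵐᵒᵖ ^ n * op r = op (pR R ^ n * r) := by
  rw [pR_op_pow, ← op_mul, ((commute_pR r).pow_left n).eq]

open MulOpposite in
theorem coeff_pexp_op (c : ℕ → R) (n : ℕ) :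
    coeff n (pexp (posSer fun n => op (c n))) = op (coeff n (pexp (posSer c))) := by
  have hpow : ∀ k n, coeff n ((posSer fun n => op (c n)) ^ k) =
      op (coeff n (posSer c ^ k)) := by
    intro k
    induction k with
    | zero =>
      intro n
      rw [pow_zero, pow_zero, PowerSeries.coeff_one, PowerSeries.coeff_one]
      split_ifs <;> rfl
    | succ k ih =>
      intro n
      rw [pow_succ, pow_succ', PowerSeries.coeff_mul, PowerSeries.coeff_mul,
        ← Finset.Nat.sum_antidiagonal_swap, Finset.op_sum]
      refine Finset.sum_congr rfl fun x _ => ?_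
      rw [op_mul, Prod.fst_swap, Prod.snd_swap, ih, coeff_posSer, coeff_posSer]
      split_ifs <;> rfl
  simp only [pexp, PowerSeries.coeff_mk, hpow, Finset.op_sum, op_smul]

open MulOpposite in
theorem twist_op (τ : ℤ) (c : ℕ → R) (y : ℤ → R) :
    twist N τ (fun n => op (c n)) (fun n => op (y n)) = fun n => op (twistR N τ c y n) := by
  ext n : 1
  rw [twist, twistR, Finset.op_sum]
  refine Finset.sum_congr rfl fun m _ => ?_
  rw [coeff_pexp_op, ← op_mul, pR_op_pow_mul]

open MulOpposite in
theorem actN_op (G : (LP ι)⟦X⟧) (F : (ι → ℤ) → R) :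
    actN N G (fun ν => op (F ν)) = fun ν => op (actN N G F ν) := by
  ext ν : 1
  rw [actN, actN, Finset.op_sum]
  refine Finset.sum_congr rfl fun e _ => ?_
  rw [← pR_op_pow_mul]
  simp only [Finsupp.sum, Finset.op_sum, op_smul]

open MulOpposite in
theorem word_op (y : ι → ℤ → R) (L : List ι) :
    word (fun v n => op (y v n)) L.reverse = fun ν => op (word y L ν) := by
  ext ν : 1
  rw [word, word, op_list_prod, List.map_map, List.map_reverse]
  rfl

open MulOpposite in
/-- Twisting from the right is invertible. -/
theorem twistR_neg_twistR (hN : pR R ^ N = 0) (τ : ℤ) (c : ℕ → R) (y : ℤ → R) :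
    twistR N τ (fun n => -c n) (twistR N τ c y) = y := by
  have h := twist_neg_twist (pR_op_pow_eq_zero hN) τ (fun n => op (c n)) (fun n => op (y n))
  rw [twist_op] at h
  have h2 := twist_op (N := N) τ (fun n => -c n) (twistR N τ c y)
  ext n
  exact op_injective ((congrFun h2 n).symm.trans (congrFun h n))

theorem twistR_twistR_neg (hN : pR R ^ N = 0) (τ : ℤ) (c : ℕ → R) (y : ℤ → R) :
    twistR N τ c (twistR N τ (fun n => -c n) y) = y := by
  simpa using twistR_neg_twistR hN τ (fun n => -c n) y

open MulOpposite in
/-- The analogue of `sum_actN_word_twist_eq_zero_iff` for currents multiplied by exponentials from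
the right, obtained by passing to the opposite ring, which reverses the words. -/
theorem sum_actN_word_twistR_eq_zero_iff (hN : pR R ^ N = 0) {τ : ℤ} {c : ι → ℕ → R}
    {y : ι → ℤ → R} {s : ι → ι → ℕ → Lam} {g : ι → ι → (LP ι)⟦X⟧}
    (hc : ∀ v w m n, Commute (c v m) (c w n))
    (h : ∀ v w n m, v ≠ w → n ≠ 0 →
      y v m * c w n = c w n * y v m + s v w n • y v (m - τ * n))
    (hg : ∀ v w, v ≠ w →
      (Gop N (g w v) : DEnd ι Rᵐᵒᵖ) = Eop N (s v w) (Pi.single w τ - Pi.single v τ))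
    {K : Type} (S : Finset K) (A : K → LP ι) (L : K → List ι) (L₀ : List ι)
    (hL₀ : L₀.Nodup) (hL : ∀ k, (L k).Perm L₀) :
    ∑ k ∈ S, actN N (PowerSeries.C (A k) * pairProd g (L k))
        (word (fun v => twistR N τ (c v) (y v)) (L k)) = 0 ↔
      ∑ k ∈ S, actN N (PowerSeries.C (A k)) (word y (L k)) = 0 := by
  have hop := sum_actN_word_twist_eq_zero_iff (R := Rᵐᵒᵖ) (pR_op_pow_eq_zero hN) (τ := τ)
    (c := fun v n => op (c v n)) (y := fun v n => op (y v n)) (s := s) (g := fun v w => g w v)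
    (fun v w m n => (hc v w m n).op) (fun v w n m hvw hn => by
      rw [← op_mul, h v w n m hvw hn]; rfl)
    hg S A (fun k => (L k).reverse) L₀ hL₀ (fun k => (List.reverse_perm _).trans (hL k))
  have hz : ∀ F : K → (ι → ℤ) → R, (∑ k ∈ S, fun ν => op (F k ν)) = 0 ↔ ∑ k ∈ S, F k = 0 := by
    intro F
    rw [funext_iff, funext_iff]
    refine forall_congr' fun ν => ?_
    rw [Finset.sum_apply, Finset.sum_apply, ← Finset.op_sum]
    exact op_eq_zero_iff _
  simp only [pairProd_reverse, twist_op, word_op, actN_op, hz] at hop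
  exact hop

/-! ### Commutators with exponentials -/

theorem Uop_apply (τ : ℤ) (v : ι) (c : ℕ → R) (F : (ι → ℤ) → R) (ν : ι → ℤ) :
    Uop N τ v c F ν = ∑ m ∈ Finset.range N,
      pR R ^ m * (coeff m (pexp (posSer c)) * F (ν - m • Pi.single v τ)) := by
  rw [Uop, evp, LinearMap.sum_apply, Finset.sum_apply]
  refine Finset.sum_congr rfl fun m _ => ?_
  rw [Module.End.mul_apply, pR_pow_apply, coeff_pexp_Lop, Lop_apply]

theorem Eop_apply (s : ℕ → Lam) (ρ : ι → ℤ) (F : (ι → ℤ) → R) (ν : ι → ℤ) :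
    Eop N s ρ F ν = ∑ m ∈ Finset.range N,
      pR R ^ m * (coeff m (pexp (posSer s)) • F (ν - m • ρ)) := by
  rw [Eop, evp, LinearMap.sum_apply, Finset.sum_apply]
  refine Finset.sum_congr rfl fun m _ => ?_
  have h : coeff m (pexp (posSer fun n => s n • (Lop 1 (n • ρ) : DEnd ι R))) =
      coeff m (pexp (posSer s)) • Lop 1 (m • ρ) := by
    refine coeff_pexp_graded (fun n => ⟨⟨fun r => r • Lop 1 (n • ρ), zero_smul _ _⟩,
      fun x y => add_smul _ _ _⟩) ?_ ?_ ?_ ?_ m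
    · simp [Lop_one]
    · intro i j a b; simp [Lop_mul, add_smul, smul_smul, mul_comm]
    · intro n d a; simp
    · intro n
      rw [coeff_posSer, coeff_posSer]
      split_ifs
      · exact (map_zero _).symm
      · rfl
  rw [h, Module.End.mul_apply, pR_pow_apply, LinearMap.smul_apply, Pi.smul_apply, Lop_apply,
    one_mul]

open MulOpposite in
theorem Eop_op (s : ℕ → Lam) (ρ : ι → ℤ) (F : (ι → ℤ) → R) :
    Eop N s ρ (fun ν => op (F ν)) = fun ν => op (Eop N s ρ F ν) := by
  ext ν : 1
  rw [Eop_apply, Eop_apply, Finset.op_sum]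
  refine Finset.sum_congr rfl fun e _ => ?_
  rw [← pR_op_pow_mul, op_smul]

theorem word_pair (v w : ι) (hvw : v ≠ w) (y y' : ℤ → R) :
    (Yop y v * Yop y' w : DEnd ι R) (fun _ => 1) = fun ν => y (-ν v) * y' (-ν w) := by
  ext ν; simp [hvw.symm]

open MulOpposite in
/-- The commutator of `x⁺(z) = u⁺(z) y⁺(z)` and `x⁻(w) = y⁻(w) u⁻(w)` is
`u⁺(z) [y⁺(z), y⁻(w)] u⁻(w)`, provided that the factor from moving `u⁺(z)` past `x⁻(w)` cancels
that from moving `u⁻(w)` past `y⁺(z)`. -/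
theorem commutator_twist_twistR (hN : pR R ^ N = 0) {cp cm : ℕ → R} {yp ym : ℤ → R} {s : ℕ → Lam}
    (hp : ∀ n m, n ≠ 0 → cp n * twistR N (-1) cm ym m =
      twistR N (-1) cm ym m * cp n + s n • twistR N (-1) cm ym (m - n))
    (hm : ∀ n m, n ≠ 0 → cm n * yp m = yp m * cm n + s n • yp (m + n)) (n l : ℤ) :
    twist N 1 cp yp n * twistR N (-1) cm ym l - twistR N (-1) cm ym l * twist N 1 cp yp n =
      twist N 1 cp (fun n' => twistR N (-1) cm (fun l' => yp n' * ym l' - ym l' * yp n') l) n := by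
  set xm := twistR N (-1) cm ym
  set ρ : Fin 2 → ℤ := Pi.single 0 1 - Pi.single 1 1
  set U : DEnd (Fin 2) R := Uop N 1 0 cp
  set V : DEnd (Fin 2) Rᵐᵒᵖ := Uop N (-1) 1 fun n => op (cm n)
  set E : DEnd (Fin 2) R := Eop N (fun n => -s n) ρ
  have h01 : (0 : Fin 2) ≠ 1 := by decide
  have hU : Yop xm 1 * U = U * (E * Yop xm 1) := by
    have h1 : Eop N s ρ * (Yop xm 1 * U) = U * Yop xm 1 :=
      Eop_mul_Yop_mul_Uop hN (v := 1) (w := 0) (fun n m hn => by rw [hp n m hn, one_mul]) h01.symm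
    have hEU : Commute E U := commute_Uop fun n _ =>
      (commute_Eop fun m => commute_Lop (Commute.one_right _) _ _).symm
    rw [← mul_assoc, ← hEU.eq, mul_assoc, ← h1, ← mul_assoc, Eop_mul_Eop_of_neg hN, one_mul]
  have hV : Eop N (fun n => -s n) ρ * (Yop (fun n => op (yp n)) 0 * V) =
      V * Yop (fun n => op (yp n)) 0 := by
    have hρ : (Pi.single 1 (-1) - Pi.single 0 (-1) : Fin 2 → ℤ) = ρ := by
      ext i; fin_cases i <;> simp [ρ]
    rw [← hρ]
    refine Eop_mul_Yop_mul_Uop (pR_op_pow_eq_zero hN) (v := 0) (w := 1) (fun n m hn => ?_) h01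
    rw [← op_mul, ← op_mul, hm n m hn, show m - -1 * (n : ℤ) = m + n by ring, neg_smul, op_add,
      op_smul]
    abel
  have hYx : Yop (fun n => op (xm n)) 1 = V * Yop (fun n => op (ym n)) (1 : Fin 2) := by
    rw [← Yop_twist, twist_op]
  -- The two orderings of `y⁺(z)` and `x⁻(w)`, computed in the opposite ring.
  have hF1 : (fun ν : Fin 2 → ℤ => op (yp (-ν 0) * xm (-ν 1))) =
      V (fun ν => op (yp (-ν 0) * ym (-ν 1))) := by
    have h := word_pair (1 : Fin 2) 0 h01.symm (fun n => op (xm n)) fun n => op (yp n)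
    have h' := word_pair (1 : Fin 2) 0 h01.symm (fun n => op (ym n)) fun n => op (yp n)
    simp only [← op_mul] at h h'
    rw [← h, ← h', hYx]; rfl
  have hF2 : (fun ν : Fin 2 → ℤ => op ((E fun ν => xm (-ν 1) * yp (-ν 0)) ν)) =
      V (fun ν => op (ym (-ν 1) * yp (-ν 0))) := by
    have h := word_pair (0 : Fin 2) 1 h01 (fun n => op (yp n)) fun n => op (xm n)
    have h' := word_pair (0 : Fin 2) 1 h01 (fun n => op (yp n)) fun n => op (ym n)
    simp only [← op_mul] at h h'
    rw [← Eop_op, ← h, ← h', hYx, ← Module.End.mul_apply, ← Module.End.mul_apply, ← mul_assoc,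
      ← mul_assoc, mul_assoc _ _ V, hV, mul_assoc]
  have hx1 := word_pair (0 : Fin 2) 1 h01 (twist N 1 cp yp) xm
  have hx2 := word_pair (1 : Fin 2) 0 h01.symm xm (twist N 1 cp yp)
  rw [Yop_twist] at hx1 hx2
  rw [← mul_assoc, hU, mul_assoc U, mul_assoc E, Module.End.mul_apply, Module.End.mul_apply,
    word_pair _ _ h01.symm] at hx2
  rw [mul_assoc, Module.End.mul_apply, word_pair _ _ h01] at hx1
  set ν : Fin 2 → ℤ := ![-n, -l]
  have e1 := congrFun hx1 ν
  have e2 := congrFun hx2 ν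
  simp only [ν, Matrix.cons_val_zero, Matrix.cons_val_one, neg_neg] at e1 e2
  rw [← e1, ← e2, ← Pi.sub_apply, ← map_sub, Uop_apply, twist]
  refine Finset.sum_congr rfl fun m _ => ?_
  congr 2
  have e3 := congrFun (congrArg₂ (· - ·) hF1 hF2) (ν - m • Pi.single 0 1)
  simp only [Pi.sub_apply] at e3
  apply op_injective
  rw [Pi.sub_apply, op_sub]
  refine e3.trans ?_
  rw [← Pi.sub_apply, ← map_sub, Uop_apply, twistR, Finset.op_sum]
  refine Finset.sum_congr rfl fun r _ => ?_
  have a0 : -((ν - m • Pi.single 0 1 - r • Pi.single 1 (-1) : Fin 2 → ℤ) 0) = n + 1 * m := by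
    simp only [Pi.sub_apply, Pi.smul_apply, Pi.single_eq_same, Pi.single_eq_of_ne h01]
    simp [ν]; ring
  have a1 : -((ν - m • Pi.single 0 1 - r • Pi.single 1 (-1) : Fin 2 → ℤ) 1) = l + -1 * r := by
    simp only [Pi.sub_apply, Pi.smul_apply, Pi.single_eq_same, Pi.single_eq_of_ne h01.symm]
    simp [ν]; ring
  rw [coeff_pexp_op, Pi.sub_apply, ← op_sub, ← op_mul, pR_op_pow_mul, a0, a1]

/-! ### Commutation of twisted currents with other elements -/

theorem twist_commutator_of_commute {r : R} {τ d : ℤ} {c : ℕ → R} {y : ℤ → R} {s : Lam}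
    (hc : ∀ n, n ≠ 0 → Commute r (c n)) (hy : ∀ m, r * y m = y m * r + s • y (m + d)) (m : ℤ) :
    r * twist N τ c y m = twist N τ c y m * r + s • twist N τ c y (m + d) := by
  have hE : ∀ n, Commute r (coeff n (pexp (posSer c))) := commute_coeff_pexp fun n => by
    rw [coeff_posSer]
    split_ifs with h
    · exact Commute.zero_right _
    · exact hc n h
  rw [twist, twist, Finset.mul_sum, Finset.sum_mul, Finset.smul_sum, ← Finset.sum_add_distrib]
  refine Finset.sum_congr rfl fun n _ => ?_
  rw [← mul_assoc, ← ((commute_pR r).pow_left n).eq, mul_assoc, ← mul_assoc r, (hE n).eq, mul_assoc,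
    hy, mul_add, mul_add, show m + τ * n + d = m + d + τ * n by ring]
  simp only [mul_assoc, mul_smul_comm]

/-- If `[r, c_n] = δ_{n,k} t` and `[r, y(z)] = s z^{τk} y(z)`, then the current
`y'(z) = exp(∑ c_n (p z^τ)^n) y(z)` satisfies `[r, y'(z)] = (s + p^k t) z^{τk} y'(z)`. -/
theorem twist_commutator (hN : pR R ^ N = 0) {r : R} {τ : ℤ} {k : ℕ} (hk : k ≠ 0) {c : ℕ → R}
    {y : ℤ → R} {s t : Lam}
    (hc : ∀ n, n ≠ 0 → r * c n = c n * r + if n = k then t • 1 else 0)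
    (hy : ∀ m, r * y m = y m * r + s • y (m + τ * k)) (m : ℤ) :
    r * twist N τ c y m =
      twist N τ c y m * r + (s + pp ^ k * t) • twist N τ c y (m + τ * k) := by
  set A : DEnd Unit R := Lop r 0
  set f : (DEnd Unit R)⟦X⟧ := posSer fun n => Lop (c n) (n • Pi.single () τ)
  set T : (DEnd Unit R)⟦X⟧ := PowerSeries.monomial k (t • Lop 1 (k • Pi.single () τ))
  have hT : PowerSeries.C A * f = f * PowerSeries.C A + T := by
    ext n : 1
    rw [map_add, PowerSeries.coeff_C_mul, PowerSeries.coeff_mul_C, coeff_posSer,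
      PowerSeries.coeff_monomial]
    by_cases hn : n = 0
    · rw [if_pos hn, if_neg (by rw [hn]; exact hk.symm)]; simp
    · rw [if_neg hn, Lop_mul, hc n hn, Lop_mul]
      split_ifs with h
      · rw [Lop_add, Lop_lam_smul, zero_add, add_zero, h]
      · rw [add_zero, zero_add, add_zero, add_zero]
  have hTf : Commute T f := commute_of_coeff fun m n => by
    rw [PowerSeries.coeff_monomial, coeff_posSer]
    split_ifs
    · exact Commute.zero_right _
    · exact (commute_Lop (Commute.one_left _) _ _).smul_left _
    · exact Commute.zero_right _
    · exact Commute.zero_left _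
  have hN' := pR_pow_DEnd (ι := Unit) hN
  have hAU := congrArg (evp N) (commutator_pexp (coeff_zero_posSer _) hT hTf)
  rw [evp_add, evp_mul hN', evp_mul hN', evp_mul hN', evp_C hN'] at hAU
  have hevT : evp N T = pR (DEnd Unit R) ^ k * (t • Lop 1 (k • Pi.single () τ)) := by
    rw [← evp_eq_of_le hN' (show N ≤ N + (k + 1) by omega), evp,
      Finset.sum_eq_single_of_mem k (Finset.mem_range.mpr (by omega))]
    · rw [PowerSeries.coeff_monomial, if_pos rfl]
    · intro e _ he
      rw [PowerSeries.coeff_monomial, if_neg he, mul_zero]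
  have hAY := Lop_mul_Yop (ι := Unit) (v := ()) (μ := 0) hy rfl
  have hsingle : (0 + Pi.single () (τ * k) : Unit → ℤ) = k • Pi.single () τ := by
    ext; simp [mul_comm]
  rw [hsingle] at hAY
  set U := Uop (ι := Unit) N τ () c
  set S : DEnd Unit R := Lop 1 (k • Pi.single () τ)
  have hSU : Commute S U := commute_Uop fun n _ => commute_Lop (Commute.one_left _) _ _
  have key : A * (U * Yop y ()) = U * Yop y () * A + (s + pp ^ k * t) • (S * (U * Yop y ())) := by
    have hAU' : A * U = U * A + evp N T * U := hAU
    have hAY' : A * Yop y () = Yop y () * A + s • (S * Yop y ()) := hAY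
    have hpp : ∀ x : DEnd Unit R, (pp ^ k : Lam) • x = pR (DEnd Unit R) ^ k * x :=
      fun x => by ext F ν; rw [Module.End.mul_apply, pR_pow_apply, ← pp_pow_smul]; rfl
    have hevT' : evp N T = pR (DEnd Unit R) ^ k * (t • S) := hevT
    rw [← mul_assoc, hAU', hevT', add_mul, mul_assoc, hAY', mul_add, add_smul, ← mul_assoc,
      add_assoc]
    congr 2
    · rw [mul_smul_comm, ← mul_assoc, ← hSU.eq, mul_assoc]
    · rw [mul_smul, hpp]
      simp only [smul_mul_assoc, mul_assoc]
  rw [← Yop_twist] at key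
  have := congrFun (LinearMap.congr_fun key (fun _ => 1)) (fun _ => -m)
  simpa [A, S, mul_comm, add_comm] using this

open MulOpposite in
theorem twistR_commutator_of_commute {r : R} {τ d : ℤ} {c : ℕ → R} {y : ℤ → R} {s : Lam}
    (hc : ∀ n, n ≠ 0 → Commute r (c n)) (hy : ∀ m, r * y m = y m * r + s • y (m + d)) (m : ℤ) :
    r * twistR N τ c y m = twistR N τ c y m * r + s • twistR N τ c y (m + d) := by
  have h := twist_commutator_of_commute (N := N) (r := op r) (τ := τ) (d := d)
    (c := fun n => op (c n)) (y := fun n => op (y n)) (s := -s) (fun n hn => (hc n hn).op)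
    (fun m => by rw [← op_mul, ← op_mul, hy, op_add, op_smul, neg_smul]; abel) m
  rw [twist_op, ← op_mul, ← op_mul, ← op_smul, ← op_add] at h
  rw [op_injective h, neg_smul]; abel

open MulOpposite in
/-- The analogue of `twist_commutator` for a current multiplied by an exponential from the right. -/
theorem twistR_commutator (hN : pR R ^ N = 0) {r : R} {τ : ℤ} {k : ℕ} (hk : k ≠ 0) {c : ℕ → R}
    {y : ℤ → R} {s t : Lam}
    (hc : ∀ n, n ≠ 0 → r * c n = c n * r + if n = k then t • 1 else 0)
    (hy : ∀ m, r * y m = y m * r + s • y (m + τ * k)) (m : ℤ) :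
    r * twistR N τ c y m =
      twistR N τ c y m * r + (s + pp ^ k * t) • twistR N τ c y (m + τ * k) := by
  have h := twist_commutator (pR_op_pow_eq_zero hN) (r := op r) (τ := τ) hk
    (c := fun n => op (c n)) (y := fun n => op (y n)) (s := -s) (t := -t)
    (fun n hn => by
      rw [← op_mul, ← op_mul, hc n hn, op_add, add_assoc]
      split_ifs
      · simp
      · simp)
    (fun m => by rw [← op_mul, ← op_mul, hy, op_add, op_smul, neg_smul]; abel) m
  rw [twist_op, ← op_mul, ← op_mul, ← op_smul, ← op_add] at h
  rw [op_injective h, mul_neg, ← neg_add, neg_smul]; abel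

theorem mul_coeff_pexp_posSer {g : R} {c : ℕ → R} {α : Coef}
    (hc : ∀ n, n ≠ 0 → g * c n = α ^ n • (c n * g)) (n : ℕ) :
    g * coeff n (pexp (posSer c)) = α ^ n • (coeff n (pexp (posSer c)) * g) := by
  have h1 := mul_coeff_pexp (y := g) (f := posSer c) (g := posSer fun n => α ^ n • c n)
    (fun n => by
      rw [coeff_posSer, coeff_posSer]
      split_ifs with h
      · simp
      · rw [hc n h, smul_mul_assoc]) n
  have h2 := coeff_pexp_posSer_smul (algebraMap Coef R α) (fun r => Algebra.commutes _ _) c n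
  simp only [← map_pow, ← Algebra.smul_def] at h2
  rw [h1, h2, smul_mul_assoc]

/-- If `g` rescales both the exponent and the current, it rescales the twisted current. The element
`g'` to the right of the current is allowed to differ from `g`, as happens for the functions `g(h,
P)`. -/
theorem mul_twist {g g' : R} {τ : ℤ} {c : ℕ → R} {y : ℤ → R} {α : Coef} {β γ : ℤ → Coef}
    (hc : ∀ n, n ≠ 0 → g * c n = α ^ n • (c n * g)) (hy : ∀ m, g * y m = β m • (y m * g'))
    (hβ : ∀ m (n : ℕ), α ^ n * β (m + τ * n) = γ m) (m : ℤ) :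
    g * twist N τ c y m = γ m • (twist N τ c y m * g') := by
  rw [twist, Finset.mul_sum, Finset.sum_mul, Finset.smul_sum]
  refine Finset.sum_congr rfl fun n _ => ?_
  rw [← mul_assoc, ← ((commute_pR g).pow_left n).eq, mul_assoc, ← mul_assoc g,
    mul_coeff_pexp_posSer hc, smul_mul_assoc, mul_assoc, hy, ← hβ m n, mul_smul]
  simp only [mul_assoc, mul_smul_comm]

theorem mul_twistR {g g' : R} {τ : ℤ} {c : ℕ → R} {y : ℤ → R} {α : Coef} {β γ : ℤ → Coef}
    (hc : ∀ n, n ≠ 0 → g' * c n = α ^ n • (c n * g')) (hy : ∀ m, g * y m = β m • (y m * g'))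
    (hβ : ∀ m (n : ℕ), α ^ n * β (m + τ * n) = γ m) (m : ℤ) :
    g * twistR N τ c y m = γ m • (twistR N τ c y m * g') := by
  rw [twistR, Finset.mul_sum, Finset.sum_mul, Finset.smul_sum]
  refine Finset.sum_congr rfl fun n _ => ?_
  rw [← mul_assoc, ← ((commute_pR g).pow_left n).eq, mul_assoc, ← mul_assoc g, hy, smul_mul_assoc,
    mul_assoc, mul_coeff_pexp_posSer hc, ← hβ m n, mul_comm (α ^ n), mul_smul]
  simp only [mul_assoc, mul_smul_comm]

end Opposite

/-! ### The structure functions `g_{ij}` as exchange factors -/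

section Structure
variable {ι R : Type} [DecidableEq ι] [Ring R] [Algebra Coef R] [Algebra Lam R]
  [IsScalarTower Coef Lam R] {N : ℕ}

/-- Multiplication by the structure function `g_{ij}` is the operator `Eop` of the exchange factor
whose exponent has the coefficients of that of `g_{ij}`. -/
theorem Gop_gSer (D : Datum) (hN : pR R ^ N = 0) (b : ℤ) (nome : Lam) (r : ℂ)
    (μ : ι → ℤ) (s : ℕ → Lam)
    (hs : ∀ m : ℕ, m ≠ 0 → pp ^ m * s m =
      -(PowerSeries.C (scal ((D.q ^ (b * (m : ℤ)) - D.q ^ (-(b * (m : ℤ)))) / (m : ℂ) * r ^ m)) *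
        (invOneSub nome m * nome ^ m))) :
    (Gop N (D.gSer b nome (AddMonoidAlgebra.single μ (scal r))) : DEnd ι R) = Eop N s μ := by
  have hN' := pR_pow_DEnd (ι := ι) hN
  have hneg : ∀ (c : Coef) (x : DEnd ι R), -c • x = -(c • x) := fun c x => by ext; simp
  rw [Gop, Datum.gSer, map_pexp, Eop, evp_pexp hN' (by simp), evp_pexp hN' (coeff_zero_posSer _)]
  congr 1
  rw [evp_posSer, evp]
  have hterm : ∀ m, (if m = 0 then 0 else pR (DEnd ι R) ^ m * (s m • Lop 1 (m • μ))) =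
      ∑ e ∈ Finset.range N, pR (DEnd ι R) ^ e * (if m = 0 then 0 else
        coeff e (pp ^ m * s m) • Lop 1 (m • μ)) := by
    intro m
    split_ifs with h
    · simp
    · rw [← pp_pow_smul, smul_smul, Algebra.smul_def, algebraMap_eq_sum hN', Finset.sum_mul]
      refine Finset.sum_congr rfl fun e _ => ?_
      rw [mul_assoc, ← Algebra.smul_def]
  simp only [hterm]
  rw [Finset.sum_comm]
  refine Finset.sum_congr rfl fun e he => ?_
  rw [← Finset.mul_sum]
  congr 1
  rw [PowerSeries.coeff_map, PowerSeries.coeff_mk, RingHom.coe_coe, map_neg, map_sum,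
    ← Finset.sum_neg_distrib]
  rw [Finset.mem_range] at he
  have hsub : Finset.Icc 1 e ⊆ Finset.range N := fun m hm => by
    rw [Finset.mem_Icc] at hm; rw [Finset.mem_range]; omega
  rw [← Finset.sum_subset hsub]
  · refine Finset.sum_congr rfl fun m hm => ?_
    rw [Finset.mem_Icc] at hm
    have hm0 : m ≠ 0 := by omega
    rw [if_neg hm0, hs m hm0, map_neg, PowerSeries.coeff_C_mul, AddMonoidAlgebra.single_pow,
        map_smul,
      Sop_single, smul_smul, hneg]
    congr 2
    simp only [scal, map_mul, map_pow]
    ring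
  · intro m hm hm'
    rw [Finset.mem_range] at hm
    rw [Finset.mem_Icc] at hm'
    split_ifs with h
    · rfl
    · have hX : (PowerSeries.X : Lam) ^ m ∣ pp ^ m * s m := ⟨s m, rfl⟩
      rw [PowerSeries.X_pow_dvd_iff.mp hX e (by omega), zero_smul]

end Structure
end EllTor

namespace EllTor

/-! ### Structure constants -/

theorem cpow_add (m n : ℤ) : cpow (m + n) = cpow m * cpow n := LaurentPolynomial.T_add m n

theorem cpow_zero : cpow 0 = 1 := LaurentPolynomial.T_zero

theorem cpow_nsmul (n : ℕ) (m : ℤ) : cpow (n * m) = cpow m ^ n :=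
  (LaurentPolynomial.T_pow m n).symm

theorem cpow_mul_neg (n : ℤ) : cpow n * cpow (-n) = 1 := by
  rw [← cpow_add, add_neg_cancel, cpow_zero]

theorem scal_mul (x y : ℂ) : scal (x * y) = scal x * scal y := map_mul _ _ _

theorem scal_neg (x : ℂ) : scal (-x) = -scal x := map_neg _ _

theorem scal_one : scal 1 = 1 := map_one _

theorem one_sub_mul_invOneSub {s : Lam} (hs : coeff 0 s = 0) {n : ℕ} (hn : n ≠ 0) :
    (1 - s ^ n) * invOneSub s n = 1 := by
  refine PowerSeries.mul_invOfUnit _ _ ?_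
  have : PowerSeries.constantCoeff s = 0 := by simpa using hs
  simp [this, hn]

theorem one_sub_pp_mul {n : ℕ} (hn : n ≠ 0) : (1 - pp ^ n) * invOneSub pp n = 1 :=
  one_sub_mul_invOneSub (by simp [pp]) hn

theorem pstar_pow (n : ℕ) : pstar ^ n = PowerSeries.C (cpow (-(4 * n))) * pp ^ n := by
  rw [pstar, mul_pow, ← map_pow, ← cpow_nsmul, pp]
  congr 3; ring

theorem one_sub_pstar_mul {n : ℕ} (hn : n ≠ 0) :
    (1 - PowerSeries.C (cpow (-(4 * n))) * pp ^ n) * invOneSub pstar n = 1 := by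
  rw [← pstar_pow]; exact one_sub_mul_invOneSub (by simp [pstar]) hn

namespace Datum

/-- The properties of the numerical data on which the isomorphism depends. -/
structure Admissible (D : Datum) : Prop where
  q_ne : D.q ≠ 0
  qdiff_ne : ∀ i, D.qdiff i ≠ 0
  b_symm : ∀ i j, D.b i j = D.b j i
  m_anti : ∀ i j, D.m i j = -D.m j i

variable {D : Datum}

/-- `(q^{b_{ij} n} - q^{-b_{ij} n}) / n · κ^{-n m_{ij}}`. -/
def beta (D : Datum) (i j : D.I) (n : ℤ) : ℂ :=
  (D.q ^ (D.b i j * n) - D.q ^ (-(D.b i j * n))) / n * D.κ ^ (-(n * D.m i j))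

/-- The normalization of the `a^∨_{i,l}` is such that `(q_i - q_i^{-1}) [a_{ij} n]_i / n` depends on
`b_{ij}` only, which makes it symmetric under `(i, j, n) ↦ (j, i, -n)`. -/
theorem qdiff_mul_str (h : D.Admissible) (i j : D.I) (n : ℤ) :
    D.qdiff i * D.str i j n = D.beta i j n := by
  have h1 : ∀ k : ℤ, D.qi i ^ (D.A i j * k) = D.q ^ (D.b i j * k) := fun k => by
    rw [qi, ← zpow_natCast, ← zpow_mul, b, mul_assoc]
  have h2 : D.qi i ^ (-(D.A i j * n)) = D.q ^ (-(D.b i j * n)) := by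
    rw [← mul_neg, h1, mul_neg]
  have := h.qdiff_ne i
  rw [str, qint, h1, h2, beta]
  field_simp

theorem beta_neg (h : D.Admissible) (i j : D.I) (n : ℤ) : D.beta i j (-n) = D.beta j i n := by
  rw [beta, beta, h.m_anti i j, h.b_symm i j]
  simp only [mul_neg, neg_mul, neg_neg, Int.cast_neg]
  rw [div_neg, ← neg_div, neg_sub]

/-- The coefficient of `a^∨_{i,-n}` in the exponent of `u_i^+`, without the factor `p^n`. -/
def hP (D : Datum) (i : D.I) (n : ℕ) : Lam :=
  PowerSeries.C (scal (-D.qdiff i) * cpow n * cpow (-(4 * n))) * invOneSub pstar n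

/-- The coefficient of `a^∨_{i,n}` in the exponent of `u_i^-`, without the factor `p^n`. -/
def hM (D : Datum) (i : D.I) (n : ℕ) : Lam :=
  PowerSeries.C (scal (D.qdiff i) * cpow (-n)) * invOneSub pp n

theorem pp_pow_mul_hP (i : D.I) (n : ℕ) : pp ^ n * D.hP i n =
    PowerSeries.C (scal (-D.qdiff i) * cpow n) * (invOneSub pstar n * pstar ^ n) := by
  rw [hP, pstar_pow]; simp only [map_mul]; ring

theorem pp_pow_mul_hM (i : D.I) (n : ℕ) : pp ^ n * D.hM i n =
    PowerSeries.C (scal (D.qdiff i) * cpow (-n)) * (invOneSub pp n * pp ^ n) := by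
  rw [hM]; ring

/-- The factor relating `α^∨_{i,l}` and `a^∨_{i,l}`. -/
def alS (l : ℤ) : Lam :=
  PowerSeries.C (cpow (-|l|)) *
    if 0 < l then 1 else (1 - pp ^ l.natAbs) * invOneSub pstar l.natAbs

/-- The inverse of `alS l`. -/
def alS' (l : ℤ) : Lam :=
  PowerSeries.C (cpow |l|) *
    if 0 < l then 1 else (1 - pstar ^ l.natAbs) * invOneSub pp l.natAbs

theorem alS_mul_alS' {l : ℤ} (hl : l ≠ 0) : alS l * alS' l = 1 := by
  have h1 := congrArg (PowerSeries.C (R := Coef)) (cpow_mul_neg |l|)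
  rw [map_mul, map_one] at h1
  rw [alS, alS']
  split_ifs with h
  · rw [mul_one, mul_one, mul_comm, h1]
  · have h2 := one_sub_pp_mul (n := l.natAbs) (by omega)
    have h3 := one_sub_pstar_mul (n := l.natAbs) (by omega)
    rw [← pstar_pow] at h3
    linear_combination (1 - pp ^ l.natAbs) * invOneSub pp l.natAbs * (1 - pstar ^ l.natAbs) *
      invOneSub pstar l.natAbs * h1 + h3 * (1 - pp ^ l.natAbs) * invOneSub pp l.natAbs + h2

/-- The scalar in `[a^∨_{i,l}, x_j^+(z)]`. -/
def sP (D : Datum) (i j : D.I) (l : ℤ) : Lam :=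
  PowerSeries.C (scal (D.str i j l) * cpow (-|l|)) +
    if 0 < l then pp ^ l.natAbs * (D.hP j l.natAbs *
      PowerSeries.C (scal (D.str i j l / D.qdiff j) * (cpow (2 * l) - cpow (-(2 * l))))) else 0

/-- The scalar in `[a^∨_{i,l}, x_j^-(z)]`. -/
def sM (D : Datum) (i j : D.I) (l : ℤ) : Lam :=
  PowerSeries.C (scal (-D.str i j l) * cpow |l|) +
    if 0 < l then 0 else pp ^ l.natAbs * (D.hM j l.natAbs *
      PowerSeries.C (scal (D.str i j l / D.qdiff j) * (cpow (2 * l) - cpow (-(2 * l)))))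

theorem cpow_four (t : ℤ) : cpow (-(4 * t)) = cpow (-t) ^ 4 := by
  rw [← cpow_nsmul]; congr 1; push_cast; ring

theorem cpow_two (t : ℤ) : cpow (2 * t) = cpow t ^ 2 := by
  rw [← cpow_nsmul]; congr 1

theorem cpow_neg_two (t : ℤ) : cpow (-(2 * t)) = cpow (-t) ^ 2 := by
  rw [← cpow_nsmul]; congr 1; push_cast; ring

theorem scal_qdiff_mul (h : D.Admissible) (j : D.I) (x : ℂ) :
    scal (D.qdiff j) * scal (x / D.qdiff j) = scal x := by
  have := h.qdiff_ne j
  rw [← scal_mul]; congr 1; field_simp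

/-- The scalar in `[α^∨_{i,l}, x_j^+(z)]` is the one prescribed in the elliptic algebra. -/
theorem alS_mul_sP (h : D.Admissible) (i j : D.I) {l : ℤ} (hl : l ≠ 0) :
    alS l * D.sP i j l = PowerSeries.C (scal (D.str i j l) * cpow (-(2 * l))) * ratio l := by
  obtain ⟨n, rfl | rfl⟩ := l.eq_nat_or_neg
  · have hn : n ≠ 0 := by omega
    have hpos : (0 : ℤ) < n := by omega
    have h1 := congrArg (PowerSeries.C (R := Coef)) (cpow_mul_neg n)
    have h2 := one_sub_pstar_mul hn
    have h3 := congrArg (PowerSeries.C (R := Coef)) (scal_qdiff_mul h j (D.str i j n))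
    rw [alS, sP, if_pos hpos, if_pos hpos, ratio, if_neg (by omega), hP, Int.natAbs_natCast,
      Nat.abs_cast]
    simp only [cpow_four, cpow_two, cpow_neg_two, scal_neg, map_mul, map_pow, map_neg, map_sub,
      map_one] at h1 h2 h3 ⊢
    generalize PowerSeries.C (cpow n) = t at *
    generalize PowerSeries.C (cpow (-n)) = t' at *
    generalize PowerSeries.C (scal (D.str i j n)) = S at *
    generalize PowerSeries.C (scal (D.str i j n / D.qdiff j)) = S' at *
    generalize PowerSeries.C (scal (D.qdiff j)) = Q at *
    generalize invOneSub pstar n = I at *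
    generalize pp ^ n = P at *
    linear_combination (-P * I * t * t' ^ 5 * (t ^ 2 - t' ^ 2)) * h3 -
      S * P * I * (t' ^ 2 * (t ^ 2 * t' ^ 2 + t * t' + 1) - t' ^ 6) * h1 - S * t' ^ 2 * h2
  · have h1 := congrArg (PowerSeries.C (R := Coef)) (cpow_mul_neg n)
    have e1 : cpow (-(2 * -(n : ℤ))) = cpow n ^ 2 := by rw [← cpow_two]; congr 1; ring
    have e2 : cpow (4 * -(n : ℤ)) = cpow (-n) ^ 4 := by rw [← cpow_four]; congr 1; ring
    rw [alS, sP, if_neg (by omega), if_neg (by omega), ratio, if_pos (by omega), Int.natAbs_neg,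
      Int.natAbs_natCast, abs_neg, Nat.abs_cast, e1, e2]
    simp only [map_mul, map_pow, map_one] at h1 ⊢
    linear_combination (-PowerSeries.C (scal (D.str i j (-n))) * (1 - pp ^ n) * invOneSub pstar n *
      PowerSeries.C (cpow (-n)) ^ 2 * (PowerSeries.C (cpow n) * PowerSeries.C (cpow (-n)) + 1)) * h1

/-- The scalar in `[α^∨_{i,l}, x_j^-(z)]` is the one prescribed in the elliptic algebra. -/
theorem alS_mul_sM (h : D.Admissible) (i j : D.I) {l : ℤ} (hl : l ≠ 0) :
    alS l * D.sM i j l = PowerSeries.C (scal (-D.str i j l)) := by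
  obtain ⟨n, rfl | rfl⟩ := l.eq_nat_or_neg
  · have hpos : (0 : ℤ) < n := by omega
    have h1 := congrArg (PowerSeries.C (R := Coef)) (cpow_mul_neg n)
    rw [alS, sM, if_pos hpos, if_pos hpos, Nat.abs_cast]
    simp only [scal_neg, map_mul, map_neg, map_one] at h1 ⊢
    linear_combination (-PowerSeries.C (scal (D.str i j n))) * h1
  · have hn : n ≠ 0 := by omega
    have h1 := congrArg (PowerSeries.C (R := Coef)) (cpow_mul_neg n)
    have h2 := one_sub_pstar_mul hn
    have h4 := one_sub_pp_mul hn
    have h3 := congrArg (PowerSeries.C (R := Coef)) (scal_qdiff_mul h j (D.str i j (-n)))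
    have e1 : cpow (-(2 * -(n : ℤ))) = cpow n ^ 2 := by rw [← cpow_two]; congr 1; ring
    have e2 : cpow (2 * -(n : ℤ)) = cpow (-n) ^ 2 := cpow_two _
    rw [alS, sM, if_neg (by omega), if_neg (by omega), hM, Int.natAbs_neg, Int.natAbs_natCast,
      abs_neg, Nat.abs_cast, e1, e2]
    simp only [cpow_four, scal_neg, map_mul, map_pow, map_neg, map_sub, map_one] at h1 h2 h3 ⊢
    generalize PowerSeries.C (cpow n) = t at *
    generalize PowerSeries.C (cpow (-n)) = t' at *
    generalize PowerSeries.C (scal (D.str i j (-n))) = S at *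
    generalize PowerSeries.C (scal (D.str i j (-n) / D.qdiff j)) = S' at *
    generalize PowerSeries.C (scal (D.qdiff j)) = Q at *
    generalize invOneSub pstar n = I at *
    generalize invOneSub pp n = J at *
    generalize pp ^ n = P at *
    linear_combination (t' ^ 2 * (1 - P) * I * P * J * (t' ^ 2 - t ^ 2)) * h3 +
      ((1 - P) * I * S * (-1 - P * J * (t * t' + 1))) * h1 + (I * S * P * (t' ^ 4 - 1)) * h4 -
      S * h2

/-- The scalar by which `[α^∨_{i,l}, α^∨_{j,-l}]` differs from `[a^∨_{i,l}, a^∨_{j,-l}]`. -/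
theorem alS_mul_alS_neg {l : ℤ} (hl : l ≠ 0) :
    alS l * alS (-l) = PowerSeries.C (cpow (-(2 * l))) * ratio l := by
  obtain ⟨n, rfl | rfl⟩ := l.eq_nat_or_neg
  · rw [alS, alS, if_pos (by omega), if_neg (by omega), ratio, if_neg (by omega), Int.natAbs_neg,
      Int.natAbs_natCast, abs_neg, Nat.abs_cast, cpow_neg_two, map_pow]
    ring
  · have h1 := congrArg (PowerSeries.C (R := Coef)) (cpow_mul_neg n)
    have e1 : cpow (-(2 * -(n : ℤ))) = cpow n ^ 2 := by rw [← cpow_two]; congr 1; ring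
    have e2 : cpow (4 * -(n : ℤ)) = cpow (-n) ^ 4 := by rw [← cpow_four]; congr 1; ring
    rw [alS, alS, if_neg (by omega), if_pos (by omega), ratio, if_pos (by omega), neg_neg,
      Int.natAbs_neg, Int.natAbs_natCast, abs_neg, Nat.abs_cast, e1, e2]
    simp only [map_mul, map_pow, map_one] at h1 ⊢
    linear_combination (-(1 - pp ^ n) * invOneSub pstar n *
      PowerSeries.C (cpow (-n)) ^ 2 * (PowerSeries.C (cpow n) * PowerSeries.C (cpow (-n)) + 1)) * h1

/-- The exchange factors of the currents `x^+`. -/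
def exP (D : Datum) (i j : D.I) (n : ℕ) : Lam :=
  D.hP j n * PowerSeries.C (scal (D.str j i (-n)) * cpow (-n))

/-- The exchange factors of the currents `x^-`. -/
def exM (D : Datum) (i j : D.I) (n : ℕ) : Lam :=
  D.hM j n * PowerSeries.C (scal (D.str j i n) * cpow n)

/-- The exponent of the exchange factor of `x_i^+` and `x_j^+` is that of `g_{ij}(z; p^*)`. -/
theorem pp_pow_mul_exP (h : D.Admissible) (i j : D.I) (n : ℕ) :
    pp ^ n * D.exP i j n =
      -(PowerSeries.C (scal ((D.q ^ (D.b i j * n) - D.q ^ (-(D.b i j * n))) / n *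
      (D.κ ^ (-D.m i j)) ^ n)) * (invOneSub pstar n * pstar ^ n)) := by
  have h1 : (D.q ^ (D.b i j * n) - D.q ^ (-(D.b i j * n))) / n * (D.κ ^ (-D.m i j)) ^ n =
      D.qdiff j * D.str j i (-n) := by
    rw [qdiff_mul_str h, beta_neg h, beta, ← zpow_natCast, ← zpow_mul]
    push_cast
    congr 2; ring
  have h2 := congrArg (PowerSeries.C (R := Coef)) (cpow_mul_neg n)
  rw [exP, ← mul_assoc, pp_pow_mul_hP, h1]
  simp only [scal_neg, scal_mul, map_mul, map_neg, map_one] at h2 ⊢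
  linear_combination (-PowerSeries.C (scal (D.qdiff j)) * (invOneSub pstar n * pstar ^ n) *
    PowerSeries.C (scal (D.str j i (-n)))) * h2

/-- The exponent of the exchange factor of `x^-_i` and `x^-_j` is that of `g_{ji}(z; p)^{-1}`, the
inverse being encoded by the opposite sign of `b_{ji}`. -/
theorem pp_pow_mul_exM (h : D.Admissible) (i j : D.I) (n : ℕ) :
    pp ^ n * D.exM i j n =
      -(PowerSeries.C (scal ((D.q ^ (-D.b j i * n) - D.q ^ (-(-D.b j i * n))) / n *
      (D.κ ^ (-D.m j i)) ^ n)) * (invOneSub pp n * pp ^ n)) := by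
  have h1 : (D.q ^ (-D.b j i * n) - D.q ^ (-(-D.b j i * n))) / n * (D.κ ^ (-D.m j i)) ^ n =
      -(D.qdiff j * D.str j i n) := by
    rw [qdiff_mul_str h, beta, ← zpow_natCast, ← zpow_mul, neg_mul, neg_neg,
      show -D.m j i * (n : ℤ) = -(n * D.m j i) by ring]
    push_cast
    ring
  have h2 := congrArg (PowerSeries.C (R := Coef)) (cpow_mul_neg n)
  rw [exM, ← mul_assoc, pp_pow_mul_hM, h1]
  simp only [scal_neg, scal_mul, map_mul, map_neg, map_one] at h2 ⊢
  linear_combination (PowerSeries.C (scal (D.qdiff j)) * (invOneSub pp n * pp ^ n) *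
    PowerSeries.C (scal (D.str j i n))) * h2

/-- The two exchange factors in the commutator of `x_i^+` and `x_j^-` cancel. -/
theorem hP_mul_sM (h : D.Admissible) (i j : D.I) {n : ℕ} (hn : n ≠ 0) :
    D.hP i n * D.sM i j (-n) =
      D.hM j n * PowerSeries.C (scal (D.str j i n) * cpow (-n)) := by
  have h1 := congrArg (PowerSeries.C (R := Coef)) (cpow_mul_neg n)
  have h2 := one_sub_pstar_mul hn
  have h4 := one_sub_pp_mul hn
  have h3 := congrArg (PowerSeries.C (R := Coef)) (scal_qdiff_mul h j (D.str i j (-n)))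
  have h5 : scal (D.qdiff i) * scal (D.str i j (-n)) = scal (D.qdiff j) * scal (D.str j i n) := by
    rw [← scal_mul, ← scal_mul, qdiff_mul_str h, qdiff_mul_str h, beta_neg h]
  have h6 := congrArg (PowerSeries.C (R := Coef)) h5
  have e1 : cpow (-(2 * -(n : ℤ))) = cpow n ^ 2 := by rw [← cpow_two]; congr 1; ring
  have e2 : cpow (2 * -(n : ℤ)) = cpow (-n) ^ 2 := cpow_two _
  rw [hP, sM, if_neg (by omega), Int.natAbs_neg, Int.natAbs_natCast, abs_neg, Nat.abs_cast, hM,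
    e1, e2]
  simp only [cpow_four, scal_neg, map_mul, map_pow, map_neg, map_sub, map_one] at h1 h2 h3 h6 ⊢
  generalize PowerSeries.C (cpow n) = t at *
  generalize PowerSeries.C (cpow (-n)) = t' at *
  generalize PowerSeries.C (scal (D.str i j (-n))) = S at *
  generalize PowerSeries.C (scal (D.str j i n)) = S₂ at *
  generalize PowerSeries.C (scal (D.str i j (-n) / D.qdiff j)) = S' at *
  generalize PowerSeries.C (scal (D.qdiff j)) = Q at *
  generalize PowerSeries.C (scal (D.qdiff i)) = Q' at *
  generalize invOneSub pstar n = I at *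
  generalize invOneSub pp n = J at *
  generalize pp ^ n = P at *
  linear_combination (-Q' * t * t' ^ 5 * I * P * J * (t' ^ 2 - t ^ 2)) * h3 + t' ^ 2 * J * h6 +
    (Q' * S * t' ^ 2 * (I * (t * t' + 1) -
      P * I * J * (t' ^ 4 - ((t * t') ^ 2 + t * t' + 1)))) * h1 -
    Q' * S * t' ^ 2 * I * h4 + Q' * S * t' ^ 2 * J * h2

end Datum
end EllTor

namespace EllTor

theorem C_smul {R : Type} [Ring R] [Algebra Coef R] [Algebra Lam R] [IsScalarTower Coef Lam R]
    (c : Coef) (r : R) : (PowerSeries.C c : Lam) • r = c • r := by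
  rw [← algebraMap_smul Lam c r]; rfl

/-! ### Twisted currents -/

namespace Datum

/-- The images in a ring of the generators of the smash product. -/
structure TorData (D : Datum) (R : Type) where
  a : D.I → ℤ → R
  X : ℤˣ → D.I → ℤ → R
  k : ℤˣ → D.I → R
  qd : ℤˣ → R
  eQ : (D.I → ℤ) → R
  fn : D.Mer → R

namespace TorData
variable {D : Datum} {R : Type} [Ring R] [Algebra Coef R] [Algebra Lam R]
  [IsScalarTower Coef Lam R] (T : D.TorData R) (N : ℕ)

/-- The Heisenberg relations. -/
structure IsHeis : Prop where
  a_zero : ∀ i, T.a i 0 = 0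
  a_a : ∀ i j l m, l ≠ 0 → m ≠ 0 → T.a i l * T.a j m = T.a j m * T.a i l +
    if l + m = 0 then (PowerSeries.C (scal (D.str i j l / D.qdiff j) *
      (cpow (2 * l) - cpow (-(2 * l)))) : Lam) • 1 else 0

/-- The relations involving the Heisenberg generators and the `e^{Q_α}`. -/
structure IsBase : Prop extends T.IsHeis where
  a_X : ∀ (ε : ℤˣ) i j l n, l ≠ 0 → T.a i l * T.X ε j n = T.X ε j n * T.a i l +
    (PowerSeries.C (scal (ε * D.str i j l) * cpow (-(ε * |l|))) : Lam) • T.X ε j (n + l)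
  k_a : ∀ ε i j l, Commute (T.k ε i) (T.a j l)
  eQ_zero : T.eQ 0 = 1
  eQ_add : ∀ α β, T.eQ (α + β) = T.eQ α * T.eQ β
  eQ_a : ∀ α i l, Commute (T.eQ α) (T.a i l)
  eQ_X : ∀ α ε i n, Commute (T.eQ α) (T.X ε i n)
  eQ_k : ∀ α ε i, Commute (T.eQ α) (T.k ε i)

/-- `e^{-Q_i}`. -/
def e (i : D.I) : R := T.eQ (-Pi.single i 1)

/-- The coefficients of the exponent of `u_i^+`, without the powers of `p`. -/
def cP (i : D.I) (n : ℕ) : R := D.hP i n • T.a i (-n)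

/-- The coefficients of the exponent of `u_i^-`, without the powers of `p`. -/
def cM (i : D.I) (n : ℕ) : R := D.hM i n • T.a i n

/-- `X_i^+(z) e^{-Q_i}`. -/
def baseP (i : D.I) (n : ℤ) : R := T.X 1 i n * T.e i

/-- The image of `x_i^±(z)`, at `p ^ N = 0`. -/
def x (ε : ℤˣ) (i : D.I) : ℤ → R :=
  if ε = 1 then twist N 1 (T.cP i) (T.baseP i) else twistR N (-1) (T.cM i) (T.X (-1) i)

/-- The image of `α^∨_{i,l}`. -/
def al (i : D.I) (l : ℤ) : R := alS l • T.a i l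

/-- The image of `K_i^±`. -/
def K (ε : ℤˣ) (i : D.I) : R := T.k ε i * T.e i

/-- The image of `φ_i^±(z)`, at `p ^ N = 0`. -/
def phi (ε : ℤˣ) (i : D.I) (n : ℤ) : R :=
  ∑ m ∈ Finset.range N, pR R ^ m * (coeff m (pexp (posSer (T.cP i))) *
    ∑ r ∈ Finset.range N, pR R ^ r * (cpow (ε * (m + r)) •
      (trigPhi (D.qdiff i) ε (T.k ε i) (T.a i) (n + m - r) * T.e i) *
        coeff r (pexp (posSer (T.cM i)))))

theorem x_one (i : D.I) : T.x N 1 i = twist N 1 (T.cP i) (T.baseP i) := if_pos rfl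

theorem x_neg_one (i : D.I) : T.x N (-1) i = twistR N (-1) (T.cM i) (T.X (-1) i) :=
  if_neg (by decide)

variable {T N}

namespace IsHeis
variable (h : T.IsHeis)
include h

theorem commute_a (i j : D.I) {l m : ℤ} (hlm : l + m ≠ 0) : Commute (T.a i l) (T.a j m) := by
  rcases eq_or_ne l 0 with rfl | hl
  · rw [h.a_zero]; exact Commute.zero_left _
  rcases eq_or_ne m 0 with rfl | hm
  · rw [h.a_zero]; exact Commute.zero_right _
  have := h.a_a i j l m hl hm
  rwa [if_neg hlm, add_zero] at this

theorem commute_a_of_nat (s : ℤ) (i j : D.I) (m n : ℕ) (hs : s = 1 ∨ s = -1) :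
    Commute (T.a i (s * m)) (T.a j (s * n)) := by
  rcases eq_or_ne ((m : ℤ) + n) 0 with h0 | h0
  · have : m = 0 := by omega
    rw [this, Nat.cast_zero, mul_zero, h.a_zero]; exact Commute.zero_left _
  · exact h.commute_a i j (by rcases hs with rfl | rfl <;> omega)

theorem cP_comm (i j : D.I) (m n : ℕ) : Commute (T.cP i m) (T.cP j n) := by
  have := h.commute_a_of_nat (-1) i j m n (Or.inr rfl)
  simp only [neg_mul, one_mul] at this
  exact (this.smul_left _).smul_right _

theorem cM_comm (i j : D.I) (m n : ℕ) : Commute (T.cM i m) (T.cM j n) := by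
  have := h.commute_a_of_nat 1 i j m n (Or.inl rfl)
  simp only [one_mul] at this
  exact (this.smul_left _).smul_right _

theorem a_cP (i j : D.I) {l : ℤ} (hl : l ≠ 0) (n : ℕ) (hn : n ≠ 0) :
    T.a i l * T.cP j n = T.cP j n * T.a i l + if l = n then
      (D.hP j n * PowerSeries.C (scal (D.str i j l / D.qdiff j) *
        (cpow (2 * l) - cpow (-(2 * l)))) : Lam) • 1 else 0 := by
  rw [cP, mul_smul_comm, h.a_a i j l (-n) hl (by omega), smul_add, smul_mul_assoc]
  congr 1
  by_cases hln : l = n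
  · rw [if_pos (by omega), if_pos hln, smul_smul]
  · rw [if_neg (by omega), if_neg hln, smul_zero]

theorem a_cM (i j : D.I) {l : ℤ} (hl : l ≠ 0) (n : ℕ) (hn : n ≠ 0) :
    T.a i l * T.cM j n = T.cM j n * T.a i l + if l = -n then
      (D.hM j n * PowerSeries.C (scal (D.str i j l / D.qdiff j) *
        (cpow (2 * l) - cpow (-(2 * l)))) : Lam) • 1 else 0 := by
  rw [cM, mul_smul_comm, h.a_a i j l n hl (by omega), smul_add, smul_mul_assoc]
  congr 1
  by_cases hln : l = -n
  · rw [if_pos (by omega), if_pos hln, smul_smul]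
  · rw [if_neg (by omega), if_neg hln, smul_zero]

end IsHeis

namespace IsBase
variable (h : T.IsBase)
include h

theorem eQ_eQ (α β : D.I → ℤ) : Commute (T.eQ α) (T.eQ β) := by
  rw [Commute, SemiconjBy, ← h.eQ_add, ← h.eQ_add, add_comm]

theorem e_mul_eQ (i : D.I) : T.e i * T.eQ (Pi.single i 1) = 1 := by
  rw [e, ← h.eQ_add, neg_add_cancel, h.eQ_zero]

theorem eQ_mul_e (i : D.I) : T.eQ (Pi.single i 1) * T.e i = 1 := by
  rw [e, ← h.eQ_add, add_neg_cancel, h.eQ_zero]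

theorem a_baseP (i j : D.I) {l : ℤ} (hl : l ≠ 0) (n : ℤ) :
    T.a i l * T.baseP j n = T.baseP j n * T.a i l +
      (PowerSeries.C (scal (D.str i j l) * cpow (-|l|)) : Lam) • T.baseP j (n + l) := by
  have := h.a_X 1 i j l n hl
  simp only [Units.val_one, Int.cast_one, one_mul] at this
  have he : T.a i l * T.e j = T.e j * T.a i l := (h.eQ_a _ _ _).eq.symm
  rw [baseP, ← mul_assoc, this, add_mul, mul_assoc, he, smul_mul_assoc, mul_assoc]
  rfl

theorem a_X_neg (i j : D.I) {l : ℤ} (hl : l ≠ 0) (n : ℤ) :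
    T.a i l * T.X (-1) j n = T.X (-1) j n * T.a i l +
      (PowerSeries.C (scal (-D.str i j l) * cpow |l|) : Lam) • T.X (-1) j (n + l) := by
  have := h.a_X (-1) i j l n hl
  simpa using this

end IsBase

/-- Multiplication by `u^+` changes the scalar in the commutator of `a_{i,l}` with a current. -/
theorem a_twist_cP (hN : pR R ^ N = 0) (c : ℤˣ) {y : ℤ → R} {s : Lam} {i j : D.I} {l : ℤ}
    (hl : l ≠ 0)
    (hc : ∀ n : ℕ, n ≠ 0 → T.a i l * T.cP j n = T.cP j n * T.a i l + if l = n then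
      (D.hP j n * PowerSeries.C (scal (D.str i j l / D.qdiff j) *
        (cpow (2 * l) - cpow (-(2 * l)))) : Lam) • 1 else 0)
    (hy : ∀ n, T.a i l * y n = y n * T.a i l + s • y (n + l)) (n : ℤ) :
    T.a i l * twist N 1 (fun n => (c : ℤ) • T.cP j n) y n =
      twist N 1 (fun n => (c : ℤ) • T.cP j n) y n * T.a i l +
        (s + (c : ℤ) • (D.sP i j l - PowerSeries.C (scal (D.str i j l) * cpow (-|l|)))) •
          twist N 1 (fun n => (c : ℤ) • T.cP j n) y (n + l) := by
  rw [sP, add_sub_cancel_left]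
  split_ifs with hpos
  · obtain ⟨k, rfl⟩ := Int.eq_ofNat_of_zero_le hpos.le
    have hk : k ≠ 0 := by rintro rfl; simp at hl
    have := twist_commutator hN (τ := 1) hk (c := fun n => (c : ℤ) • T.cP j n) (s := s) (y := y)
      (t := (c : ℤ) • (D.hP j k * PowerSeries.C (scal (D.str i j k / D.qdiff j) *
        (cpow (2 * k) - cpow (-(2 * k)))))) (r := T.a i k) (fun n hn => by
          rw [mul_smul_comm, hc n hn, smul_add, smul_mul_assoc]
          congr 1
          by_cases hkn : n = k
          · rw [if_pos hkn, if_pos (by rw [hkn]), hkn, smul_assoc]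
          · rw [if_neg hkn, if_neg (by omega), smul_zero]) (by simpa using hy) n
    rw [one_mul] at this
    rw [this, mul_smul_comm, Int.natAbs_natCast]
  · rw [smul_zero, add_zero]
    exact twist_commutator_of_commute (fun n hn => by
      have := hc n hn
      rw [if_neg (by omega), add_zero] at this
      exact (show Commute _ _ from this).smul_right _) hy n

/-- Multiplication by `u^-` changes the scalar in the commutator of `a_{i,l}` with a current. -/
theorem a_twistR_cM (hN : pR R ^ N = 0) (c : ℤˣ) {y : ℤ → R} {s : Lam} {i j : D.I} {l : ℤ}
    (hl : l ≠ 0)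
    (hc : ∀ n : ℕ, n ≠ 0 → T.a i l * T.cM j n = T.cM j n * T.a i l + if l = -n then
      (D.hM j n * PowerSeries.C (scal (D.str i j l / D.qdiff j) *
        (cpow (2 * l) - cpow (-(2 * l)))) : Lam) • 1 else 0)
    (hy : ∀ n, T.a i l * y n = y n * T.a i l + s • y (n + l)) (n : ℤ) :
    T.a i l * twistR N (-1) (fun n => (c : ℤ) • T.cM j n) y n =
      twistR N (-1) (fun n => (c : ℤ) • T.cM j n) y n * T.a i l +
        (s + (c : ℤ) • (D.sM i j l - PowerSeries.C (scal (-D.str i j l) * cpow |l|))) •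
          twistR N (-1) (fun n => (c : ℤ) • T.cM j n) y (n + l) := by
  rw [sM, add_sub_cancel_left]
  split_ifs with hpos
  · rw [smul_zero, add_zero]
    exact twistR_commutator_of_commute (fun n hn => by
      have := hc n hn
      rw [if_neg (by omega), add_zero] at this
      exact (show Commute _ _ from this).smul_right _) hy n
  · obtain ⟨k, rfl⟩ : ∃ k : ℕ, l = -k := ⟨l.natAbs, by omega⟩
    have hk : k ≠ 0 := by rintro rfl; simp at hl
    have := twistR_commutator hN (τ := -1) hk (c := fun n => (c : ℤ) • T.cM j n) (s := s) (y := y)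
      (t := (c : ℤ) • (D.hM j k * PowerSeries.C (scal (D.str i j (-k) / D.qdiff j) *
        (cpow (2 * -k) - cpow (-(2 * -k)))))) (r := T.a i (-k)) (fun n hn => by
          rw [mul_smul_comm, hc n hn, smul_add, smul_mul_assoc]
          congr 1
          by_cases hkn : n = k
          · rw [if_pos hkn, if_pos (by rw [hkn]), hkn, smul_assoc]
          · rw [if_neg hkn, if_neg (by omega), smul_zero]) (by simpa using hy) n
    rw [neg_one_mul] at this
    rw [this, mul_smul_comm, Int.natAbs_neg, Int.natAbs_natCast]

namespace IsBase
variable (h : T.IsBase)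
include h

/-- The relation between `a^∨_{i,l}` and the twisted current `x_j^+(z)`. -/
theorem a_xP (hN : pR R ^ N = 0) (i j : D.I) {l : ℤ} (hl : l ≠ 0) (n : ℤ) :
    T.a i l * T.x N 1 j n = T.x N 1 j n * T.a i l + D.sP i j l • T.x N 1 j (n + l) := by
  have := a_twist_cP hN 1 hl (h.a_cP i j hl) (h.a_baseP i j hl) n
  simpa [x_one] using this

/-- The relation between `a^∨_{i,l}` and the twisted current `x_j^-(z)`. -/
theorem a_xM (hN : pR R ^ N = 0) (i j : D.I) {l : ℤ} (hl : l ≠ 0) (n : ℤ) :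
    T.a i l * T.x N (-1) j n = T.x N (-1) j n * T.a i l + D.sM i j l • T.x N (-1) j (n + l) := by
  have := a_twistR_cM hN 1 hl (h.a_cM i j hl) (h.a_X_neg i j hl) n
  simpa [x_neg_one] using this

/-- The currents `x^+`, up to the factors `g_{ij}`, satisfy the same relations as the currents
`X^+`. -/
theorem sum_words_pos_iff (hD : D.Admissible) (hN : pR R ^ N = 0) {ι : Type} [DecidableEq ι]
    (col : ι → D.I) {K : Type} (S : Finset K) (A : K → LP ι) (L : K → List ι) (L₀ : List ι)
    (hL₀ : L₀.Nodup) (hL : ∀ k, (L k).Perm L₀) :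
    ∑ k ∈ S, actN N (PowerSeries.C (A k) * pairProd (fun v w => EFree.gg 1 (col v) (col w)
        (LP.frac (D.κ ^ (-D.m (col v) (col w))) w v)) (L k))
        (word (fun v => T.x N 1 (col v)) (L k)) = 0 ↔
      ∑ k ∈ S, actN N (PowerSeries.C (A k)) (word (fun v => T.X 1 (col v)) (L k)) = 0 := by
  simp only [x_one]
  refine (sum_actN_word_twist_eq_zero_iff hN (s := fun v w => D.exP (col v) (col w))
    (fun v w m n => h.cP_comm _ _ m n) (fun v w n m _ hn => ?_) (fun v w _ => ?_) S A L L₀ hL₀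
    hL).trans ?_
  · have := h.a_baseP (col w) (col v) (l := -n) (by omega) m
    rw [cP, smul_mul_assoc, this, smul_add, mul_smul_comm, smul_smul, exP, abs_neg, Nat.abs_cast,
      one_mul, ← sub_eq_add_neg]
  · exact Gop_gSer D hN _ _ _ _ _ (fun m _ => by
      rw [pp_pow_mul_exP hD]; simp; left; rfl)
  · have hw : ∀ L : List ι, word (fun v => T.baseP (col v)) L =
        fun ν => word (fun v => T.X 1 (col v)) L ν * (L.map fun v => T.e (col v)).prod := by
      intro L
      ext ν
      induction L with
      | nil => simp [word]
      | cons v L ih =>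
        have hc : Commute (T.e (col v)) (word (fun v => T.X 1 (col v)) L ν) :=
          Commute.list_prod_right _ _ fun x hx => by
            obtain ⟨w, _, rfl⟩ := List.mem_map.mp hx
            exact h.eQ_X _ _ _ _
        simp only [word, List.map_cons, List.prod_cons] at ih hc ⊢
        rw [ih, baseP, mul_assoc, ← mul_assoc (T.e (col v)), hc.eq]
        simp only [mul_assoc]
    -- the factors `e^{-Q_i}` of each word have the same invertible product
    set u := (L₀.map fun v => T.e (col v)).prod
    have hu : ∀ k, ((L k).map fun v => T.e (col v)).prod = u := fun k => by
      refine ((hL k).map _).prod_eq' ?_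
      rw [List.pairwise_map]
      exact List.pairwise_of_forall fun {a b} => h.eQ_eQ _ _
    have huu : IsUnit u := by
      clear hu
      simp only [u]
      clear u hL hL₀
      induction L₀ with
      | nil => simp
      | cons v L ih =>
        rw [List.map_cons, List.prod_cons]
        exact (Units.mk _ _ (h.e_mul_eQ (col v)) (h.eQ_mul_e (col v))).isUnit.mul ih
    have hact : ∀ k, actN N (PowerSeries.C (A k)) (word (fun v => T.baseP (col v)) (L k)) =
        fun ν => actN N (PowerSeries.C (A k)) (word (fun v => T.X 1 (col v)) (L k)) ν * u := by
      intro k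
      rw [hw, hu]
      ext ν
      simp only [actN, Finset.sum_mul, Finsupp.sum, smul_mul_assoc, mul_assoc]
    simp only [hact]
    rw [funext_iff, funext_iff]
    refine forall_congr' fun ν => ?_
    rw [Finset.sum_apply, Finset.sum_apply, ← Finset.sum_mul, Pi.zero_apply, huu.mul_left_eq_zero]

/-- The currents `x^-`, up to the factors `g_{ij}⁻¹`, satisfy the same relations as the currents
`X^-`. -/
theorem sum_words_neg_iff (hD : D.Admissible) (hN : pR R ^ N = 0) {ι : Type} [DecidableEq ι]
    (col : ι → D.I) {K : Type} (S : Finset K) (A : K → LP ι) (L : K → List ι) (L₀ : List ι)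
    (hL₀ : L₀.Nodup) (hL : ∀ k, (L k).Perm L₀) :
    ∑ k ∈ S, actN N (PowerSeries.C (A k) * pairProd (fun v w => EFree.gg (-1) (col v) (col w)
        (LP.frac (D.κ ^ (-D.m (col v) (col w))) w v)) (L k))
        (word (fun v => T.x N (-1) (col v)) (L k)) = 0 ↔
      ∑ k ∈ S, actN N (PowerSeries.C (A k)) (word (fun v => T.X (-1) (col v)) (L k)) = 0 := by
  simp only [x_neg_one]
  refine sum_actN_word_twistR_eq_zero_iff hN (s := fun v w => D.exM (col v) (col w))
    (fun v w m n => h.cM_comm _ _ m n) (fun v w n m _ hn => ?_) (fun v w _ => ?_) S A L L₀ hL₀ hL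
  · have := h.a_X_neg (col w) (col v) (l := n) (by omega) m
    rw [cM, smul_mul_assoc, this, smul_add, mul_smul_comm, smul_smul, exM, Nat.abs_cast,
      neg_one_mul, sub_neg_eq_add, add_assoc, ← add_smul, ← mul_add, scal_neg, neg_mul, map_neg,
      neg_add_cancel, mul_zero, zero_smul, add_zero]
  · rw [Pi.single_neg, Pi.single_neg, sub_neg_eq_add, neg_add_eq_sub]
    exact Gop_gSer D (pR_op_pow_eq_zero hN) _ _ _ _ _ (fun m _ => by
      rw [pp_pow_mul_exM hD]; simp; left; rfl)

/-- The commutator of `x_i^+(z)` and `x_j^-(w)` is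
`u_i^+(z) [X_i^+(z), X_j^-(w)] e^{-Q_i} u_j^-(w)`. -/
theorem commutator_x (hD : D.Admissible) (hN : pR R ^ N = 0) (i j : D.I) (n l : ℤ) :
    T.x N 1 i n * T.x N (-1) j l - T.x N (-1) j l * T.x N 1 i n =
      twist N 1 (T.cP i) (fun n' => twistR N (-1) (T.cM j) (fun l' =>
        (T.X 1 i n' * T.X (-1) j l' - T.X (-1) j l' * T.X 1 i n') * T.e i) l) n := by
  rw [x_one, x_neg_one]
  have key := commutator_twist_twistR hN (cp := T.cP i) (cm := T.cM j) (yp := T.baseP i)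
    (ym := T.X (-1) j) (s := fun n => D.hP i n * D.sM i j (-n)) (fun n m hn => by
      have := h.a_xM hN i j (l := -n) (by omega) m
      rw [x_neg_one] at this
      rw [cP, smul_mul_assoc, this, smul_add, mul_smul_comm, smul_smul, ← sub_eq_add_neg])
    (fun n m hn => by
      have := h.a_baseP j i (l := n) (by omega) m
      rw [cM, smul_mul_assoc, this, smul_add, mul_smul_comm, smul_smul, hP_mul_sM hD i j hn,
        Nat.abs_cast]) n l
  rw [key]
  have hB : ∀ n' l', T.baseP i n' * T.X (-1) j l' - T.X (-1) j l' * T.baseP i n' =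
      (T.X 1 i n' * T.X (-1) j l' - T.X (-1) j l' * T.X 1 i n') * T.e i := by
    intro n' l'
    rw [baseP, sub_mul, mul_assoc, show T.e i * T.X (-1) j l' = T.X (-1) j l' * T.e i from
      (h.eQ_X _ _ _ _).eq]
    simp only [mul_assoc]
  simp only [hB]

end IsBase
end TorData
end Datum
end EllTor

namespace EllTor

/-! ### Evaluation of series at a nilpotent value of `p` -/

section Eval
variable {A R : Type} [Ring A] [Algebra Coef A] [Ring R] [Algebra Coef R] [Algebra Lam R]
  [IsScalarTower Coef Lam R]

/-- A homomorphism to an `ℂ[q^{±c/2}][[p]]`-algebra which is compatible with the scalars and in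
which `p ^ N = 0`. -/
structure IsEval (π : A⟦X⟧ →ₐ[Coef] R) (N : ℕ) : Prop where
  map_ofCoef : ∀ f : Lam, π (ofCoef f) = algebraMap Lam R f
  pow_eq_zero : pR R ^ N = 0

/-- The inclusion of the constant series. -/
def constAlgHom (A : Type) [Ring A] [Algebra Coef A] : A →ₐ[Coef] A⟦X⟧ where
  toRingHom := PowerSeries.C
  commutes' c := PowerSeries.algebraMap_apply.symm

theorem constAlgHom_apply (r : A) : constAlgHom A r = PowerSeries.C r := rfl

theorem ofCoef_C (c : Coef) : (ofCoef (PowerSeries.C c) : A⟦X⟧) = algebraMap Coef A⟦X⟧ c := by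
  rw [ofCoef, PowerSeries.map_C, PowerSeries.algebraMap_apply]

theorem ofCoef_C_mul (c : Coef) (f : A⟦X⟧) : ofCoef (PowerSeries.C c) * f = c • f := by
  rw [ofCoef_C, Algebra.smul_def]

theorem C_smul_eq (c : Coef) (u : A) : (PowerSeries.C (c • u) : A⟦X⟧) = c • PowerSeries.C u :=
  map_smul (constAlgHom A) c u

theorem map_C_smul {R : Type} [Ring R] [Algebra Coef R] (π : A⟦X⟧ →ₐ[Coef] R) (c : Coef) (u : A) :
    π (PowerSeries.C (c • u)) = c • π (PowerSeries.C u) := by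
  rw [C_smul_eq, map_smul]

theorem ofCoef_C_mul_C (c : Coef) (u : A) :
    ofCoef (PowerSeries.C c) * PowerSeries.C u = (PowerSeries.C (c • u) : A⟦X⟧) := by
  rw [ofCoef_C_mul, C_smul_eq]

theorem ofCoef_X : (ofCoef PowerSeries.X : A⟦X⟧) = PowerSeries.X := by
  rw [ofCoef, PowerSeries.map_X]

/-- If the exponent is divisible by `p` in each degree, so is the exponential. -/
theorem X_pow_dvd_coeff_pexp {h h' : ℕ → Lam} (hh : ∀ n, h n = pp ^ n * h' n) (a : ℕ → A) (m : ℕ) :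
    (PowerSeries.X : A⟦X⟧) ^ m ∣
      coeff m (pexp (posSer fun n => ofCoef (h n) * (PowerSeries.C (a n) : A⟦X⟧))) := by
  have := coeff_pexp_posSer_smul (PowerSeries.X : A⟦X⟧) (fun r => (PowerSeries.commute_X r).symm)
    (fun n => ofCoef (h' n) * PowerSeries.C (a n)) m
  simp only [hh, map_mul, map_pow, show (ofCoef pp : A⟦X⟧) = PowerSeries.X from ofCoef_X, mul_assoc]
  exact ⟨_, this⟩

namespace IsEval
variable {π : A⟦X⟧ →ₐ[Coef] R} {N : ℕ} (h : IsEval π N)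
include h

theorem map_X : π PowerSeries.X = pR R := by
  rw [← ofCoef_X, h.map_ofCoef]; rfl

theorem map_ofCoef_mul (f : Lam) (g : A⟦X⟧) : π (ofCoef f * g) = f • π g := by
  rw [map_mul, h.map_ofCoef, Algebra.smul_def]

/-- Where `p ^ N = 0`, the value of a series depends only on its first `N` coefficients. -/
theorem map_eq_sum (f : A⟦X⟧) :
    π f = ∑ e ∈ Finset.range N, pR R ^ e * π (PowerSeries.C (coeff e f)) := by
  obtain ⟨g, hg⟩ := exists_eq_sum_add N f
  conv_lhs => rw [hg]
  rw [map_add, map_mul, map_pow, h.map_X, h.pow_eq_zero, zero_mul, add_zero, map_sum]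
  exact Finset.sum_congr rfl fun e _ => by rw [map_mul, map_pow, h.map_X]

theorem map_act {ι : Type} (G : (LP ι)⟦X⟧) (F : (ι → ℤ) → A) (ν : ι → ℤ) :
    π (act G F ν) = actN N G (fun ν => π (PowerSeries.C (F ν))) ν := by
  rw [h.map_eq_sum]
  refine Finset.sum_congr rfl fun e _ => ?_
  rw [act, PowerSeries.coeff_mk, Finsupp.sum, Finsupp.sum, ← constAlgHom_apply, map_sum, map_sum]
  refine congrArg _ (Finset.sum_congr rfl fun μ _ => ?_)
  rw [map_smul, map_smul, constAlgHom_apply]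

/-- Where `p ^ N = 0`, the product of two distributions is a finite sum, provided that its terms
outside a finite set are divisible by `p ^ N`. -/
theorem map_mulDist {F G : ℤ → A⟦X⟧} {n : ℤ} (S : Finset ℤ)
    (hS : ∀ e < N, ∀ r ∉ S, coeff e (F (n - r) * G r) = 0) :
    π (mulDist F G n) = ∑ r ∈ S, π (F (n - r)) * π (G r) := by
  simp only [← map_mul]
  rw [← map_sum, h.map_eq_sum, h.map_eq_sum (∑ r ∈ S, _)]
  refine Finset.sum_congr rfl fun e he => ?_
  rw [mulDist, PowerSeries.coeff_mk, map_sum, finsum_eq_sum_of_support_subset]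
  intro r hr
  by_contra hrS
  exact hr (hS e (Finset.mem_range.mp he) r hrS)

/-- The product of distributions if the first factor is a power series in `p z`. -/
theorem map_mulDist_left {F G : ℤ → A⟦X⟧} (hF : ∀ n, 0 < n → F n = 0)
    (hF' : ∀ m : ℕ, PowerSeries.X ^ m ∣ F (-m)) (n : ℤ) :
    π (mulDist F G n) = ∑ m ∈ Finset.range N, π (F (-m)) * π (G (n + m)) := by
  rw [h.map_mulDist ((Finset.range N).image fun m : ℕ => n + m), Finset.sum_image]
  · simp
  · intro a _ b _ hab; simpa using hab
  · intro e he r hr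
    rcases lt_or_ge r n with hrn | hrn
    · rw [hF _ (by omega), zero_mul, map_zero]
    · obtain ⟨k, hk⟩ := Int.eq_ofNat_of_zero_le (sub_nonneg.mpr hrn)
      obtain rfl : r = n + k := by omega
      have hkN : N ≤ k := by
        by_contra hkN
        exact hr (Finset.mem_image.mpr ⟨k, Finset.mem_range.mpr (by omega), rfl⟩)
      obtain ⟨g, hg⟩ := hF' k
      rw [show n - (n + k) = -(k : ℤ) by ring, hg, mul_assoc, PowerSeries.coeff_X_pow_mul',
        if_neg (by omega)]

/-- The product of distributions if the second factor is a power series in `p / z`. -/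
theorem map_mulDist_right {F G : ℤ → A⟦X⟧} (hG : ∀ n, n < 0 → G n = 0)
    (hG' : ∀ m : ℕ, PowerSeries.X ^ m ∣ G m) (n : ℤ) :
    π (mulDist F G n) = ∑ m ∈ Finset.range N, π (F (n - m)) * π (G m) := by
  rw [h.map_mulDist ((Finset.range N).image fun m : ℕ => (m : ℤ)), Finset.sum_image]
  · intro a _ b _ hab; simpa using hab
  · intro e he r hr
    rcases lt_or_ge r 0 with hrn | hrn
    · rw [hG _ hrn, mul_zero, map_zero]
    · obtain ⟨k, rfl⟩ := Int.eq_ofNat_of_zero_le hrn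
      have hkN : N ≤ k := by
        by_contra hkN
        exact hr (Finset.mem_image.mpr ⟨k, Finset.mem_range.mpr (by omega), rfl⟩)
      obtain ⟨g, hg⟩ := hG' k
      rw [hg, ← mul_assoc, (PowerSeries.commute_X_pow _ _).eq, mul_assoc,
        PowerSeries.coeff_X_pow_mul', if_neg (by omega)]

theorem map_coeff_pexp (k : ℕ → Lam) (a : ℕ → A) (m : ℕ) :
    π (coeff m (pexp (posSer fun n => ofCoef (k n) * (PowerSeries.C (a n) : A⟦X⟧)))) =
      coeff m (pexp (posSer fun n => k n • π (PowerSeries.C (a n)))) := by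
  have h1 : PowerSeries.map (π : A⟦X⟧ →+* R) (posSer fun n => ofCoef (k n) *
      (PowerSeries.C (a n) : A⟦X⟧)) = posSer fun n => k n • π (PowerSeries.C (a n)) := by
    ext n
    rw [PowerSeries.coeff_map, coeff_posSer, coeff_posSer]
    split_ifs
    · exact map_zero _
    · exact h.map_ofCoef_mul _ _
  have h2 := congrArg (coeff m) (map_pexp π (posSer fun n => ofCoef (k n) *
    (PowerSeries.C (a n) : A⟦X⟧)))
  rw [PowerSeries.coeff_map, h1] at h2
  exact h2

end IsEval

/-- The exponential of `f(p z)`, at `p ^ N = 0`. -/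
theorem coeff_pexp_pp_smul {k k' : ℕ → Lam} (hk : ∀ n, n ≠ 0 → k n = pp ^ n * k' n) (a : ℕ → R)
    (m : ℕ) : coeff m (pexp (posSer fun n => k n • a n)) =
      pR R ^ m * coeff m (pexp (posSer fun n => k' n • a n)) := by
  rw [← coeff_pexp_posSer_smul (pR R) commute_pR]
  refine congrArg (fun f => coeff m (pexp f)) (PowerSeries.ext fun n => ?_)
  rw [coeff_posSer, coeff_posSer]
  split_ifs with h0
  · rfl
  · rw [hk n h0, mul_smul, pp_pow_smul]

/-- The exponential of `f(q^{sc/2} z)`. -/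
theorem coeff_pexp_cpow_smul {a b : ℕ → R} (s : ℤ) (hab : ∀ n, n ≠ 0 → b n = cpow (s * n) • a n)
    (m : ℕ) : coeff m (pexp (posSer b)) = cpow (s * m) • coeff m (pexp (posSer a)) := by
  have := coeff_pexp_posSer_smul (algebraMap Coef R (cpow s)) (fun r => Algebra.commutes _ _) a m
  simp only [← map_pow, ← Algebra.smul_def, ← cpow_nsmul] at this
  rw [mul_comm s, ← this]
  refine congrArg (fun f => coeff m (pexp f)) (PowerSeries.ext fun n => ?_)
  rw [coeff_posSer, coeff_posSer]
  split_ifs with h0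
  · rfl
  · rw [hab n h0, mul_comm s]

end Eval

theorem map_trigPhi {A R : Type} [Ring A] [Algebra Coef A] [Ring R] [Algebra Coef R] (c : ℂ)
    (ε : ℤˣ) (k : A) (a : ℤ → A) (π : A →ₐ[Coef] R) (n : ℤ) :
    π (trigPhi c ε k a n) = trigPhi c ε (π k) (fun l => π (a l)) n := by
  have h1 : PowerSeries.map (π : A →+* R) (posSer fun n => scal ((ε : ℤ) * c) • a (ε * n)) =
      posSer fun n => scal ((ε : ℤ) * c) • π (a (ε * n)) := by
    ext n
    rw [PowerSeries.coeff_map, coeff_posSer, coeff_posSer]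
    split_ifs
    · exact map_zero _
    · exact map_smul π _ _
  have h2 : ∀ m, π (coeff m (pexp (posSer fun n => scal ((ε : ℤ) * c) • a (ε * n)))) =
      coeff m (pexp (posSer fun n => scal ((ε : ℤ) * c) • π (a (ε * n)))) := fun m => by
    rw [← h1, ← map_pexp, PowerSeries.coeff_map]; rfl
  rw [trigPhi, trigPhi, map_mul]
  congr 1
  by_cases hε : ε = 1
  · rw [if_pos hε, if_pos hε, inZInv, inZInv]
    by_cases hn : 0 ≤ n
    · rw [if_pos hn, if_pos hn, h2]
    · rw [if_neg hn, if_neg hn, map_zero]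
  · rw [if_neg hε, if_neg hε, inZ, inZ]
    by_cases hn : n ≤ 0
    · rw [if_pos hn, if_pos hn, h2]
    · rw [if_neg hn, if_neg hn, map_zero]

end EllTor

namespace EllTor

/-! ### The currents `φ_i^±` -/

section Split
variable {R : Type} [Ring R] [Algebra Coef R] [Algebra Lam R] [IsScalarTower Coef Lam R] {N : ℕ}

theorem inZ_eq_inZInv {R : Type} [Ring R] (f : R⟦X⟧) (n : ℤ) : inZ f n = inZInv f (-n) := by
  simp only [inZ, inZInv, Left.nonneg_neg_iff]

theorem inZInv_natCast {R : Type} [Ring R] (f : R⟦X⟧) (n : ℕ) : inZInv f n = coeff n f := by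
  simp [inZInv]

theorem inZ_neg_natCast {R : Type} [Ring R] (f : R⟦X⟧) (n : ℕ) : inZ f (-n) = coeff n f := by
  rw [inZ_eq_inZInv, neg_neg, inZInv_natCast]

theorem inZInv_of_neg {R : Type} [Ring R] (f : R⟦X⟧) {n : ℤ} (hn : n < 0) : inZInv f n = 0 :=
  if_neg (by omega)

theorem inZ_of_pos {R : Type} [Ring R] (f : R⟦X⟧) {n : ℤ} (hn : 0 < n) : inZ f n = 0 :=
  if_neg (by omega)

/-- If the exponent is the sum of a series `b(z)` and a series in `p z`, the exponential is a
product, in which only finitely many terms of the second factor contribute at `p ^ N = 0`. -/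
theorem inZInv_pexp_split (hN : pR R ^ N = 0) {f b c : ℕ → R} (s : ℤ)
    (hf : ∀ n, n ≠ 0 → f n = b n + (pp ^ n : Lam) • cpow (s * n) • c n)
    (hbc : ∀ m n, Commute (b m) (c n)) (j : ℤ) :
    inZInv (pexp (posSer f)) j = ∑ r ∈ Finset.range N, inZInv (pexp (posSer b)) (j - r) *
      ((pp ^ r : Lam) • cpow (s * r) • coeff r (pexp (posSer c))) := by
  rcases lt_or_ge j 0 with hj | hj
  · rw [inZInv_of_neg _ hj, Finset.sum_eq_zero]
    intro r _
    rw [inZInv_of_neg _ (by omega), zero_mul]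
  obtain ⟨j, rfl⟩ := Int.eq_ofNat_of_zero_le hj
  have h1 : posSer f = posSer b + posSer fun n => (pp ^ n : Lam) • cpow (s * n) • c n := by
    ext n
    rw [map_add, coeff_posSer, coeff_posSer, coeff_posSer]
    split_ifs with h0
    · rw [add_zero]
    · rw [hf n h0]
  rw [inZInv_natCast, h1, pexp_add (by rw [coeff_posSer, if_pos rfl])
    (by rw [coeff_posSer, if_pos rfl])
    (commute_posSer fun m n => ((hbc m n).smul_right _).smul_right _), PowerSeries.coeff_mul]
  have h2 : ∀ r, coeff r (pexp (posSer fun n => (pp ^ n : Lam) • cpow (s * n) • c n)) =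
      (pp ^ r : Lam) • cpow (s * r) • coeff r (pexp (posSer c)) := fun r => by
    have := coeff_pexp_pp_smul (k := fun n => pp ^ n) (k' := fun _ => 1) (fun n _ => by simp)
      (fun n => cpow (s * n) • c n) r
    rw [this, pp_pow_smul]
    simp only [one_smul]
    rw [coeff_pexp_cpow_smul s fun _ _ => rfl]
  simp only [h2]
  have h3 : ∀ r, N ≤ r → (pp ^ r : Lam) • cpow (s * r) • coeff r (pexp (posSer c)) = 0 :=
      fun r hr => by
    rw [pp_pow_smul, pR_pow_eq_zero hN hr, zero_mul]
  rw [← Finset.Nat.sum_antidiagonal_swap, Finset.Nat.sum_antidiagonal_eq_sum_range_succ_mk]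
  have h4 : ∀ r ∈ Finset.range (j + 1), coeff (j - r) (pexp (posSer b)) *
      ((pp ^ r : Lam) • cpow (s * r) • coeff r (pexp (posSer c))) =
      inZInv (pexp (posSer b)) ((j : ℤ) - r) *
      ((pp ^ r : Lam) • cpow (s * r) • coeff r (pexp (posSer c))) := fun r hr => by
    rw [Finset.mem_range] at hr
    rw [← inZInv_natCast, Nat.cast_sub (by omega)]
  refine (Finset.sum_congr rfl h4).trans ?_
  rcases le_total N (j + 1) with hle | hle
  · refine (Finset.sum_subset (Finset.range_subset_range.mpr hle) fun r _ hr => ?_).symm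
    rw [h3 r (by simpa using hr), mul_zero]
  · refine Finset.sum_subset (Finset.range_subset_range.mpr hle) fun r _ hr => ?_
    rw [Finset.mem_range] at hr
    rw [inZInv_of_neg _ (by omega), zero_mul]

end Split

namespace Datum
variable {D : Datum}

/-- The first exponent of `φ_i^+`, written with `a^∨_{i,-n}`, is that of `u_i^+(q^c z)`. -/
theorem neg_qdiff_mul_alS_neg (i : D.I) {n : ℕ} (hn : n ≠ 0) :
    PowerSeries.C (scal (-D.qdiff i)) * (pp ^ n * invOneSub pp n) * alS (-n) =
      pp ^ n * (PowerSeries.C (cpow (2 * n)) * D.hP i n) := by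
  have h1 := one_sub_pp_mul hn
  have h2 := congrArg (PowerSeries.C (R := Coef))
    (show cpow (2 * n) * (cpow n * cpow (-(4 * n))) = cpow (-n) by
      rw [← cpow_add, ← cpow_add]; congr 1; ring)
  rw [alS, if_neg (by omega), hP, Int.natAbs_neg, Int.natAbs_natCast, abs_neg, Nat.abs_cast]
  simp only [map_mul] at h2 ⊢
  linear_combination PowerSeries.C (scal (-D.qdiff i)) * pp ^ n * PowerSeries.C (cpow (-n)) *
    invOneSub pstar n * h1 - PowerSeries.C (scal (-D.qdiff i)) * pp ^ n * invOneSub pstar n * h2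

theorem qdiff_mul_alS (i : D.I) {n : ℕ} (hn : n ≠ 0) :
    PowerSeries.C (scal (D.qdiff i)) * invOneSub pp n * alS n = D.hM i n := by
  rw [alS, if_pos (by omega), hM, Nat.abs_cast]
  simp only [map_mul]
  ring

/-- `1 / (1 - p^n) = 1 + p^n / (1 - p^n)`: the exponent of `φ_i^+` in the `a^∨_{i,n}` is the sum of
that of `Φ_i^+` and that of `u_i^-`. -/
theorem qdiff_mul_invOneSub (i : D.I) {n : ℕ} (hn : n ≠ 0) :
    PowerSeries.C (scal (D.qdiff i)) * invOneSub pp n =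
      PowerSeries.C (scal (D.qdiff i)) + pp ^ n * (PowerSeries.C (cpow n) * D.hM i n) := by
  have h1 := one_sub_pp_mul hn
  have h2 := congrArg (PowerSeries.C (R := Coef)) (cpow_mul_neg n)
  rw [hM]
  simp only [map_mul, map_one] at h2 ⊢
  linear_combination PowerSeries.C (scal (D.qdiff i)) * h1 -
    PowerSeries.C (scal (D.qdiff i)) * pp ^ n * invOneSub pp n * h2

/-- `1 / (1 - p^{*n}) = 1 + p^{*n} / (1 - p^{*n})`: the exponent of `φ_i^-` in the `a^∨_{i,-n}` is
the sum of that of `Φ_i^-` and that of `u_i^+`. -/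
theorem neg_qdiff_mul_invOneSub (i : D.I) {n : ℕ} (hn : n ≠ 0) :
    PowerSeries.C (scal (-D.qdiff i)) * invOneSub pstar n =
      PowerSeries.C (scal (-D.qdiff i)) + pp ^ n * (PowerSeries.C (cpow (-n)) * D.hP i n) := by
  have h1 := one_sub_pstar_mul hn
  have h2 := congrArg (PowerSeries.C (R := Coef)) (cpow_mul_neg n)
  rw [hP]
  simp only [map_mul, map_one] at h2 ⊢
  linear_combination PowerSeries.C (scal (-D.qdiff i)) * h1 -
    PowerSeries.C (scal (-D.qdiff i)) * pp ^ n * invOneSub pstar n *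
      PowerSeries.C (cpow (-(4 * n))) * h2

theorem neg_qdiff_mul_alS_neg' (i : D.I) {n : ℕ} (hn : n ≠ 0) :
    PowerSeries.C (scal (-D.qdiff i)) * invOneSub pp n * alS (-n) =
      PowerSeries.C (cpow (-n)) * (PowerSeries.C (scal (-D.qdiff i)) * invOneSub pstar n) := by
  have h1 := one_sub_pp_mul hn
  rw [alS, if_neg (by omega), Int.natAbs_neg, Int.natAbs_natCast, abs_neg, Nat.abs_cast]
  linear_combination PowerSeries.C (scal (-D.qdiff i)) * PowerSeries.C (cpow (-n)) *
    invOneSub pstar n * h1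

namespace TorData
variable {R : Type} [Ring R] [Algebra Coef R] [Algebra Lam R]
  [IsScalarTower Coef Lam R] {T : D.TorData R} {N : ℕ}

/-- The coefficients of `Φ_i^ε(z)`, without the factor `k_i^ε`. -/
def trig (T : D.TorData R) (ε : ℤˣ) (i : D.I) (n : ℤ) : R :=
  inZInv (pexp (posSer fun n => scal ((ε : ℤ) * D.qdiff i) • T.a i (ε * n))) (ε * n)

theorem trigPhi_eq (ε : ℤˣ) (i : D.I) (n : ℤ) :
    trigPhi (D.qdiff i) ε (T.k ε i) (T.a i) n = T.k ε i * T.trig ε i n := by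
  rcases Int.units_eq_one_or ε with rfl | rfl
  · simp [trigPhi, trig]
  · simp only [trigPhi, trig, inZ_eq_inZInv, if_neg (show (-1 : ℤˣ) ≠ 1 by decide)]; simp

namespace IsBase
variable (h : T.IsBase)
include h

theorem commute_coeff_pexp_cP {r : R} (i : D.I) (hr : ∀ l, Commute r (T.a i l)) (m : ℕ) :
    Commute r (coeff m (pexp (posSer (T.cP i)))) :=
  commute_coeff_pexp (fun n => by
    rw [coeff_posSer]
    split_ifs
    · exact Commute.zero_right _
    · exact (hr _).smul_right _) m

theorem commute_trig {r : R} (i : D.I) (hr : ∀ l, Commute r (T.a i l)) (ε : ℤˣ) (n : ℤ) :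
    Commute r (T.trig ε i n) := by
  rw [trig, inZInv]
  split_ifs
  · refine commute_coeff_pexp (fun n => ?_) _
    rw [coeff_posSer]
    split_ifs
    · exact Commute.zero_right _
    · exact (hr _).smul_right _
  · exact Commute.zero_right _

omit h in
theorem map_expNeg_pp {π : D.EFree⟦X⟧ →ₐ[Coef] R} (hπ : IsEval π N)
    (hal : ∀ i l, π (PowerSeries.C (EFree.al i l)) = T.al i l) (i : D.I) (m : ℕ) :
    π (EFree.expNeg (-D.qdiff i) pp i (-m)) =
      (pp ^ m * PowerSeries.C (cpow (2 * m)) : Lam) • coeff m (pexp (posSer (T.cP i))) := by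
  rw [EFree.expNeg, inZ_neg_natCast, hπ.map_coeff_pexp]
  simp only [hal, al, smul_smul]
  rw [coeff_pexp_pp_smul (k' := fun n => PowerSeries.C (cpow (2 * n)) * D.hP i n)
    (fun n hn => neg_qdiff_mul_alS_neg i hn), coeff_pexp_cpow_smul (a := T.cP i) 2 fun n _ => by
      rw [mul_smul, C_smul]; rfl, mul_smul, pp_pow_smul, C_smul]

omit h in
theorem map_expPos_pp {π : D.EFree⟦X⟧ →ₐ[Coef] R} (hπ : IsEval π N)
    (hal : ∀ i l, π (PowerSeries.C (EFree.al i l)) = T.al i l) (i : D.I) (m : ℕ) :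
    π (EFree.expPos (D.qdiff i) pp i m) = (pp ^ m : Lam) • coeff m (pexp (posSer (T.cM i))) := by
  rw [EFree.expPos, inZInv_natCast, hπ.map_coeff_pexp]
  simp only [hal, al, smul_smul]
  rw [coeff_pexp_pp_smul (k' := fun n => D.hM i n) (fun n hn => by
    rw [← qdiff_mul_alS i hn]; ring), pp_pow_smul]
  rfl

theorem map_expPos_one {π : D.EFree⟦X⟧ →ₐ[Coef] R} (hπ : IsEval π N)
    (hal : ∀ i l, π (PowerSeries.C (EFree.al i l)) = T.al i l) (i : D.I) (j : ℤ) :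
    π (EFree.expPos (D.qdiff i) 1 i j) = ∑ r ∈ Finset.range N,
      (PowerSeries.C (cpow (-j)) * (pp ^ r * PowerSeries.C (cpow r)) : Lam) •
        (T.trig 1 i (j - r) * coeff r (pexp (posSer (T.cM i)))) := by
  have h1 := inZInv_pexp_split hπ.pow_eq_zero (f := fun n => (PowerSeries.C (scal (D.qdiff i)) *
    invOneSub pp n : Lam) • T.a i n) (b := fun n => scal (D.qdiff i) • T.a i n)
    (c := T.cM i) 1 (fun n hn => by
      rw [qdiff_mul_invOneSub i hn, add_smul, C_smul, cM, mul_smul, mul_smul, C_smul, one_mul])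
    (fun m n => by
      have := h.commute_a_of_nat 1 i i m n (Or.inl rfl)
      simp only [one_mul] at this
      exact (this.smul_left _).smul_right _) j
  have h2 : π (EFree.expPos (D.qdiff i) 1 i j) = cpow (-j) • inZInv (pexp (posSer
      fun n => (PowerSeries.C (scal (D.qdiff i)) * invOneSub pp n : Lam) • T.a i n)) j := by
    rcases lt_or_ge j 0 with hj | hj
    · rw [EFree.expPos, inZInv_of_neg _ hj, inZInv_of_neg _ hj, map_zero, smul_zero]
    · obtain ⟨j, rfl⟩ := Int.eq_ofNat_of_zero_le hj
      rw [EFree.expPos, inZInv_natCast, inZInv_natCast, hπ.map_coeff_pexp]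
      simp only [hal, al, smul_smul]
      rw [coeff_pexp_cpow_smul (-1) (a := fun n => (PowerSeries.C (scal (D.qdiff i)) *
        invOneSub pp n : Lam) • T.a i n) fun n hn => ?_, neg_one_mul]
      rw [one_pow, one_mul, alS, if_pos (by omega), mul_one, Nat.abs_cast, mul_comm, mul_smul,
        C_smul, neg_one_mul]
  rw [h2, h1, Finset.smul_sum]
  refine Finset.sum_congr rfl fun r _ => ?_
  rw [mul_smul, C_smul, mul_smul, C_smul, mul_smul_comm, mul_smul_comm, one_mul, trig,
    Units.val_one, Int.cast_one, one_mul]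
  simp only [one_mul]

theorem map_expNeg_one {π : D.EFree⟦X⟧ →ₐ[Coef] R} (hπ : IsEval π N)
    (hal : ∀ i l, π (PowerSeries.C (EFree.al i l)) = T.al i l) (i : D.I) (j : ℤ) :
    π (EFree.expNeg (-D.qdiff i) 1 i j) = ∑ m ∈ Finset.range N,
      (PowerSeries.C (cpow j) * (pp ^ m * PowerSeries.C (cpow (-m))) : Lam) •
        (coeff m (pexp (posSer (T.cP i))) * T.trig (-1) i (j + m)) := by
  have hcomm : ∀ m n : ℕ, Commute (T.a i (-m)) (T.cP i n) := fun m n => by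
    have := h.commute_a_of_nat (-1) i i m n (Or.inr rfl)
    simp only [neg_one_mul] at this
    exact this.smul_right _
  have h1 := inZInv_pexp_split hπ.pow_eq_zero (f := fun n => (PowerSeries.C (scal (-D.qdiff i)) *
    invOneSub pstar n : Lam) • T.a i (-n)) (b := fun n => scal (-D.qdiff i) • T.a i (-n))
    (c := T.cP i) (-1) (fun n hn => by
      rw [neg_qdiff_mul_invOneSub i hn, add_smul, C_smul, cP, mul_smul, mul_smul, C_smul,
        neg_one_mul])
    (fun m n => (hcomm m n).smul_left _) (-j)
  have h2 : π (EFree.expNeg (-D.qdiff i) 1 i j) = cpow j • inZInv (pexp (posSer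
      fun n => (PowerSeries.C (scal (-D.qdiff i)) * invOneSub pstar n : Lam) • T.a i (-n)))
        (-j) := by
    rw [EFree.expNeg, inZ_eq_inZInv]
    obtain ⟨j, rfl⟩ : ∃ j', j = -j' := ⟨-j, by ring⟩
    rw [neg_neg]
    rcases lt_or_ge j 0 with hj | hj
    · rw [inZInv_of_neg _ hj, inZInv_of_neg _ hj, map_zero, smul_zero]
    · obtain ⟨j, rfl⟩ := Int.eq_ofNat_of_zero_le hj
      rw [inZInv_natCast, inZInv_natCast, hπ.map_coeff_pexp]
      simp only [hal, al, smul_smul]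
      rw [coeff_pexp_cpow_smul (-1) (a := fun n => (PowerSeries.C (scal (-D.qdiff i)) *
        invOneSub pstar n : Lam) • T.a i (-n)) fun n hn => ?_, neg_one_mul]
      rw [one_pow, one_mul, neg_qdiff_mul_alS_neg' i hn, mul_smul, C_smul, neg_one_mul]
  rw [h2, h1, Finset.smul_sum]
  refine Finset.sum_congr rfl fun m _ => ?_
  have hc : Commute (coeff m (pexp (posSer (T.cP i)))) (T.trig (-1) i (j + m)) := by
    rw [trig, inZInv]
    split_ifs
    · refine commute_coeff_pexp (fun n => ?_) _
      rw [coeff_posSer]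
      split_ifs
      · exact Commute.zero_right _
      · refine Commute.smul_right (Commute.symm (commute_coeff_pexp (fun n' => ?_) _)) _
        rw [coeff_posSer]
        split_ifs
        · exact Commute.zero_right _
        · simpa using hcomm n n'
    · exact Commute.zero_right _
  rw [mul_smul, C_smul, mul_smul, C_smul, mul_smul_comm, mul_smul_comm, neg_one_mul, hc.eq, trig]
  rw [show ((-1 : ℤˣ) : ℤ) * (j + m) = -j - m by push_cast; ring]
  simp

/-- Reordering of the factors of `φ_i^±`. -/
theorem K_mul (ε : ℤˣ) (i : D.I) (m : ℕ) (n : ℤ) (E' : R) {c c' : Lam} (hc : c = c') :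
    c • (T.K ε i * (coeff m (pexp (posSer (T.cP i))) * (T.trig ε i n * E'))) =
      c' • (coeff m (pexp (posSer (T.cP i))) * (T.k ε i * T.trig ε i n * T.e i * E')) := by
  have hkE := h.commute_coeff_pexp_cP i (h.k_a ε i i) m
  have heE : Commute (T.e i) _ := h.commute_coeff_pexp_cP i (h.eQ_a (-Pi.single i 1) i) m
  have het : Commute (T.e i) _ := h.commute_trig i (h.eQ_a (-Pi.single i 1) i) ε n
  rw [hc, K]
  congr 1
  simp only [← mul_assoc]
  congr 1
  rw [mul_assoc _ _ (coeff m _), heE.eq, ← mul_assoc, hkE.eq,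
    mul_assoc _ _ (T.trig ε i n), het.eq]
  simp only [mul_assoc]

theorem map_phi_one {π : D.EFree⟦X⟧ →ₐ[Coef] R} (hπ : IsEval π N)
    (hal : ∀ i l, π (PowerSeries.C (EFree.al i l)) = T.al i l)
    (hK : ∀ ε i, π (PowerSeries.C (EFree.K ε i)) = T.K ε i) (i : D.I) (n : ℤ) :
    π (EFree.phi 1 i n) = T.phi N 1 i n := by
  rw [EFree.phi, scaleArg, map_smul, EFree.phiShifted, map_mul, hK, phi, if_pos rfl, if_pos rfl,
    hπ.map_mulDist_left (F := EFree.expNeg (-D.qdiff i) pp i) (fun n hn => inZ_of_pos _ hn)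
    (fun m => by
      rw [EFree.expNeg, inZ_neg_natCast]
      exact X_pow_dvd_coeff_pexp (h' := fun n => PowerSeries.C (scal (-D.qdiff i)) *
        invOneSub pp n) (fun n => by ring) _ m)]
  simp only [map_expNeg_pp hπ hal, h.map_expPos_one hπ hal, Finset.mul_sum, Finset.smul_sum,
    trigPhi_eq, ← pp_pow_smul, ← C_smul (R := R)]
  refine Finset.sum_congr rfl fun m _ => Finset.sum_congr rfl fun r _ => ?_
  simp only [smul_mul_assoc, mul_smul_comm, smul_smul]
  refine h.K_mul 1 i m _ _ ?_
  have := congrArg (PowerSeries.C (R := Coef)) (show cpow (-(-((1 : ℤˣ) : ℤ) * n)) *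
    (cpow (2 * m) * (cpow (-(n + m)) * cpow r)) = cpow (((1 : ℤˣ) : ℤ) * (m + r)) by
      simp only [← cpow_add]; congr 1; push_cast; ring)
  simp only [map_mul] at this ⊢
  linear_combination pp ^ m * pp ^ r * this

theorem map_phi_neg_one {π : D.EFree⟦X⟧ →ₐ[Coef] R} (hπ : IsEval π N)
    (hal : ∀ i l, π (PowerSeries.C (EFree.al i l)) = T.al i l)
    (hK : ∀ ε i, π (PowerSeries.C (EFree.K ε i)) = T.K ε i) (i : D.I) (n : ℤ) :
    π (EFree.phi (-1) i n) = T.phi N (-1) i n := by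
  rw [EFree.phi, scaleArg, map_smul, EFree.phiShifted, map_mul, hK, phi, if_neg (by decide),
    if_neg (by decide),
    hπ.map_mulDist_right (G := EFree.expPos (D.qdiff i) pp i) (fun n hn => inZInv_of_neg _ hn)
    (fun m => by
      rw [EFree.expPos, inZInv_natCast]
      exact X_pow_dvd_coeff_pexp (h' := fun n => PowerSeries.C (scal (D.qdiff i)) *
        invOneSub pp n) (fun n => by ring) _ m)]
  simp only [map_expPos_pp hπ hal, h.map_expNeg_one hπ hal, Finset.mul_sum, Finset.smul_sum,
    Finset.sum_mul, trigPhi_eq, ← pp_pow_smul, ← C_smul (R := R)]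
  rw [Finset.sum_comm]
  refine Finset.sum_congr rfl fun m _ => Finset.sum_congr rfl fun r _ => ?_
  rw [show n - (r : ℤ) + m = n + m - r by ring]
  simp only [smul_mul_assoc, mul_smul_comm, smul_smul]
  rw [mul_assoc (coeff m _)]
  refine h.K_mul (-1) i m _ _ ?_
  have := congrArg (PowerSeries.C (R := Coef)) (show cpow (-(-((-1 : ℤˣ) : ℤ) * n)) *
    (cpow (n - r) * cpow (-m)) = cpow (((-1 : ℤˣ) : ℤ) * (m + r)) by
      simp only [← cpow_add]; congr 1; push_cast; ring)
  simp only [map_mul] at this ⊢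
  linear_combination pp ^ m * pp ^ r * this

/-- The elements `φ_i^±`, defined in the elliptic algebra by exponentials of the `α^∨_{i,n}`, are
sent to `u_i^+(q^{±c/2} z) Φ_i^±(z) e^{-Q_i} u_i^-(q^{∓c/2} z)`. -/
theorem map_phi {π : D.EFree⟦X⟧ →ₐ[Coef] R} (hπ : IsEval π N)
    (hal : ∀ i l, π (PowerSeries.C (EFree.al i l)) = T.al i l)
    (hK : ∀ ε i, π (PowerSeries.C (EFree.K ε i)) = T.K ε i) (ε : ℤˣ) (i : D.I) (n : ℤ) :
    π (EFree.phi ε i n) = T.phi N ε i n := by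
  rcases Int.units_eq_one_or ε with rfl | rfl
  · exact h.map_phi_one hπ hal hK i n
  · exact h.map_phi_neg_one hπ hal hK i n

end IsBase
end TorData
end Datum
end EllTor

namespace EllTor
namespace Datum
namespace TorData
variable {D : Datum} {R : Type} [Ring R] [Algebra Coef R]

/-! ### The relations of the smash product -/

/-- The images of the generators of the quantum toroidal algebra. -/
def gen (T : D.TorData R) : D.Gen → R
  | .a i l => T.a i l
  | .X ε i n => T.X ε i n
  | .k ε i => T.k ε i
  | .qd ε => T.qd ε

/-- The homomorphism from the free algebra. -/
def lift (T : D.TorData R) : D.TFree →ₐ[Coef] R := FreeAlgebra.lift Coef T.gen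

/-- The relations of the smash product. -/
structure IsTor (T : D.TorData R) : Prop where
  a_zero : ∀ i, T.a i 0 = 0
  rel : ∀ u v, D.TRel u v → T.lift u = T.lift v
  eQ_zero : T.eQ 0 = 1
  eQ_add : ∀ α β, T.eQ (α + β) = T.eQ α * T.eQ β
  eQ_gen : ∀ α g, Commute (T.eQ α) (T.gen g)
  fn_add : ∀ f g, T.fn (f + g) = T.fn f + T.fn g
  fn_mul : ∀ f g, T.fn (f * g) = T.fn f * T.fn g
  fn_const : ∀ z : ℂ, T.fn (algebraMap ℂ D.Mer z) = algebraMap Coef R (scal z)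
  fn_gen : ∀ f g, T.fn f * T.gen g = T.gen g * T.fn (D.shift (D.latVec (g.wt, 0)) f)
  eQ_fn : ∀ α f, T.eQ α * T.fn f = T.fn (D.shift (-D.latVec (0, α)) f) * T.eQ α

section Lift
variable {T : D.TorData R}

theorem lift_gen (g : D.Gen) : T.lift (TFree.gen g) = T.gen g := FreeAlgebra.lift_ι_apply _ _

theorem lift_a (h : ∀ i, T.a i 0 = 0) (i : D.I) (l : ℤ) : T.lift (TFree.a i l) = T.a i l := by
  rw [TFree.a]
  split_ifs with hl
  · exact lift_gen _
  · rw [map_zero, not_not.mp hl, h]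

theorem lift_X (ε : ℤˣ) (i : D.I) (n : ℤ) : T.lift (TFree.X ε i n) = T.X ε i n := lift_gen _

theorem lift_k (ε : ℤˣ) (i : D.I) : T.lift (TFree.k ε i) = T.k ε i := lift_gen _

theorem lift_qd (ε : ℤˣ) : T.lift (TFree.qd ε) = T.qd ε := lift_gen _

theorem lift_Phi (h : ∀ i, T.a i 0 = 0) (ε : ℤˣ) (i : D.I) (n : ℤ) :
    T.lift (TFree.Phi ε i n) = trigPhi (D.qdiff i) ε (T.k ε i) (T.a i) n := by
  rw [TFree.Phi, map_trigPhi, lift_k]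
  simp only [lift_a h]

theorem lift_prod_k (ε : ℤˣ) (c : D.I → ℕ) :
    T.lift (List.ofFn fun i => TFree.k ε i ^ c i).prod =
        (List.ofFn fun i => T.k ε i ^ c i).prod := by
  rw [map_list_prod, List.map_ofFn]
  congr 2
  ext i
  simp [lift_k]

end Lift

theorem IsTor.a_gen {T : D.TorData R} (h : T.IsTor) {r : R} (i : D.I)
    (hr : ∀ g : D.Gen, Commute r (T.gen g)) (l : ℤ) : Commute r (T.a i l) := by
  rcases eq_or_ne l 0 with rfl | hl
  · rw [h.a_zero]; exact Commute.zero_right _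
  · exact hr (.a i ⟨l, hl⟩)

section Unpack
variable {T : D.TorData R} (h : T.IsTor)
include h

namespace IsTor

theorem central (ε : ℤˣ) (c : D.I → ℕ) (hc : D.A.mulVec (fun i => (c i : ℤ)) = 0) (g : D.Gen) :
    Commute (List.ofFn fun i => T.k ε i ^ c i).prod (T.gen g) := by
  rw [commute_iff_eq]
  have := h.rel _ _ (.central ε c hc g)
  simpa only [map_mul, lift_prod_k, lift_gen] using this

theorem k_inv (ε : ℤˣ) (i : D.I) : T.k ε i * T.k (-ε) i = 1 := by
  simpa only [map_mul, map_one, lift_k] using h.rel _ _ (.k_inv ε i)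

theorem k_k (ε ε' : ℤˣ) (i j : D.I) : Commute (T.k ε i) (T.k ε' j) := by
  rw [commute_iff_eq]
  simpa only [map_mul, lift_k] using h.rel _ _ (.k_k ε ε' i j)

theorem qd_inv (ε : ℤˣ) : T.qd ε * T.qd (-ε) = 1 := by
  simpa only [map_mul, map_one, lift_qd] using h.rel _ _ (.qd_inv ε)

theorem qd_k (ε ε' : ℤˣ) (i : D.I) : Commute (T.qd ε) (T.k ε' i) := by
  rw [commute_iff_eq]
  simpa only [map_mul, lift_qd, lift_k] using h.rel _ _ (.qd_k ε ε' i)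

theorem qd_a (i : D.I) (l : ℤ) : T.qd 1 * T.a i l = scal (D.q ^ l) • (T.a i l * T.qd 1) := by
  simpa only [map_mul, map_smul, lift_qd, lift_a h.a_zero] using h.rel _ _ (.qd_a i l)

theorem qd_X (ε : ℤˣ) (i : D.I) (n : ℤ) :
    T.qd 1 * T.X ε i n = scal (D.q ^ n) • (T.X ε i n * T.qd 1) := by
  simpa only [map_mul, map_smul, lift_qd, lift_X] using h.rel _ _ (.qd_X ε i n)

theorem k_X_one (ε : ℤˣ) (i j : D.I) (n : ℤ) :
    T.k 1 i * T.X ε j n = scal (D.q ^ (ε * D.b i j)) • (T.X ε j n * T.k 1 i) := by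
  simpa only [map_mul, map_smul, lift_k, lift_X] using h.rel _ _ (.k_X ε i j n)

theorem k_X (hD : D.Admissible) (ε ε' : ℤˣ) (i j : D.I) (n : ℤ) :
    T.k ε i * T.X ε' j n = scal (D.q ^ ((ε : ℤ) * ε' * D.b i j)) • (T.X ε' j n * T.k ε i) := by
  rcases Int.units_eq_one_or ε with rfl | rfl
  · simpa using h.k_X_one ε' i j n
  · have h1 := h.k_X_one ε' i j n
    have h2 : T.k (-1) i * T.k 1 i = 1 := by simpa using h.k_inv (-1) i
    have h3 : T.k 1 i * T.k (-1) i = 1 := h.k_inv 1 i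
    have h4 : T.X ε' j n * T.k (-1) i =
        scal (D.q ^ ((ε' : ℤ) * D.b i j)) • (T.k (-1) i * T.X ε' j n) := by
      calc T.X ε' j n * T.k (-1) i
          = T.k (-1) i * (T.k 1 i * T.X ε' j n) * T.k (-1) i := by
            rw [← mul_assoc (T.k (-1) i), h2, one_mul]
        _ = _ := by
            rw [h1, mul_smul_comm, smul_mul_assoc]
            simp only [mul_assoc, h3, mul_one]
    rw [h4, smul_smul, ← scal_mul, ← zpow_add₀ hD.q_ne]
    simp [scal_one]

theorem X_X (ε : ℤˣ) (i j : D.I) (n l : ℤ) :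
    scal (D.κ ^ D.m i j) • (T.X ε i (n + 1) * T.X ε j l)
          - scal (D.q ^ (ε * D.b i j)) • (T.X ε i n * T.X ε j (l + 1)) =
        scal (D.κ ^ D.m i j * D.q ^ (ε * D.b i j)) • (T.X ε j l * T.X ε i (n + 1))
          - T.X ε j (l + 1) * T.X ε i n := by
  simpa only [map_sub, map_mul, map_smul, lift_X] using h.rel _ _ (.X_X ε i j n l)

theorem Xp_Xm (i j : D.I) (n l : ℤ) :
    T.X 1 i n * T.X (-1) j l - T.X (-1) j l * T.X 1 i n =
      if i = j then scal (D.qdiff i)⁻¹ •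
        (cpow (n - l) • trigPhi (D.qdiff i) 1 (T.k 1 i) (T.a i) (n + l) -
          cpow (l - n) • trigPhi (D.qdiff i) (-1) (T.k (-1) i) (T.a i) (n + l)) else 0 := by
  have := h.rel _ _ (.Xp_Xm i j n l)
  split_ifs at this ⊢ <;>
    simpa only [map_sub, map_mul, map_smul, lift_X, map_zero, lift_Phi h.a_zero] using this

theorem serre (ε : ℤˣ) (i j : D.I) (hij : i ≠ j) (s : ℕ) (hs : (s : ℤ) = 1 - D.A i j)
    (n : Fin s → ℤ) (l : ℤ) :
    ∑ σ : Equiv.Perm (Fin s), ∑ r ∈ Finset.range (s + 1),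
      scal ((-1) ^ r * D.qbinom i s r) •
        (((List.ofFn fun t => T.X ε i (n (σ t))).take r).prod * T.X ε j l *
          ((List.ofFn fun t => T.X ε i (n (σ t))).drop r).prod) = 0 := by
  have := h.rel _ _ (.serre ε i j hij s hs n l)
  simpa only [map_sum, map_mul, map_smul, map_list_prod, List.map_take, List.map_drop,
    List.map_ofFn, Function.comp_def, lift_X, map_zero] using this

theorem eQ_a (α : D.I → ℤ) (i : D.I) (l : ℤ) : Commute (T.eQ α) (T.a i l) :=
  h.a_gen i (h.eQ_gen α) l

theorem fn_a (f : D.Mer) (i : D.I) (l : ℤ) : Commute (T.fn f) (T.a i l) := by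
  rcases eq_or_ne l 0 with rfl | hl
  · rw [h.a_zero]; exact Commute.zero_right _
  · have := h.fn_gen f (.a i ⟨l, hl⟩)
    rwa [show D.latVec ((Gen.a i ⟨l, hl⟩ : D.Gen).wt, 0) = 0 from map_zero D.latVec,
        shift_zero] at this

theorem fn_k (f : D.Mer) (ε : ℤˣ) (i : D.I) : Commute (T.fn f) (T.k ε i) := by
  have := h.fn_gen f (.k ε i)
  rwa [show D.latVec ((Gen.k ε i : D.Gen).wt, 0) = 0 from map_zero D.latVec, shift_zero] at this

theorem fn_qd (f : D.Mer) (ε : ℤˣ) : Commute (T.fn f) (T.qd ε) := by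
  have := h.fn_gen f (.qd ε)
  rwa [show D.latVec ((Gen.qd ε : D.Gen).wt, 0) = 0 from map_zero D.latVec, shift_zero] at this

end IsTor
end Unpack

/-- The relations used for twisting are among those of the smash product. -/
theorem IsTor.isBase [Algebra Lam R] [IsScalarTower Coef Lam R] {T : D.TorData R} (h : T.IsTor) :
    T.IsBase where
  a_zero := h.a_zero
  a_a i j l m hl hm := by
    have := h.rel _ _ (.a_a i j l m hl hm)
    rw [map_sub, map_mul, map_mul, lift_a h.a_zero, lift_a h.a_zero, sub_eq_iff_eq_add'] at this
    rw [this]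
    split_ifs
    · rw [map_smul, map_one, C_smul]
    · rw [map_zero]
  a_X ε i j l n hl := by
    have := h.rel _ _ (.a_X ε i j l n hl)
    rw [map_sub, map_mul, map_mul, map_smul, lift_a h.a_zero, lift_X, lift_X,
      sub_eq_iff_eq_add'] at this
    rw [this, C_smul]
  k_a ε i j l := by
    rw [commute_iff_eq]
    simpa only [map_mul, lift_k, lift_a h.a_zero] using h.rel _ _ (.k_a ε i j l)
  eQ_zero := h.eQ_zero
  eQ_add := h.eQ_add
  eQ_a := h.eQ_a
  eQ_X α ε i n := h.eQ_gen α (.X ε i n)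
  eQ_k α ε i := h.eQ_gen α (.k ε i)

end TorData

/-! ### Words in the Serre relations -/

theorem latVec_single_left (D : Datum) (j : D.I) (n : ℤ) :
    D.latVec (Pi.single j n, 0) = n • D.rootVec j := by
  simp [latVec, Pi.single_apply]

theorem latVec_single_right (D : Datum) (j : D.I) (n : ℤ) :
    D.latVec (0, Pi.single j n) = n • D.QVec j := by
  simp [latVec, Pi.single_apply]

theorem shift_shift (D : Datum) (v w : D.HDual) (f : D.Mer) :
    D.shift v (D.shift w f) = D.shift (v + w) f := by
  rw [shift_add]; rfl

section SerreWord
variable {R : Type} [Ring R] {s : ℕ}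

/-- The word `z_{σ(1)} ⋯ z_{σ(r)} w z_{σ(r+1)} ⋯ z_{σ(s)}`. -/
def serreList (σ : Equiv.Perm (Fin s)) (r : ℕ) : List (Option (Fin s)) :=
  (List.ofFn fun t => some (σ t)).take r ++ none :: (List.ofFn fun t => some (σ t)).drop r

theorem serreList_perm (σ : Equiv.Perm (Fin s)) (r : ℕ) :
    (serreList σ r).Perm (none :: (List.finRange s).map some) := by
  refine List.perm_middle.trans (List.Perm.cons _ ?_)
  rw [List.take_append_drop]
  rw [← List.ofFn_eq_map]
  exact Equiv.Perm.ofFn_comp_perm σ some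

theorem nodup_none_cons_finRange :
    (none :: (List.finRange s).map some : List (Option (Fin s))).Nodup := by
  rw [List.nodup_cons]
  exact ⟨by simp, (List.nodup_finRange s).map (Option.some_injective _)⟩

theorem word_serreList (y : Option (Fin s) → ℤ → R) (σ : Equiv.Perm (Fin s)) (r : ℕ)
    (ν : Option (Fin s) → ℤ) : word y (serreList σ r) ν =
      ((List.ofFn fun t => y (some (σ t)) (-ν (some (σ t)))).take r).prod * y none (-ν none) *
        ((List.ofFn fun t => y (some (σ t)) (-ν (some (σ t)))).drop r).prod := by
  rw [word, serreList, List.map_append, List.prod_append, List.map_cons, List.prod_cons,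
    List.map_take, List.map_drop, List.map_ofFn, mul_assoc]
  rfl

/-- The product over pairs of positions in a list. -/
theorem pairProd_ofFn {ι B : Type} [CommMonoid B] (g : ι → ι → B) {n : ℕ} (x : Fin n → ι) :
    pairProd g (List.ofFn x) = ∏ k : Fin n, ∏ m : Fin n, if k < m then g (x k) (x m) else 1 := by
  induction n with
  | zero => simp [pairProd]
  | succ n ih =>
    rw [List.ofFn_succ, pairProd, ih, Fin.prod_univ_succ]
    simp only [Fin.prod_univ_succ]
    simp [List.map_ofFn, List.prod_ofFn]

end SerreWord

end Datum
end EllTor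

namespace EllTor

/-! ### The quadratic, Serre and commutator relations of the twisted currents -/

section ActN
variable {ι R : Type} [Ring R] [Algebra Coef R] [Algebra Lam R] [IsScalarTower Coef Lam R] {N : ℕ}

theorem actN_neg_C_mul [DecidableEq ι] (A : LP ι) (P : (LP ι)⟦X⟧) (F : (ι → ℤ) → R) :
    actN N (PowerSeries.C (-A) * P) F = -actN N (PowerSeries.C A * P) F := by
  have h1 : PowerSeries.C (-A) * P = -(PowerSeries.C A * P) := by
    rw [map_neg]; exact neg_mul (PowerSeries.C A) P
  rw [← Gop_apply, ← Gop_apply, h1, Gop, map_neg, evp_neg]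
  rfl

theorem actN_algebraMap_C_mul [DecidableEq ι] (c : Coef) (P : (LP ι)⟦X⟧)
    (F : (ι → ℤ) → R) (ν : ι → ℤ) :
    actN N (PowerSeries.C (algebraMap Coef (LP ι) c) * P) F ν = c • actN N P F ν := by
  have h1 : PowerSeries.C (algebraMap Coef (LP ι) c) * P = c • P := by
    rw [Algebra.smul_def, PowerSeries.algebraMap_apply]
  have h2 : PowerSeries.map ((Sop ι R : LP ι →ₐ[Coef] DEnd ι R) : LP ι →+* DEnd ι R) (c • P) =
      c • PowerSeries.map ((Sop ι R : LP ι →ₐ[Coef] DEnd ι R) : LP ι →+* DEnd ι R) P := by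
    ext n : 1
    rw [PowerSeries.coeff_map, PowerSeries.coeff_smul, PowerSeries.coeff_smul,
        PowerSeries.coeff_map]
    exact map_smul (Sop ι R) c _
  rw [← Gop_apply, ← Gop_apply, h1, Gop]
  refine (congrArg (fun f : (DEnd ι R)⟦X⟧ => (evp N f : DEnd ι R) F ν) h2).trans ?_
  rw [evp_smul]
  rfl

theorem actN_C (hN : pR R ^ N = 0) [DecidableEq ι] (A : LP ι) (F : (ι → ℤ) → R) (ν : ι → ℤ) :
    actN N (PowerSeries.C A) F ν = A.coeff.sum fun μ r => r • F (ν - μ) := by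
  rw [← Gop_apply, Gop_C hN, Sop_apply]

theorem actN_smul_var_sub_smul_var (hN : pR R ^ N = 0) [DecidableEq ι] (v w : ι) (c d : Coef)
    (F : (ι → ℤ) → R) (ν : ι → ℤ) :
    actN N (PowerSeries.C (c • LP.var v - d • LP.var w)) F ν =
      c • F (ν - Pi.single v 1) - d • F (ν - Pi.single w 1) := by
  rw [actN_C hN, ← Sop_apply, map_sub, map_smul, map_smul, LP.var, LP.var, Sop_single, Sop_single]
  simp

theorem actN_smul_var_sub_var (hN : pR R ^ N = 0) [DecidableEq ι] (v w : ι) (c : Coef)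
    (F : (ι → ℤ) → R) (ν : ι → ℤ) : actN N (PowerSeries.C (c • LP.var v - LP.var w)) F ν =
      c • F (ν - Pi.single v 1) - F (ν - Pi.single w 1) := by
  have := actN_smul_var_sub_smul_var hN v w c 1 F ν
  rwa [one_smul, one_smul] at this

end ActN

theorem pairProd_append_cons {ι B : Type} [CommMonoid B] (g : ι → ι → B) (L L' : List ι) (v : ι) :
    pairProd g (L ++ v :: L') =
      pairProd g (L ++ L') * ((L.map fun w => g w v).prod * (L'.map (g v)).prod) := by
  rw [pairProd_append, pairProd_append, pairProd]
  simp only [List.map_cons, List.prod_cons, List.prod_map_mul]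
  ac_rfl

theorem prod_take_ofFn_mul_prod_drop_ofFn {B : Type} [CommMonoid B] {n : ℕ} (f g : Fin n → B)
    (r : ℕ) :
    ((List.ofFn f).take r).prod * ((List.ofFn g).drop r).prod =
      ∏ t : Fin n, if t.val < r then f t else g t := by
  induction n generalizing r with
  | zero => simp
  | succ n ih =>
    rw [List.ofFn_succ, List.ofFn_succ, Fin.prod_univ_succ]
    cases r with
    | zero => simp [List.prod_ofFn]
    | succ r =>
      rw [List.take_succ_cons, List.drop_succ_cons, List.prod_cons, mul_assoc, ih]
      simp

namespace Datum

/-- The exchange factors of all pairs of letters of a word of the Serre relation multiply to the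
factor in the elliptic Serre relation. -/
theorem pairProd_serreList {D : Datum} (hD : D.Admissible) (ε : ℤˣ) (i j : D.I) {s : ℕ}
    (σ : Equiv.Perm (Fin s)) (r : ℕ) (col : Option (Fin s) → D.I) (hcol : ∀ t, col (some t) = i)
    (hcol' : col none = j) :
    pairProd (fun v w => EFree.gg ε (col v) (col w) (LP.frac (D.κ ^ (-D.m (col v) (col w))) w v))
      (serreList σ r) = EFree.serreFactor ε i j s σ r := by
  have hm : ∀ i, D.m i i = 0 := fun i => by have := hD.m_anti i i; omega
  set g := fun v w => EFree.gg ε (col v) (col w)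
    (LP.frac (D.κ ^ (-D.m (col v) (col w))) w v) with hg
  have h2 : (∏ k : Fin s, ∏ m : Fin s, if k < m then g (some (σ k)) (some (σ m)) else 1) =
      ∏ k : Fin s, ∏ m : Fin s,
        if k < m then EFree.gg ε i i (LP.frac 1 (some (σ m)) (some (σ k))) else 1 := by
    simp only [hg, hcol, hm, neg_zero, zpow_zero]
  have h3 : ∀ v, g (some v) none = EFree.gg ε i j (LP.frac (D.κ ^ (-D.m i j)) none (some v)) :=
    fun v => by simp only [hg, hcol, hcol']
  have h4 : ∀ v, g none (some v) = EFree.gg ε i j (LP.frac (D.κ ^ D.m i j) (some v) none) :=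
    fun v => by simp only [hg, hcol, hcol', hD.m_anti j i, neg_neg, EFree.gg, hD.b_symm j i]
  clear_value g
  rw [serreList, pairProd_append_cons, List.take_append_drop, pairProd_ofFn, h2, EFree.serreFactor,
    ← prod_take_ofFn_mul_prod_drop_ofFn, List.map_take, List.map_drop, List.map_ofFn, List.map_ofFn]
  simp only [Function.comp_def, h3, h4]

namespace TorData
variable {D : Datum} {R : Type} [Ring R] [Algebra Coef R] [Algebra Lam R]
  [IsScalarTower Coef Lam R] {T : D.TorData R} {N : ℕ}

namespace IsBase
variable (h : T.IsBase)
include h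

/-- Both kinds of currents at once. -/
theorem sum_words_iff (hD : D.Admissible) (hN : pR R ^ N = 0) (ε : ℤˣ) {ι : Type} [DecidableEq ι]
    (col : ι → D.I) {K : Type} (S : Finset K) (A : K → LP ι) (L : K → List ι) (L₀ : List ι)
    (hL₀ : L₀.Nodup) (hL : ∀ k, (L k).Perm L₀) :
    ∑ k ∈ S, actN N (PowerSeries.C (A k) * pairProd (fun v w => EFree.gg ε (col v) (col w)
        (LP.frac (D.κ ^ (-D.m (col v) (col w))) w v)) (L k))
        (word (fun v => T.x N ε (col v)) (L k)) = 0 ↔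
      ∑ k ∈ S, actN N (PowerSeries.C (A k)) (word (fun v => T.X ε (col v)) (L k)) = 0 := by
  rcases Int.units_eq_one_or ε with rfl | rfl
  · exact h.sum_words_pos_iff hD hN col S A L L₀ hL₀ hL
  · exact h.sum_words_neg_iff hD hN col S A L L₀ hL₀ hL

/-- The quadratic relation for the `x^±` is equivalent to that for the `X^±`. -/
theorem X_X_iff (hD : D.Admissible) (hN : pR R ^ N = 0) (ε : ℤˣ) (i j : D.I) :
    (∀ ν : Fin 2 → ℤ,
      actN N (PowerSeries.C
          (scal (D.κ ^ D.m i j) • LP.var 0 - scal (D.q ^ (ε * D.b i j)) • LP.var 1)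
            * EFree.gg ε i j (LP.frac (D.κ ^ (-D.m i j)) 1 0))
          (fun ν => T.x N ε i (-ν 0) * T.x N ε j (-ν 1)) ν =
        actN N (PowerSeries.C (scal (D.κ ^ D.m i j * D.q ^ (ε * D.b i j)) • LP.var 0 - LP.var 1)
            * EFree.gg ε i j (LP.frac (D.κ ^ D.m i j) 0 1))
          (fun ν => T.x N ε j (-ν 1) * T.x N ε i (-ν 0)) ν) ↔
    ∀ n l, scal (D.κ ^ D.m i j) • (T.X ε i (n + 1) * T.X ε j l)
          - scal (D.q ^ (ε * D.b i j)) • (T.X ε i n * T.X ε j (l + 1)) =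
        scal (D.κ ^ D.m i j * D.q ^ (ε * D.b i j)) • (T.X ε j l * T.X ε i (n + 1))
          - T.X ε j (l + 1) * T.X ε i n := by
  -- the relation compares the words `z w` and `w z`
  have hw : ∀ y : D.I → ℤ → R, word (fun v : Fin 2 => y (![i, j] v)) [0, 1] =
      fun ν => y i (-ν 0) * y j (-ν 1) := fun y => by ext ν; simp [word]
  have hw' : ∀ y : D.I → ℤ → R, word (fun v : Fin 2 => y (![i, j] v)) [1, 0] =
      fun ν => y j (-ν 1) * y i (-ν 0) := fun y => by ext ν; simp [word]
  have key := h.sum_words_iff hD hN ε ![i, j] (Finset.univ : Finset (Fin 2))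
    ![scal (D.κ ^ D.m i j) • LP.var 0 - scal (D.q ^ (ε * D.b i j)) • LP.var 1,
      -(scal (D.κ ^ D.m i j * D.q ^ (ε * D.b i j)) • LP.var 0 - LP.var 1)]
    ![[0, 1], [1, 0]] [0, 1] (by decide) (fun k => by
      fin_cases k
      · exact List.Perm.refl _
      · exact List.Perm.swap _ _ _)
  simp only [Fin.sum_univ_two, Matrix.cons_val_zero, Matrix.cons_val_one, hw, hw', pairProd,
    List.map_cons, List.map_nil, List.prod_cons, List.prod_nil, mul_one] at key
  rw [actN_neg_C_mul, ← mul_one (PowerSeries.C (-_)), actN_neg_C_mul, mul_one, ← sub_eq_add_neg,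
    ← sub_eq_add_neg, sub_eq_zero, sub_eq_zero, funext_iff, funext_iff] at key
  rw [hD.m_anti j i, neg_neg] at key
  simp only [EFree.gg, hD.b_symm j i] at key ⊢
  refine key.trans ?_
  simp only [actN_smul_var_sub_smul_var hN, actN_smul_var_sub_var hN]
  constructor
  · intro H n l
    have := H ![-n, -l]
    simpa [add_comm] using this
  · intro H ν
    have := H (-ν 0) (-ν 1)
    simpa [add_comm, sub_eq_add_neg] using this

/-- The elliptic Serre relation for the `x^±` is equivalent to the Serre relation for the `X^±`. -/
theorem serre_iff (hD : D.Admissible) (hN : pR R ^ N = 0) (ε : ℤˣ) (i j : D.I) (s : ℕ) :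
    (∀ ν : Option (Fin s) → ℤ, ∑ σ : Equiv.Perm (Fin s), ∑ r ∈ Finset.range (s + 1),
        scal ((-1) ^ r * D.qbinom i s r) • actN N (EFree.serreFactor ε i j s σ r)
          (fun ν => ((List.ofFn fun t => T.x N ε i (-ν (some (σ t)))).take r).prod *
            T.x N ε j (-ν none) *
            ((List.ofFn fun t => T.x N ε i (-ν (some (σ t)))).drop r).prod) ν = 0) ↔
    ∀ (n : Fin s → ℤ) (l : ℤ), ∑ σ : Equiv.Perm (Fin s), ∑ r ∈ Finset.range (s + 1),
      scal ((-1) ^ r * D.qbinom i s r) •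
        (((List.ofFn fun t => T.X ε i (n (σ t))).take r).prod * T.X ε j l *
          ((List.ofFn fun t => T.X ε i (n (σ t))).drop r).prod) = 0 := by
  have key := h.sum_words_iff hD hN ε (fun o : Option (Fin s) => o.elim j fun _ => i)
    ((Finset.univ : Finset (Equiv.Perm (Fin s))) ×ˢ Finset.range (s + 1))
    (fun k => algebraMap Coef _ (scal ((-1) ^ k.2 * D.qbinom i s k.2)))
    (fun k => serreList k.1 k.2) _ nodup_none_cons_finRange (fun k => serreList_perm k.1 k.2)
  simp only [Finset.sum_product, pairProd_serreList hD ε i j _ _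
    (fun o : Option (Fin s) => o.elim j fun _ => i) (fun _ => rfl) rfl] at key
  simp only [funext_iff, Finset.sum_apply, actN_algebraMap_C_mul, Pi.zero_apply] at key
  have hw : ∀ (y : D.I → ℤ → R) (σ : Equiv.Perm (Fin s)) (r : ℕ),
      word (fun v : Option (Fin s) => y (v.elim j fun _ => i)) (serreList σ r) =
      fun ν => ((List.ofFn fun t => y i (-ν (some (σ t)))).take r).prod * y j (-ν none) *
        ((List.ofFn fun t => y i (-ν (some (σ t)))).drop r).prod := fun y σ r => by
    ext ν; rw [word_serreList]; rfl
  simp only [hw] at key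
  refine key.trans ?_
  have h1 : ∀ (c : Coef) (F : (Option (Fin s) → ℤ) → R) (ν : Option (Fin s) → ℤ),
      actN N (PowerSeries.C (algebraMap Coef (LP (Option (Fin s))) c)) F ν = c • F ν := by
    intro c F ν
    rw [actN_C hN, ← Sop_apply, AlgHom.commutes]
    rfl
  simp only [h1]
  constructor
  · intro H n l
    have := H fun o => o.elim (-l) fun t => -n t
    simpa using this
  · intro H ν
    exact H (fun t => -ν (some t)) (-ν none)

/-- The right-hand side of the relation for `[X_i^+, X_j^-]`. -/
def torComm (T : D.TorData R) (i j : D.I) (n l : ℤ) : R :=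
  if i = j then scal (D.qdiff i)⁻¹ •
    (cpow (n - l) • trigPhi (D.qdiff i) 1 (T.k 1 i) (T.a i) (n + l) -
      cpow (l - n) • trigPhi (D.qdiff i) (-1) (T.k (-1) i) (T.a i) (n + l)) else 0

omit h in
/-- Multiplying `Φ_i^±` by `u_i^+` from the left and by `e^{-Q_i} u_i^-` from the right turns the
right-hand side of the relation for `[X_i^+, X_j^-]` into that of the relation for `[x_i^+, x_j^-]`.
-/
theorem twist_twistR_torComm (i j : D.I) (n l : ℤ) :
    twist N 1 (T.cP i) (fun n' => twistR N (-1) (T.cM j)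
      (fun l' => torComm T i j n' l' * T.e i) l) n =
      if i = j then scal (D.qdiff i)⁻¹ •
        (cpow (n - l) • T.phi N 1 i (n + l) - cpow (l - n) • T.phi N (-1) i (n + l)) else 0 := by
  by_cases hij : i = j
  · subst hij
    simp only [torComm, if_true, twist, twistR, phi, Finset.smul_sum, Finset.mul_sum, sub_mul,
      smul_mul_assoc, mul_smul_comm, mul_sub, smul_sub, ← Finset.sum_sub_distrib]
    refine Finset.sum_congr rfl fun m _ => Finset.sum_congr rfl fun r _ => ?_
    rw [smul_smul (cpow (n - l)), smul_smul (cpow (l - n)), ← cpow_add, ← cpow_add]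
    rw [show n + 1 * (m : ℤ) - (l + -1 * (r : ℤ)) =
        n - l + ((1 : ℤˣ) : ℤ) * (m + r) by push_cast; ring,
      show l + -1 * (r : ℤ) - (n + 1 * (m : ℤ)) = l - n + ((-1 : ℤˣ) : ℤ) * (m + r) by
        push_cast; ring,
      show n + 1 * (m : ℤ) + (l + -1 * (r : ℤ)) = n + l + m - r by ring]
  · simp only [torComm, if_neg hij, zero_mul, twist, twistR, mul_zero, Finset.sum_const_zero]

/-- The relation for `[x_i^+, x_j^-]` is equivalent to that for `[X_i^+, X_j^-]`. -/
theorem Xp_Xm_iff (hD : D.Admissible) (hN : pR R ^ N = 0) (i j : D.I) :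
    (∀ n l, T.x N 1 i n * T.x N (-1) j l - T.x N (-1) j l * T.x N 1 i n =
      if i = j then scal (D.qdiff i)⁻¹ •
        (cpow (n - l) • T.phi N 1 i (n + l) - cpow (l - n) • T.phi N (-1) i (n + l)) else 0) ↔
    ∀ n l, T.X 1 i n * T.X (-1) j l - T.X (-1) j l * T.X 1 i n = torComm T i j n l := by
  simp only [← twist_twistR_torComm, h.commutator_x hD hN]
  constructor
  · intro H n l
    -- both twistings are injective
    have hinj : ∀ f f' : ℤ → R, twist N 1 (T.cP i) f = twist N 1 (T.cP i) f' → f = f' :=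
      fun f f' hf => by
        rw [← twist_neg_twist hN 1 (T.cP i) f, hf, twist_neg_twist hN]
    have hinj' : ∀ f f' : ℤ → R, twistR N (-1) (T.cM j) f = twistR N (-1) (T.cM j) f' → f = f' :=
      fun f f' hf => by
        rw [← twistR_neg_twistR hN (-1) (T.cM j) f, hf, twistR_neg_twistR hN]
    have h1 := congrFun
      (hinj' _ _ (funext fun l => congrFun (hinj _ _ (funext fun n => H n l)) n)) l
    -- cancels the factor `e^{-Q_i}`
    have h2 := congrArg (· * T.eQ (Pi.single i 1)) h1
    simpa only [mul_assoc, h.e_mul_eQ, mul_one] using h2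
  · intro H n l
    simp only [H]

end IsBase
end TorData
end Datum
end EllTor

namespace EllTor

/-! ### The relations of the elliptic algebra hold for the twisted currents -/

section Twist
variable {R : Type} [Ring R] [Algebra Coef R] [Algebra Lam R] [IsScalarTower Coef Lam R] {N : ℕ}

theorem commute_twist {r : R} {τ : ℤ} {c : ℕ → R} {y : ℤ → R} (hc : ∀ n, Commute r (c n))
    (hy : ∀ n, Commute r (y n)) (n : ℤ) : Commute r (twist N τ c y n) :=
  Commute.sum_right _ _ _ fun m _ => ((commute_pR r).symm.pow_right m).mul_right
    ((commute_coeff_pexp (fun n => by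
      rw [coeff_posSer]; split_ifs; exacts [Commute.zero_right _, hc n]) m).mul_right (hy _))

theorem commute_twistR {r : R} {τ : ℤ} {c : ℕ → R} {y : ℤ → R} (hc : ∀ n, Commute r (c n))
    (hy : ∀ n, Commute r (y n)) (n : ℤ) : Commute r (twistR N τ c y n) :=
  Commute.sum_right _ _ _ fun m _ => ((commute_pR r).symm.pow_right m).mul_right
    ((hy _).mul_right (commute_coeff_pexp (fun n => by
      rw [coeff_posSer]; split_ifs; exacts [Commute.zero_right _, hc n]) m))

end Twist

namespace Datum

/-- If `A c = 0` then `∑ c_i Q_i` pairs to zero with every `P_j`. -/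
theorem latVec_eq_zero {D : Datum} {c : D.I → ℕ} (hc : D.A.mulVec (fun i => (c i : ℤ)) = 0) :
    D.latVec (0, fun i => -(c i : ℤ)) = 0 := by
  have h1 : ∀ i, ∑ j, (c j : ℂ) * (D.A i j : ℂ) = 0 := fun i => by
    have := congrFun hc i
    simp only [Matrix.mulVec, dotProduct, Pi.zero_apply] at this
    have h2 := congrArg (Int.cast : ℤ → ℂ) this
    push_cast at h2
    rw [← h2]
    exact Finset.sum_congr rfl fun j _ => mul_comm _ _
  have h2 : ∀ i : D.I, ∑ j, (c j : ℤ) • (D.QVec j).2.2.2 i = 0 := fun i => by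
    rw [← h1 i]
    exact Finset.sum_congr rfl fun j _ => by simp [QVec]
  simp only [latVec, AddMonoidHom.coe_mk, ZeroHom.coe_mk, Pi.zero_apply, zero_smul,
    Finset.sum_const_zero, zero_add, neg_smul, Finset.sum_neg_distrib, neg_eq_zero]
  refine Prod.ext ?_ (Prod.ext ?_ (Prod.ext ?_ ?_))
  · simp [Prod.fst_sum, QVec]
  · simp [Prod.fst_sum, Prod.snd_sum, QVec]
  · simp [Prod.fst_sum, Prod.snd_sum, QVec]
  · ext i
    simp only [Prod.snd_sum, Finset.sum_apply]
    exact h2 i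

namespace TorData
variable {D : Datum} {R : Type} [Ring R] [Algebra Coef R] [Algebra Lam R]
  [IsScalarTower Coef Lam R] {T : D.TorData R} {N : ℕ}

/-- The generators of the elliptic algebra are sent to the twisted currents built from `T`. -/
structure IsCompat (T : D.TorData R) (π : D.EFree⟦X⟧ →ₐ[Coef] R) (N : ℕ) : Prop where
  al : ∀ i l, π (PowerSeries.C (EFree.al i l)) = T.al i l
  x : ∀ ε i n, π (PowerSeries.C (EFree.x ε i n)) = T.x N ε i n
  K : ∀ ε i, π (PowerSeries.C (EFree.K ε i)) = T.K ε i
  qd : ∀ ε, π (PowerSeries.C (EFree.qd ε)) = T.qd ε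
  eQ : ∀ α, π (PowerSeries.C (EFree.eQ α)) = T.eQ α
  fn : ∀ f, π (PowerSeries.C (EFree.fn f)) = T.fn f

theorem commute_al {r : R} (hr : ∀ i l, Commute r (T.a i l)) (i : D.I) (l : ℤ) :
    Commute r (T.al i l) := (hr i l).smul_right _

theorem commute_x {r : R} (hr : ∀ i l, Commute r (T.a i l)) (hX : ∀ ε i n, Commute r (T.X ε i n))
    (he : ∀ i, Commute r (T.e i)) (ε : ℤˣ) (i : D.I) (n : ℤ) : Commute r (T.x N ε i n) := by
  rcases Int.units_eq_one_or ε with rfl | rfl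
  · rw [x_one]
    exact commute_twist (fun n => (hr _ _).smul_right _) (fun n => (hX _ _ _).mul_right (he _)) n
  · rw [x_neg_one]
    exact commute_twistR (fun n => (hr _ _).smul_right _) (fun n => hX _ _ _) n

/-- The elements `e^{-Q_i}` in the `K_i` can be collected. -/
theorem IsBase.prod_K (h : T.IsBase) (ε : ℤˣ) (c : D.I → ℕ) :
    (List.ofFn fun i => T.K ε i ^ c i).prod =
      (List.ofFn fun i => T.k ε i ^ c i).prod * T.eQ fun i => -(c i : ℤ) := by
  have h1 : ∀ (i : D.I) (n : ℕ), T.e i ^ n = T.eQ (Pi.single i (-(n : ℤ)) : D.I → ℤ) := by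
    intro i n
    induction n with
    | zero => simp [h.eQ_zero]
    | succ n ih =>
      rw [pow_succ, ih, e, ← h.eQ_add, ← Pi.single_neg, ← Pi.single_add]
      push_cast
      congr 2; ring
  have h2 : ∀ L : List D.I, (L.map fun i => T.K ε i ^ c i).prod =
      (L.map fun i => T.k ε i ^ c i).prod *
        T.eQ (L.map fun i => (Pi.single i (-(c i : ℤ)) : D.I → ℤ)).sum := by
    intro L
    induction L with
    | nil => simp [h.eQ_zero]
    | cons i L ih =>
      have hc : Commute (T.eQ (Pi.single i (-(c i : ℤ)))) (L.map fun i => T.k ε i ^ c i).prod :=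
        Commute.list_prod_right _ _ fun x hx => by
          obtain ⟨j, _, rfl⟩ := List.mem_map.mp hx
          exact (h.eQ_k _ _ _).pow_right _
      simp only [List.map_cons, List.prod_cons, List.sum_cons]
      rw [ih, h.eQ_add, K,
        Commute.mul_pow (show Commute (T.k ε i) (T.e i) from (h.eQ_k _ _ _).symm), h1]
      simp only [mul_assoc]
      rw [← mul_assoc (T.eQ _) (List.prod _), hc.eq, mul_assoc]
  rw [List.ofFn_eq_map, List.ofFn_eq_map, h2]
  congr 2
  rw [← List.ofFn_eq_map, List.sum_ofFn]
  ext i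
  simp [Finset.sum_apply, Pi.single_apply]

namespace IsTor
variable (h : T.IsTor)
include h

theorem e_gen (i : D.I) (g : D.Gen) : Commute (T.e i) (T.gen g) := h.eQ_gen _ g

/-- `g(h, P) e^{-Q_j} = e^{-Q_j} g(h, P - ⟨Q_j, P⟩)`. -/
theorem fn_e (f : D.Mer) (j : D.I) : T.fn f * T.e j = T.e j * T.fn (D.shift (-D.QVec j) f) := by
  rw [e, h.eQ_fn, shift_shift]
  have : -D.latVec ((0 : D.I → ℤ), -Pi.single j 1) + -D.QVec j = 0 := by
    rw [← Pi.single_neg, latVec_single_right]; simp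
  rw [this, shift_zero]; rfl

theorem fn_X (f : D.Mer) (ε : ℤˣ) (j : D.I) (n : ℤ) :
    T.fn f * T.X ε j n = T.X ε j n * T.fn (D.shift ((ε : ℤ) • D.rootVec j) f) := by
  have := h.fn_gen f (.X ε j n)
  rwa [show D.latVec ((Gen.X ε j n : D.Gen).wt, 0) = (ε : ℤ) • D.rootVec j from
    latVec_single_left _ _ _] at this

theorem fn_xP (f : D.Mer) (j : D.I) (n : ℤ) :
    T.fn f * T.x N 1 j n = T.x N 1 j n * T.fn (D.shift (D.rootVec j - D.QVec j) f) := by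
  rw [x_one]
  have := mul_twist (N := N) (τ := 1) (g := T.fn f) (c := T.cP j) (y := T.baseP j)
    (g' := T.fn (D.shift (D.rootVec j - D.QVec j) f)) (α := 1) (β := fun _ => 1) (γ := fun _ => 1)
    (fun n _ => by rw [one_pow, one_smul]; exact ((h.fn_a f j _).smul_right _).eq)
    (fun m => by
      rw [one_smul, baseP, ← mul_assoc, h.fn_X, mul_assoc, h.fn_e, mul_assoc, shift_shift]
      simp [sub_eq_neg_add]) (fun _ _ => by simp) n
  rwa [one_smul] at this

theorem fn_xM (f : D.Mer) (j : D.I) (n : ℤ) :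
    T.fn f * T.x N (-1) j n = T.x N (-1) j n * T.fn (D.shift (-D.rootVec j) f) := by
  rw [x_neg_one]
  have := mul_twistR (N := N) (τ := -1) (g := T.fn f) (c := T.cM j) (y := T.X (-1) j)
    (g' := T.fn (D.shift (-D.rootVec j) f)) (α := 1) (β := fun _ => 1) (γ := fun _ => 1)
    (fun n _ => by rw [one_pow, one_smul]; exact ((h.fn_a _ j _).smul_right _).eq)
    (fun m => by rw [one_smul, h.fn_X]; simp) (fun _ _ => by simp) n
  rwa [one_smul] at this

theorem fn_K (f : D.Mer) (ε : ℤˣ) (j : D.I) :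
    T.fn f * T.K ε j = T.K ε j * T.fn (D.shift (-D.QVec j) f) := by
  rw [K, ← mul_assoc, (h.fn_k f ε j).eq, mul_assoc, h.fn_e, mul_assoc]

theorem qd_al (i : D.I) (l : ℤ) : T.qd 1 * T.al i l = scal (D.q ^ l) • (T.al i l * T.qd 1) := by
  rw [al, mul_smul_comm, h.qd_a, smul_mul_assoc, smul_comm]

theorem qd_x (hD : D.Admissible) (ε : ℤˣ) (i : D.I) (n : ℤ) :
    T.qd 1 * T.x N ε i n = scal (D.q ^ n) • (T.x N ε i n * T.qd 1) := by
  have hq : ∀ (n : ℕ) (k : ℤ), scal (D.q ^ k) ^ n = scal (D.q ^ (k * n)) := fun n k => by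
    rw [zpow_mul, zpow_natCast]; exact (map_pow LaurentPolynomial.C _ _).symm
  rcases Int.units_eq_one_or ε with rfl | rfl
  · rw [x_one]
    refine mul_twist (g := T.qd 1) (c := T.cP i) (α := scal (D.q ^ (-1 : ℤ)))
      (β := fun n => scal (D.q ^ n)) (γ := fun n => scal (D.q ^ n)) (fun n _ => ?_) (fun m => ?_)
      (fun m n => ?_) n
    · rw [cP, mul_smul_comm, h.qd_a, smul_mul_assoc, smul_comm, hq, neg_one_mul]
    · rw [baseP, ← mul_assoc, h.qd_X, smul_mul_assoc, mul_assoc, mul_assoc,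
        show T.qd 1 * T.e i = T.e i * T.qd 1 from (h.e_gen i (.qd 1)).symm.eq]
    · rw [hq, ← scal_mul, ← zpow_add₀ hD.q_ne]; congr 2; ring
  · rw [x_neg_one]
    refine mul_twistR (g := T.qd 1) (c := T.cM i) (α := scal (D.q ^ (1 : ℤ)))
      (β := fun n => scal (D.q ^ n)) (γ := fun n => scal (D.q ^ n)) (fun n _ => ?_)
      (fun m => h.qd_X _ _ _) (fun m n => ?_) n
    · rw [cM, mul_smul_comm, h.qd_a, smul_mul_assoc, smul_comm, hq, one_mul]
    · rw [hq, ← scal_mul, ← zpow_add₀ hD.q_ne]; congr 2; ring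

theorem K_a (ε : ℤˣ) (i j : D.I) (l : ℤ) : Commute (T.K ε i) (T.a j l) :=
  (h.isBase.k_a ε i j l).mul_left (h.eQ_a _ _ _)

theorem K_x (hD : D.Admissible) (ε ε' : ℤˣ) (i j : D.I) (n : ℤ) :
    T.K ε i * T.x N ε' j n =
      scal (D.q ^ ((ε : ℤ) * (ε' : ℤ) * D.b i j)) • (T.x N ε' j n * T.K ε i) := by
  have hX : ∀ n, T.K ε i * T.X ε' j n =
      scal (D.q ^ ((ε : ℤ) * (ε' : ℤ) * D.b i j)) • (T.X ε' j n * T.K ε i) := fun n => by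
    rw [K, mul_assoc, show T.e i * T.X ε' j n = T.X ε' j n * T.e i from (h.e_gen i (.X ε' j n)).eq,
      ← mul_assoc, h.k_X hD, smul_mul_assoc, mul_assoc, mul_assoc]
  have hKe : Commute (T.K ε i) (T.e j) :=
    (h.e_gen j (.k ε i)).symm.mul_left (h.isBase.eQ_eQ _ _)
  rcases Int.units_eq_one_or ε' with rfl | rfl
  · rw [x_one]
    refine mul_twist (g := T.K ε i) (c := T.cP j) (α := 1)
      (β := fun _ => scal (D.q ^ ((ε : ℤ) * ((1 : ℤˣ) : ℤ) * D.b i j)))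
      (γ := fun _ => scal (D.q ^ ((ε : ℤ) * ((1 : ℤˣ) : ℤ) * D.b i j)))
      (fun n _ => ?_) (fun m => ?_) (fun m n => ?_) n
    · rw [one_pow, one_smul]; exact ((h.K_a ε i j _).smul_right _).eq
    · rw [baseP, ← mul_assoc, hX, smul_mul_assoc, mul_assoc (T.X 1 j m), hKe.eq, ← mul_assoc]
    · rw [one_pow, one_mul]
  · rw [x_neg_one]
    refine mul_twistR (g := T.K ε i) (c := T.cM j) (α := 1)
      (β := fun _ => scal (D.q ^ ((ε : ℤ) * ((-1 : ℤˣ) : ℤ) * D.b i j)))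
      (γ := fun _ => scal (D.q ^ ((ε : ℤ) * ((-1 : ℤˣ) : ℤ) * D.b i j)))
      (fun n _ => ?_) (fun m => hX _) (fun m n => ?_) n
    · rw [one_pow, one_smul]; exact ((h.K_a ε i j _).smul_right _).eq
    · rw [one_pow, one_mul]

/-- The products `∏ K_i^{c_i}` with `A c = 0` are central. -/
theorem commute_prod_K (ε : ℤˣ) (c : D.I → ℕ) (hc : D.A.mulVec (fun i => (c i : ℤ)) = 0) :
    (∀ i l, Commute (List.ofFn fun i => T.K ε i ^ c i).prod (T.al i l)) ∧
    (∀ ε' i n, Commute (List.ofFn fun i => T.K ε i ^ c i).prod (T.x N ε' i n)) ∧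
    (∀ ε' i, Commute (List.ofFn fun i => T.K ε i ^ c i).prod (T.K ε' i)) ∧
    (∀ ε', Commute (List.ofFn fun i => T.K ε i ^ c i).prod (T.qd ε')) ∧
    (∀ α, Commute (List.ofFn fun i => T.K ε i ^ c i).prod (T.eQ α)) ∧
    ∀ f, Commute (List.ofFn fun i => T.K ε i ^ c i).prod (T.fn f) := by
  rw [h.isBase.prod_K]
  set u := (List.ofFn fun i => T.k ε i ^ c i).prod with hu
  have hgen : ∀ g, Commute (u * T.eQ fun i => -(c i : ℤ)) (T.gen g) := fun g =>
    (h.central ε c hc g).mul_left (h.eQ_gen _ g)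
  have hcomm : ∀ r, (∀ i, Commute r (T.k ε i)) → Commute r u := fun r hr =>
    Commute.list_prod_right _ _ fun x hx => by
      obtain ⟨j, rfl⟩ := (List.mem_ofFn' _ _).mp hx
      exact (hr j).pow_right _
  have heQ : ∀ α, Commute (u * T.eQ fun i => -(c i : ℤ)) (T.eQ α) := fun α =>
    (hcomm _ fun i => h.eQ_gen α (.k ε i)).symm.mul_left (h.isBase.eQ_eQ _ _)
  have ha : ∀ i l, Commute (u * T.eQ fun i => -(c i : ℤ)) (T.a i l) := fun i => h.a_gen i hgen
  refine ⟨commute_al ha, commute_x ha (fun ε i n => hgen (.X ε i n)) (fun i => heQ _),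
    fun ε' i => (hgen (.k ε' i)).mul_right (heQ _), fun ε' => hgen (.qd ε'), heQ, fun f => ?_⟩
  have h1 := h.eQ_fn (fun i => -(c i : ℤ)) f
  rw [latVec_eq_zero hc, neg_zero, shift_zero] at h1
  exact (hcomm _ fun i => h.fn_k f ε i).symm.mul_left h1

theorem al_al (i j : D.I) (l m : ℤ) (hl : l ≠ 0) (hm : m ≠ 0) :
    T.al i l * T.al j m - T.al j m * T.al i l =
      if l + m = 0 then algebraMap Lam R (PowerSeries.C (scal (D.str i j l / D.qdiff j) *
        (cpow (2 * l) - cpow (-(2 * l))) * cpow (-(2 * l))) * ratio l) else 0 := by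
  simp only [al, smul_mul_assoc, mul_smul_comm]
  rw [smul_comm (alS m), ← smul_sub, ← smul_sub, h.isBase.a_a i j l m hl hm, add_sub_cancel_left]
  split_ifs with hlm
  · obtain rfl : m = -l := by omega
    rw [smul_smul, smul_smul, Algebra.algebraMap_eq_smul_one, alS_mul_alS_neg hl,
      map_mul PowerSeries.C (scal _ * _), mul_comm, ← mul_assoc]
  · rw [smul_zero, smul_zero]

theorem al_xP (hD : D.Admissible) (hN : pR R ^ N = 0) (i j : D.I) (l n : ℤ) (hl : l ≠ 0) :
    T.al i l * T.x N 1 j n - T.x N 1 j n * T.al i l =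
      (PowerSeries.C (scal (D.str i j l) * cpow (-(2 * l))) * ratio l : Lam) •
        T.x N 1 j (n + l) := by
  rw [al, smul_mul_assoc, mul_smul_comm, ← smul_sub, h.isBase.a_xP hN i j hl, add_sub_cancel_left,
    smul_smul, alS_mul_sP hD i j hl]

theorem al_xM (hD : D.Admissible) (hN : pR R ^ N = 0) (i j : D.I) (l n : ℤ) (hl : l ≠ 0) :
    T.al i l * T.x N (-1) j n - T.x N (-1) j n * T.al i l =
      scal (-D.str i j l) • T.x N (-1) j (n + l) := by
  rw [al, smul_mul_assoc, mul_smul_comm, ← smul_sub, h.isBase.a_xM hN i j hl, add_sub_cancel_left,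
    smul_smul, alS_mul_sM hD i j hl, C_smul]

/-- The relations without infinite sums hold. -/
theorem map_eq_of_eRelFin (hD : D.Admissible) {π : D.EFree⟦X⟧ →ₐ[Coef] R} (hT : T.IsCompat π N)
    {u v : D.EFree} (huv : D.ERelFin u v) : π (PowerSeries.C u) = π (PowerSeries.C v) := by
  have hb := h.isBase
  have hprod : ∀ (ε : ℤˣ) (c : D.I → ℕ),
      π (PowerSeries.C (List.ofFn fun i => EFree.K ε i ^ c i).prod) =
      (List.ofFn fun i => T.K ε i ^ c i).prod := fun ε c => by
    simp only [map_list_prod, List.map_ofFn, Function.comp_def, map_pow, hT.K]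
  have hK_e : ∀ ε i α, Commute (T.eQ α) (T.K ε i) := fun ε i α =>
    (hb.eQ_k α ε i).mul_right (hb.eQ_eQ _ _)
  cases huv
  case fn_add f g => rw [map_add, map_add, hT.fn, hT.fn, hT.fn, h.fn_add]
  case fn_mul f g => rw [map_mul, map_mul, hT.fn, hT.fn, hT.fn, h.fn_mul]
  case fn_const z =>
    rw [hT.fn, h.fn_const, ← constAlgHom_apply, AlgHom.commutes, AlgHom.commutes]
  case eQ_zero => rw [hT.eQ, h.eQ_zero, map_one, map_one]
  case eQ_add α β => rw [map_mul, map_mul, hT.eQ, hT.eQ, hT.eQ, h.eQ_add]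
  case eQ_fn α f => simp only [map_mul, hT.eQ, hT.fn, h.eQ_fn]
  case eQ_al α i l => simp only [map_mul, hT.eQ, hT.al]; exact commute_al (h.eQ_a α) i l
  case eQ_x α ε i n =>
    simp only [map_mul, hT.eQ, hT.x]
    exact commute_x (h.eQ_a α) (hb.eQ_X α) (fun i => hb.eQ_eQ _ _) ε i n
  case eQ_K α ε i => simp only [map_mul, hT.eQ, hT.K]; exact hK_e _ _ _
  case eQ_qd α ε => simp only [map_mul, hT.eQ, hT.qd]; exact h.eQ_gen α (.qd ε)
  case K_inv i =>
    simp only [map_mul, hT.eQ, hT.K]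
    have h1 : T.K 1 i * T.K (-1) i = T.k 1 i * T.k (-1) i * (T.e i * T.e i) := by
      rw [K, K, mul_assoc, ← mul_assoc (T.e i) (T.k (-1) i), show T.e i * T.k (-1) i =
        T.k (-1) i * T.e i from (hb.eQ_k _ _ _).eq]
      simp only [mul_assoc]
    rw [h1, h.k_inv, one_mul, e, ← hb.eQ_add, ← Pi.single_neg, ← Pi.single_add]
    rfl
  case central ε c hc g =>
    obtain ⟨h1, h2, h3, h4, h5, h6⟩ := h.commute_prod_K (N := N) ε c hc
    rw [map_mul, map_mul, map_mul, map_mul, hprod]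
    cases g with
    | al i l =>
      have := hT.al i l
      rw [EFree.al, dif_pos l.2] at this
      rw [this]; exact h1 i l
    | x ε' i n =>
        rw [show π (PowerSeries.C (EFree.gen (.x ε' i n))) = _ from hT.x ε' i n]; exact h2 _ _ _
    | K ε' i => rw [show π (PowerSeries.C (EFree.gen (.K ε' i))) = _ from hT.K ε' i]; exact h3 _ _
    | qd ε' => rw [show π (PowerSeries.C (EFree.gen (.qd ε'))) = _ from hT.qd ε']; exact h4 _
    | eQ α => rw [show π (PowerSeries.C (EFree.gen (.eQ α))) = _ from hT.eQ α]; exact h5 _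
    | fn f => rw [show π (PowerSeries.C (EFree.gen (.fn f))) = _ from hT.fn f]; exact h6 _
  case fn_xp f j n => simp only [map_mul, hT.fn, hT.x]; exact h.fn_xP f j n
  case fn_xm f j n => simp only [map_mul, hT.fn, hT.x]; exact h.fn_xM f j n
  case fn_al f i l => simp only [map_mul, hT.fn, hT.al]; exact commute_al (h.fn_a f) i l
  case fn_qd f ε => simp only [map_mul, hT.fn, hT.qd]; exact h.fn_qd f ε
  case fn_K f ε j => simp only [map_mul, hT.fn, hT.K]; exact h.fn_K f ε j
  case qd_inv ε => simp only [map_mul, map_one, hT.qd]; exact h.qd_inv ε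
  case qd_K ε ε' i =>
    simp only [map_mul, hT.qd, hT.K]
    exact (h.qd_k ε ε' i).mul_right (h.e_gen i (.qd ε)).symm
  case qd_al i l => simp only [map_C_smul, map_mul, hT.qd, hT.al]; exact h.qd_al i l
  case qd_x ε i n => simp only [map_C_smul, map_mul, hT.qd, hT.x]; exact h.qd_x hD ε i n
  case K_K ε ε' i j =>
    simp only [map_mul, hT.K]
    exact ((h.k_k ε ε' i j).mul_right (hb.eQ_k _ _ _).symm).mul_left (hK_e _ _ _)
  case K_al ε i j l => simp only [map_mul, hT.K, hT.al]; exact commute_al (h.K_a ε i) j l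
  case K_x ε ε' i j n => simp only [map_C_smul, map_mul, hT.K, hT.x]; exact h.K_x hD ε ε' i j n

/-- The twisted currents satisfy the defining relations of the elliptic algebra. -/
theorem map_eq_of_eRel (hD : D.Admissible) {π : D.EFree⟦X⟧ →ₐ[Coef] R} (hπ : IsEval π N)
    (hT : T.IsCompat π N) {u v : D.EFree⟦X⟧} (huv : D.ERel u v) : π u = π v := by
  have hb := h.isBase
  have hN := hπ.pow_eq_zero
  cases huv with
  | fin u v huv => exact h.map_eq_of_eRelFin hD hT huv
  | al_al i j l m hl hm =>
    rw [map_sub, map_sub, map_mul, map_mul, map_mul, map_mul, hT.al, hT.al, h.al_al i j l m hl hm]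
    split_ifs
    · rw [hπ.map_ofCoef]
    · rw [map_zero]
  | al_xp i j l n hl =>
    rw [map_sub, map_sub, map_mul, map_mul, map_mul, map_mul, hT.al, hT.x, h.al_xP hD hN i j l n hl,
      hπ.map_ofCoef_mul, hT.x]
  | al_xm i j l n hl =>
    rw [map_sub, map_sub, map_mul, map_mul, map_mul, map_mul, hT.al, hT.x, h.al_xM hD hN i j l n hl,
      map_C_smul, hT.x]
  | x_x ε i j ν =>
    rw [hπ.map_act, hπ.map_act]
    simp only [map_mul, hT.x]
    exact (hb.X_X_iff hD hN ε i j).mpr (h.X_X ε i j) ν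
  | xp_xm i j n l =>
    rw [map_sub, map_sub, map_mul, map_mul, map_mul, map_mul, hT.x, hT.x,
      (hb.Xp_Xm_iff hD hN i j).mpr (h.Xp_Xm i j) n l]
    split_ifs
    · rw [map_smul, map_sub, map_smul, map_smul, hb.map_phi hπ hT.al hT.K, hb.map_phi hπ hT.al hT.K]
    · rw [map_zero]
  | serre ε i j hij s hs' ν =>
    rw [map_zero, map_sum]
    have key := (hb.serre_iff hD hN ε i j s).mpr (h.serre ε i j hij s hs') ν
    rw [← key]
    refine Finset.sum_congr rfl fun σ _ => ?_
    rw [map_sum]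
    refine Finset.sum_congr rfl fun r _ => ?_
    rw [map_smul, hπ.map_act]
    congr 2
    ext ν
    simp only [EFree.serreWord, map_mul, map_list_prod, List.map_take, List.map_drop, List.map_ofFn,
      Function.comp_def, hT.x]

end IsTor
end TorData
end Datum
end EllTor

namespace EllTor
namespace Datum

/-! ### Untwisting the currents of the elliptic algebra -/

section Ell
variable {D : Datum} {R : Type} [Ring R] [Algebra Coef R] [Algebra Lam R]
  [IsScalarTower Coef Lam R]

/-- The Heisenberg generators in terms of the elliptic ones. -/
def ellA (π : D.EFree⟦X⟧ →ₐ[Coef] R) (i : D.I) (l : ℤ) : R :=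
  alS' l • π (PowerSeries.C (EFree.al i l))

/-- The generators of the smash product in terms of the elliptic ones, at `p ^ N = 0`: the currents
`X^±` are obtained by multiplying `x^±` by the inverses of `u^±`. -/
def ellData (π : D.EFree⟦X⟧ →ₐ[Coef] R) (N : ℕ) : D.TorData R where
  a := ellA π
  X ε i := if ε = 1 then fun n => twist N 1 (fun n => -(D.hP i n • ellA π i (-n)))
      (fun n => π (PowerSeries.C (EFree.x 1 i n))) n * π (PowerSeries.C (EFree.eQ (Pi.single i 1)))
    else twistR N (-1) (fun n => -(D.hM i n • ellA π i n))
      (fun n => π (PowerSeries.C (EFree.x (-1) i n)))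
  k ε i := π (PowerSeries.C (EFree.K ε i)) * π (PowerSeries.C (EFree.eQ (Pi.single i 1)))
  qd ε := π (PowerSeries.C (EFree.qd ε))
  eQ α := π (PowerSeries.C (EFree.eQ α))
  fn f := π (PowerSeries.C (EFree.fn f))

variable {π : D.EFree⟦X⟧ →ₐ[Coef] R} {N : ℕ}

/-- The relations of the elliptic algebra hold in the image of `π`. -/
structure IsEll (π : D.EFree⟦X⟧ →ₐ[Coef] R) (N : ℕ) : Prop extends IsEval π N where
  rel : ∀ u v, D.ERel u v → π u = π v

theorem ellData_X_one (i : D.I) (n : ℤ) : (ellData π N).X 1 i n =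
    twist N 1 (fun n => -(ellData π N).cP i n) (fun n => π (PowerSeries.C (EFree.x 1 i n))) n *
      (ellData π N).eQ (Pi.single i 1) := by
  rw [ellData]; rfl

theorem ellData_X_neg_one (i : D.I) : (ellData π N).X (-1) i =
    twistR N (-1) (fun n => -(ellData π N).cM i n)
      (fun n => π (PowerSeries.C (EFree.x (-1) i n))) := by
  simp only [ellData, if_neg (show (-1 : ℤˣ) ≠ 1 by decide)]
  rfl

theorem ellData_k (ε : ℤˣ) (i : D.I) : (ellData π N).k ε i =
    π (PowerSeries.C (EFree.K ε i)) * (ellData π N).eQ (Pi.single i 1) := rfl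

namespace IsEll
variable (h : IsEll π N)
include h

theorem rel_fin {u v : D.EFree} (huv : D.ERelFin u v) :
    π (PowerSeries.C u) = π (PowerSeries.C v) := h.rel _ _ (.fin _ _ huv)

theorem eQ_zero : (ellData π N).eQ 0 = 1 := by
  have := h.rel_fin .eQ_zero
  rwa [map_one, map_one] at this

theorem eQ_add (α β : D.I → ℤ) :
    (ellData π N).eQ (α + β) = (ellData π N).eQ α * (ellData π N).eQ β := by
  have := h.rel_fin (.eQ_add α β)
  rwa [map_mul, map_mul] at this

theorem eQ_eQ (α β : D.I → ℤ) : Commute ((ellData π N).eQ α) ((ellData π N).eQ β) := by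
  rw [commute_iff_eq, ← h.eQ_add, ← h.eQ_add, add_comm]

theorem eQ_K (α : D.I → ℤ) (ε : ℤˣ) (i : D.I) :
    Commute ((ellData π N).eQ α) (π (PowerSeries.C (EFree.K ε i))) := by
  have := h.rel_fin (.eQ_K α ε i)
  rwa [map_mul, map_mul, map_mul, map_mul] at this

theorem eQ_x (α : D.I → ℤ) (ε : ℤˣ) (i : D.I) (n : ℤ) :
    Commute ((ellData π N).eQ α) (π (PowerSeries.C (EFree.x ε i n))) := by
  have := h.rel_fin (.eQ_x α ε i n)
  rwa [map_mul, map_mul, map_mul, map_mul] at this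

theorem eQ_a (α : D.I → ℤ) (i : D.I) (l : ℤ) :
    Commute ((ellData π N).eQ α) ((ellData π N).a i l) := by
  have := h.rel_fin (.eQ_al α i l)
  rw [map_mul, map_mul, map_mul, map_mul] at this
  exact (show Commute _ _ from this).smul_right _

/-- What commutes with the elliptic generators commutes with the currents `X^±`. -/
theorem commute_X {r : R} (ha : ∀ i l, Commute r ((ellData π N).a i l))
    (hx : ∀ ε i n, Commute r (π (PowerSeries.C (EFree.x ε i n))))
    (he : ∀ α, Commute r ((ellData π N).eQ α)) (ε : ℤˣ) (i : D.I) (n : ℤ) :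
    Commute r ((ellData π N).X ε i n) := by
  rcases Int.units_eq_one_or ε with rfl | rfl
  · rw [ellData_X_one]
    exact (commute_twist (fun n => ((ha _ _).smul_right _).neg_right) (hx 1 i) n).mul_right (he _)
  · rw [ellData_X_neg_one]
    exact commute_twistR (fun n => ((ha _ _).smul_right _).neg_right) (hx (-1) i) n

/-- The `a^∨_{i,l}` recovered from the elliptic algebra satisfy the Heisenberg relations. -/
theorem isHeis : (ellData π N).IsHeis where
  a_zero i := by
    show alS' 0 • π (PowerSeries.C (EFree.al i 0)) = 0
    rw [EFree.al, dif_neg (by simp), map_zero, map_zero, smul_zero]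
  a_a i j l m hl hm := by
    have := h.rel _ _ (.al_al i j l m hl hm)
    rw [map_sub, map_sub, map_mul, map_mul, map_mul, map_mul, sub_eq_iff_eq_add'] at this
    simp only [ellData, ellA, smul_mul_assoc, mul_smul_comm]
    rw [this, smul_add, smul_add, smul_comm (alS' l)]
    congr 1
    split_ifs with hlm
    · obtain rfl : m = -l := by omega
      rw [h.map_ofCoef, Algebra.algebraMap_eq_smul_one, smul_smul, smul_smul]
      congr 1
      have h1 := alS_mul_alS_neg hl
      have h2 := alS_mul_alS' hl
      have h3 := alS_mul_alS' hm
      rw [map_mul PowerSeries.C (scal _ * _), mul_assoc (PowerSeries.C _), ← h1]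
      linear_combination PowerSeries.C (scal (D.str i j l / D.qdiff j) *
        (cpow (2 * l) - cpow (-(2 * l)))) * (alS (-l) * alS' (-l) * h2 + h3)
    · rw [map_zero, smul_zero, smul_zero]

/-- The relation between the recovered `a^∨_{i,l}` and `x_j^+(z)`. -/
theorem a_x_one (hD : D.Admissible) (i j : D.I) {l : ℤ} (hl : l ≠ 0) (n : ℤ) :
    (ellData π N).a i l * π (PowerSeries.C (EFree.x 1 j n)) =
      π (PowerSeries.C (EFree.x 1 j n)) * (ellData π N).a i l +
        D.sP i j l • π (PowerSeries.C (EFree.x 1 j (n + l))) := by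
  have := h.rel _ _ (.al_xp i j l n hl)
  rw [map_sub, map_sub, map_mul, map_mul, map_mul, map_mul, sub_eq_iff_eq_add', h.map_ofCoef_mul]
    at this
  simp only [ellData, ellA, smul_mul_assoc, mul_smul_comm]
  rw [this, smul_add, smul_smul, ← alS_mul_sP hD i j hl, ← mul_assoc, mul_comm (alS' l),
    alS_mul_alS' hl, one_mul]

/-- The relation between the recovered `a^∨_{i,l}` and `x_j^-(z)`. -/
theorem a_x_neg_one (hD : D.Admissible) (i j : D.I) {l : ℤ} (hl : l ≠ 0) (n : ℤ) :
    (ellData π N).a i l * π (PowerSeries.C (EFree.x (-1) j n)) =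
      π (PowerSeries.C (EFree.x (-1) j n)) * (ellData π N).a i l +
        D.sM i j l • π (PowerSeries.C (EFree.x (-1) j (n + l))) := by
  have := h.rel _ _ (.al_xm i j l n hl)
  rw [map_sub, map_sub, map_mul, map_mul, map_mul, map_mul, sub_eq_iff_eq_add',
    ← ofCoef_C_mul_C, h.map_ofCoef_mul] at this
  simp only [ellData, ellA, smul_mul_assoc, mul_smul_comm]
  rw [this, smul_add, smul_smul, ← alS_mul_sM hD i j hl, ← mul_assoc, mul_comm (alS' l),
    alS_mul_alS' hl, one_mul]

/-- Removing the exponentials from `x^±` restores the relations between `a^∨_{i,l}` and `X_j^±(z)`.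
-/
theorem isBase (hD : D.Admissible) : (ellData π N).IsBase where
  toIsHeis := h.isHeis
  a_X ε i j l n hl := by
    rcases Int.units_eq_one_or ε with rfl | rfl
    · rw [ellData_X_one, ellData_X_one, ← mul_assoc]
      have := TorData.a_twist_cP h.pow_eq_zero (-1) hl (h.isHeis.a_cP i j hl)
          (h.a_x_one hD i j hl) n
      simp only [Units.val_neg, Units.val_one, neg_smul, one_smul] at this
      rw [this, add_mul, mul_assoc, ← (h.eQ_a _ _ _).eq, mul_assoc, smul_mul_assoc]
      congr 2
      simp
    · rw [ellData_X_neg_one]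
      have := TorData.a_twistR_cM h.pow_eq_zero (-1) hl (h.isHeis.a_cM i j hl)
          (h.a_x_neg_one hD i j hl) n
      simp only [Units.val_neg, Units.val_one, neg_smul, one_smul] at this
      rw [this]
      congr 2
      simp
  k_a ε i j l := by
    have := h.rel_fin (.K_al ε i j l)
    rw [map_mul, map_mul, map_mul, map_mul] at this
    exact ((show Commute _ _ from this).smul_right _).mul_left (h.eQ_a _ _ _)
  eQ_zero := h.eQ_zero
  eQ_add := h.eQ_add
  eQ_a := h.eQ_a
  eQ_X α := h.commute_X (h.eQ_a α) (h.eQ_x α) (h.eQ_eQ α)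
  eQ_k α ε i := (h.eQ_K α ε i).mul_right (h.eQ_eQ _ _)

/-- Twisting the untwisted currents gives back the generators of the elliptic algebra. -/
theorem isCompat (hD : D.Admissible) : (ellData π N).IsCompat π N where
  al i l := by
    rcases eq_or_ne l 0 with rfl | hl
    · rw [TorData.al, h.isHeis.a_zero, EFree.al, dif_neg (by simp), map_zero, map_zero, smul_zero]
    · show _ = alS l • alS' l • π (PowerSeries.C (EFree.al i l))
      rw [smul_smul, alS_mul_alS' hl, one_smul]
  x ε i n := by
    rcases Int.units_eq_one_or ε with rfl | rfl
    · have : (ellData π N).baseP i = twist N 1 (fun n => -(ellData π N).cP i n)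
          (fun n => π (PowerSeries.C (EFree.x 1 i n))) := by
        ext n
        rw [TorData.baseP, ellData_X_one, mul_assoc, (h.isBase hD).eQ_mul_e, mul_one]
      rw [TorData.x_one, this, twist_twist_neg h.pow_eq_zero]
    · rw [TorData.x_neg_one, ellData_X_neg_one, twistR_twistR_neg h.pow_eq_zero]
  K ε i := by
    rw [TorData.K, ellData_k, mul_assoc, (h.isBase hD).eQ_mul_e, mul_one]
  qd _ := rfl
  eQ _ := rfl
  fn _ := rfl

theorem fn_eQ (f : D.Mer) (j : D.I) : (ellData π N).fn f * (ellData π N).eQ (Pi.single j 1) =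
    (ellData π N).eQ (Pi.single j 1) * (ellData π N).fn (D.shift (D.QVec j) f) := by
  have := h.rel_fin (.eQ_fn (Pi.single j 1) (D.shift (D.QVec j) f))
  rw [map_mul, map_mul, map_mul, map_mul, latVec_single_right, shift_shift] at this
  simp only [one_smul, neg_add_cancel, shift_zero] at this
  exact this.symm

theorem fn_a (f : D.Mer) (i : D.I) (l : ℤ) :
    Commute ((ellData π N).fn f) ((ellData π N).a i l) := by
  have := h.rel_fin (.fn_al f i l)
  rw [map_mul, map_mul, map_mul, map_mul] at this
  exact (show Commute _ _ from this).smul_right _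

theorem fn_gen (f : D.Mer) (g : D.Gen) : (ellData π N).fn f * (ellData π N).gen g =
    (ellData π N).gen g * (ellData π N).fn (D.shift (D.latVec (g.wt, 0)) f) := by
  cases g with
  | a i l =>
    rw [show D.latVec ((Gen.a i l : D.Gen).wt, 0) = 0 from map_zero D.latVec, shift_zero]
    exact h.fn_a f i l
  | k ε i =>
    rw [show D.latVec ((Gen.k ε i : D.Gen).wt, 0) = 0 from map_zero D.latVec, shift_zero]
    have := h.rel_fin (.fn_K f ε i)
    rw [map_mul, map_mul, map_mul, map_mul] at this
    rw [TorData.gen, ellData_k, ← mul_assoc, show (ellData π N).fn f * _ = _ from this, mul_assoc,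
      show π (PowerSeries.C (EFree.fn _)) * _ = _ from h.fn_eQ _ i, shift_shift, add_neg_cancel,
      shift_zero, mul_assoc]
  | qd ε =>
    rw [show D.latVec ((Gen.qd ε : D.Gen).wt, 0) = 0 from map_zero D.latVec, shift_zero]
    have := h.rel_fin (.fn_qd f ε)
    rw [map_mul, map_mul, map_mul, map_mul] at this
    exact this
  | X ε j n =>
    rw [show D.latVec ((Gen.X ε j n : D.Gen).wt, 0) = (ε : ℤ) • D.rootVec j from
      latVec_single_left _ _ _, TorData.gen]
    rcases Int.units_eq_one_or ε with rfl | rfl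
    · rw [ellData_X_one]
      have := mul_twist (N := N) (τ := 1) (g := (ellData π N).fn f)
        (c := fun n => -(ellData π N).cP j n) (y := fun n => π (PowerSeries.C (EFree.x 1 j n)))
        (g' := (ellData π N).fn (D.shift (D.rootVec j - D.QVec j) f)) (α := 1) (β := fun _ => 1)
        (γ := fun _ => 1)
        (fun n _ => by
          rw [one_pow, one_smul]; exact (((h.fn_a f j _).smul_right _).neg_right).eq)
        (fun m => by
          have := h.rel_fin (.fn_xp f j m)
          rw [map_mul, map_mul, map_mul, map_mul] at this
          rw [one_smul]; exact this) (fun _ _ => by simp) n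
      rw [one_smul] at this
      rw [← mul_assoc, this, mul_assoc, h.fn_eQ, shift_shift, mul_assoc]
      simp
    · rw [ellData_X_neg_one]
      have := mul_twistR (N := N) (τ := -1) (g := (ellData π N).fn f)
        (c := fun n => -(ellData π N).cM j n) (y := fun n => π (PowerSeries.C (EFree.x (-1) j n)))
        (g' := (ellData π N).fn (D.shift (-D.rootVec j) f)) (α := 1) (β := fun _ => 1)
        (γ := fun _ => 1)
        (fun n _ => by
          rw [one_pow, one_smul]; exact (((h.fn_a _ j _).smul_right _).neg_right).eq)
        (fun m => by
          have := h.rel_fin (.fn_xm f j m)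
          rw [map_mul, map_mul, map_mul, map_mul] at this
          rw [one_smul]; exact this) (fun _ _ => by simp) n
      rw [one_smul] at this
      rw [this]
      simp

theorem eQ_gen (hD : D.Admissible) (α : D.I → ℤ) (g : D.Gen) :
    Commute ((ellData π N).eQ α) ((ellData π N).gen g) := by
  cases g with
  | a i l => exact h.eQ_a α i l
  | k ε i => exact (h.isBase hD).eQ_k α ε i
  | X ε j n => exact (h.isBase hD).eQ_X α ε j n
  | qd ε =>
    have := h.rel_fin (.eQ_qd α ε)
    rwa [map_mul, map_mul, map_mul, map_mul] at this

theorem qd_a (i : D.I) (l : ℤ) : (ellData π N).qd 1 * (ellData π N).a i l =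
    scal (D.q ^ l) • ((ellData π N).a i l * (ellData π N).qd 1) := by
  have := h.rel_fin (.qd_al i l)
  rw [map_C_smul, map_mul, map_mul, map_mul, map_mul] at this
  simp only [ellData, ellA, mul_smul_comm, smul_mul_assoc]
  rw [this, smul_comm]

theorem qd_X (hD : D.Admissible) (ε : ℤˣ) (i : D.I) (n : ℤ) :
    (ellData π N).qd 1 * (ellData π N).X ε i n =
      scal (D.q ^ n) • ((ellData π N).X ε i n * (ellData π N).qd 1) := by
  have hq : ∀ (n : ℕ) (k : ℤ), scal (D.q ^ k) ^ n = scal (D.q ^ (k * n)) := fun n k => by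
    rw [zpow_mul, zpow_natCast]; exact (map_pow LaurentPolynomial.C _ _).symm
  have hx : ∀ ε i n, (ellData π N).qd 1 * π (PowerSeries.C (EFree.x ε i n)) =
      scal (D.q ^ n) • (π (PowerSeries.C (EFree.x ε i n)) * (ellData π N).qd 1) := fun ε i n => by
    have := h.rel_fin (.qd_x ε i n)
    rw [map_C_smul, map_mul, map_mul, map_mul, map_mul] at this
    exact this
  rcases Int.units_eq_one_or ε with rfl | rfl
  · rw [ellData_X_one, ← mul_assoc, mul_assoc (twist _ _ _ _ _),
      show (ellData π N).eQ (Pi.single i 1) * (ellData π N).qd 1 = _ from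
        (h.eQ_gen hD _ (.qd 1)).eq, ← mul_assoc, ← smul_mul_assoc]
    congr 1
    refine mul_twist (c := fun n => -(ellData π N).cP i n) (α := scal (D.q ^ (-1 : ℤ)))
      (β := fun n => scal (D.q ^ n)) (γ := fun n => scal (D.q ^ n)) (fun n _ => ?_) (hx 1 i)
      (fun m n => ?_) n
    · rw [TorData.cP, mul_neg, neg_mul, mul_smul_comm, h.qd_a, smul_mul_assoc, smul_neg,
        smul_comm, hq, neg_one_mul]
    · rw [hq, ← scal_mul, ← zpow_add₀ hD.q_ne]; congr 2; ring
  · rw [ellData_X_neg_one]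
    refine mul_twistR (c := fun n => -(ellData π N).cM i n) (α := scal (D.q ^ (1 : ℤ)))
      (β := fun n => scal (D.q ^ n)) (γ := fun n => scal (D.q ^ n)) (fun n _ => ?_) (hx (-1) i)
      (fun m n => ?_) n
    · rw [TorData.cM, mul_neg, neg_mul, mul_smul_comm, h.qd_a, smul_mul_assoc, smul_neg,
        smul_comm, hq, one_mul]
    · rw [hq, ← scal_mul, ← zpow_add₀ hD.q_ne]; congr 2; ring

theorem k_X (hD : D.Admissible) (ε : ℤˣ) (i j : D.I) (n : ℤ) :
    (ellData π N).k 1 i * (ellData π N).X ε j n =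
      scal (D.q ^ (ε * D.b i j)) • ((ellData π N).X ε j n * (ellData π N).k 1 i) := by
  have hb := h.isBase hD
  have hx : ∀ ε n, (ellData π N).k 1 i * π (PowerSeries.C (EFree.x ε j n)) =
      scal (D.q ^ (ε * D.b i j)) •
        (π (PowerSeries.C (EFree.x ε j n)) * (ellData π N).k 1 i) := fun ε n => by
    have := h.rel_fin (.K_x 1 ε i j n)
    rw [map_C_smul, map_mul, map_mul, map_mul, map_mul, Units.val_one, one_mul] at this
    rw [ellData_k, mul_assoc, (h.eQ_x _ ε j n).eq, ← mul_assoc, this, smul_mul_assoc, mul_assoc]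
  rcases Int.units_eq_one_or ε with rfl | rfl
  · rw [ellData_X_one, ← mul_assoc, mul_assoc (twist _ _ _ _ _), (hb.eQ_k _ 1 i).eq, ← mul_assoc,
      ← smul_mul_assoc]
    congr 1
    refine mul_twist (c := fun n => -(ellData π N).cP j n) (α := 1)
      (β := fun _ => scal (D.q ^ (((1 : ℤˣ) : ℤ) * D.b i j)))
      (γ := fun _ => scal (D.q ^ (((1 : ℤˣ) : ℤ) * D.b i j))) (fun n _ => ?_) (hx 1)
      (fun m n => by rw [one_pow, one_mul]) n
    rw [one_pow, one_smul]; exact ((hb.k_a 1 i j _).smul_right _).neg_right.eq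
  · rw [ellData_X_neg_one]
    refine mul_twistR (c := fun n => -(ellData π N).cM j n) (α := 1)
      (β := fun _ => scal (D.q ^ (((-1 : ℤˣ) : ℤ) * D.b i j)))
      (γ := fun _ => scal (D.q ^ (((-1 : ℤˣ) : ℤ) * D.b i j))) (fun n _ => ?_) (hx (-1))
      (fun m n => by rw [one_pow, one_mul]) n
    rw [one_pow, one_smul]; exact ((hb.k_a 1 i j _).smul_right _).neg_right.eq

theorem central (hD : D.Admissible) (ε : ℤˣ) (c : D.I → ℕ)
    (hc : D.A.mulVec (fun i => (c i : ℤ)) = 0) (g : D.Gen) :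
    Commute (List.ofFn fun i => (ellData π N).k ε i ^ c i).prod ((ellData π N).gen g) := by
  have hb := h.isBase hD
  have hK : ∀ g : D.EGen, Commute (List.ofFn fun i => (ellData π N).K ε i ^ c i).prod
      (π (PowerSeries.C (EFree.gen g))) := fun g => by
    have := h.rel_fin (.central ε c hc g)
    rw [map_mul, map_mul, map_mul, map_mul] at this
    have h2 : π (PowerSeries.C (List.ofFn fun i => EFree.K ε i ^ c i).prod) =
        (List.ofFn fun i => (ellData π N).K ε i ^ c i).prod := by
      simp only [map_list_prod, List.map_ofFn, Function.comp_def, map_pow, (h.isCompat hD).K]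
    rwa [h2] at this
  have hprod : (List.ofFn fun i => (ellData π N).k ε i ^ c i).prod =
      (List.ofFn fun i => (ellData π N).K ε i ^ c i).prod *
        (ellData π N).eQ fun i => (c i : ℤ) := by
    rw [hb.prod_K, mul_assoc, ← h.eQ_add,
      show ((fun i => -(c i : ℤ)) + fun i => (c i : ℤ) : D.I → ℤ) = 0 by ext; simp, h.eQ_zero,
      mul_one]
  rw [hprod]
  set u := (List.ofFn fun i => (ellData π N).K ε i ^ c i).prod
  have ha : ∀ i l, Commute u ((ellData π N).a i l) := fun i l => by
    rcases eq_or_ne l 0 with rfl | hl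
    · rw [h.isHeis.a_zero]; exact Commute.zero_right _
    · have := hK (.al i ⟨l, hl⟩)
      rw [show EFree.gen (.al i ⟨l, hl⟩) = EFree.al i l by rw [EFree.al, dif_pos hl]] at this
      exact this.smul_right _
  refine Commute.mul_left ?_ (h.eQ_gen hD _ g)
  cases g with
  | a i l => exact ha i l
  | k ε' i => exact (hK (.K ε' i)).mul_right (hK (.eQ _))
  | X ε' j n => exact h.commute_X ha (fun ε i n => hK (.x ε i n)) (fun α => hK (.eQ α)) ε' j n
  | qd ε' => exact hK (.qd ε')

theorem k_k (ε ε' : ℤˣ) (i j : D.I) :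
    Commute ((ellData π N).k ε i) ((ellData π N).k ε' j) := by
  have := h.rel_fin (.K_K ε ε' i j)
  rw [map_mul, map_mul, map_mul, map_mul] at this
  exact ((show Commute _ _ from this).mul_right (h.eQ_K _ _ _).symm).mul_left
    ((h.eQ_K _ _ _).mul_right (h.eQ_eQ _ _))

theorem k_inv (ε : ℤˣ) (i : D.I) : (ellData π N).k ε i * (ellData π N).k (-ε) i = 1 := by
  have h1 : (ellData π N).k 1 i * (ellData π N).k (-1) i = 1 := by
    have := h.rel_fin (.K_inv i)
    rw [map_mul, map_mul] at this
    rw [ellData_k, ellData_k, mul_assoc, ← mul_assoc ((ellData π N).eQ _), (h.eQ_K _ _ _).eq,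
      mul_assoc, ← mul_assoc (π _) (π _), this, ← h.eQ_add]
    have h2 := h.eQ_add (Pi.single i (-2)) (Pi.single i 1 + Pi.single i 1)
    rw [← Pi.single_add, ← Pi.single_add, show (-2 + (1 + 1) : ℤ) = 0 by norm_num, Pi.single_zero,
      h.eQ_zero] at h2
    rw [← Pi.single_add]
    exact h2.symm
  rcases Int.units_eq_one_or ε with rfl | rfl
  · exact h1
  · rw [neg_neg, (h.k_k _ _ _ _).eq, h1]

/-- The untwisted generators satisfy the relations of the smash product. -/
theorem isTor (hD : D.Admissible) : (ellData π N).IsTor := by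
  have hb := h.isBase hD
  have hN := h.pow_eq_zero
  have hT := h.isCompat hD
  have ha0 := h.isHeis.a_zero
  refine ⟨ha0, fun u v huv => ?_, h.eQ_zero, h.eQ_add, h.eQ_gen hD, fun f g => ?_, fun f g => ?_,
    fun z => ?_, h.fn_gen, fun α f => ?_⟩
  · cases huv with
    | central ε c hc g =>
      simp only [map_mul, TorData.lift_prod_k, TorData.lift_gen]
      exact h.central hD ε c hc g
    | k_inv ε i => simpa only [map_mul, map_one, TorData.lift_k] using h.k_inv ε i
    | k_k ε ε' i j => simp only [map_mul, TorData.lift_k]; exact h.k_k ε ε' i j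
    | k_a ε i j l =>
      simp only [map_mul, TorData.lift_k, TorData.lift_a ha0]; exact hb.k_a ε i j l
    | qd_inv ε =>
      have := h.rel_fin (.qd_inv ε)
      rw [map_mul, map_mul, map_one, map_one] at this
      simp only [map_mul, map_one, TorData.lift_qd]
      exact this
    | qd_k ε ε' i =>
      have := h.rel_fin (.qd_K ε ε' i)
      rw [map_mul, map_mul, map_mul, map_mul] at this
      simp only [map_mul, TorData.lift_k, TorData.lift_qd]
      exact (show Commute _ _ from this).mul_right (h.eQ_gen hD _ (.qd ε)).symm
    | qd_a i l =>
      simpa only [map_mul, map_smul, TorData.lift_qd, TorData.lift_a ha0] using h.qd_a i l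
    | qd_X ε i n =>
      simpa only [map_mul, map_smul, TorData.lift_qd, TorData.lift_X] using h.qd_X hD ε i n
    | k_X ε i j n =>
      simpa only [map_mul, map_smul, TorData.lift_k, TorData.lift_X] using h.k_X hD ε i j n
    | a_a i j l m hl hm =>
      rw [map_sub, map_mul, map_mul, TorData.lift_a ha0, TorData.lift_a ha0, hb.a_a i j l m hl hm,
        add_sub_cancel_left]
      split_ifs
      · rw [C_smul, map_smul, map_one]
      · rw [map_zero]
    | a_X ε i j l n hl =>
      rw [map_sub, map_mul, map_mul, map_smul, TorData.lift_a ha0, TorData.lift_X, TorData.lift_X,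
        hb.a_X ε i j l n hl, add_sub_cancel_left, C_smul]
    | X_X ε i j n l =>
      simp only [map_sub, map_mul, map_smul, TorData.lift_X]
      refine (hb.X_X_iff hD hN ε i j).mp (fun ν => ?_) n l
      have := h.rel _ _ (.x_x ε i j ν)
      rw [h.map_act, h.map_act] at this
      simpa only [map_mul, hT.x] using this
    | Xp_Xm i j n l =>
      have := (hb.Xp_Xm_iff hD hN i j).mp (fun n l => ?_) n l
      · rw [map_sub, map_mul, map_mul, TorData.lift_X, TorData.lift_X, this,
          TorData.IsBase.torComm]
        split_ifs
        · simp only [map_smul, map_sub, TorData.lift_Phi ha0]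
        · rw [map_zero]
      · have := h.rel _ _ (.xp_xm i j n l)
        rw [map_sub, map_sub, map_mul, map_mul, map_mul, map_mul, hT.x, hT.x] at this
        rw [this]
        split_ifs
        · rw [map_smul, map_sub, map_smul, map_smul, hb.map_phi h.toIsEval hT.al hT.K,
            hb.map_phi h.toIsEval hT.al hT.K]
        · rw [map_zero]
    | serre ε i j hij s hs n l =>
      simp only [map_sum, map_mul, map_smul, map_list_prod, List.map_take, List.map_drop,
        List.map_ofFn, Function.comp_def, TorData.lift_X, map_zero]
      refine (hb.serre_iff hD hN ε i j s).mp (fun ν => ?_) n l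
      have := h.rel _ _ (.serre ε i j hij s hs ν)
      rw [map_zero, map_sum] at this
      rw [← this]
      refine Finset.sum_congr rfl fun σ _ => ?_
      rw [map_sum]
      refine Finset.sum_congr rfl fun r _ => ?_
      rw [map_smul, h.map_act]
      congr 2
      ext ν
      simp only [EFree.serreWord, map_mul, map_list_prod, List.map_take, List.map_drop,
        List.map_ofFn, Function.comp_def, hT.x]
  · have := h.rel_fin (.fn_add f g)
    rwa [map_add, map_add] at this
  · have := h.rel_fin (.fn_mul f g)
    rwa [map_mul, map_mul] at this
  · have := h.rel_fin (.fn_const z)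
    rw [← constAlgHom_apply (algebraMap _ _ _), AlgHom.commutes, AlgHom.commutes] at this
    exact this
  · have := h.rel_fin (.eQ_fn α f)
    rwa [map_mul, map_mul, map_mul, map_mul] at this

end IsEll
end Ell
end Datum
end EllTor

namespace EllTor
namespace Datum

/-! ### The relations in the smash product -/

section Hom
variable (D : Datum)

/-- The inclusion of the smash product into the skew group algebra. -/
def smashVal : D.Smash →ₐ[Coef] D.Skew := D.smashAlg.val

theorem smashVal_injective : Function.Injective D.smashVal := Subtype.val_injective

/-- The generators of the smash product. -/
def smashTor : D.TorData D.Smash where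
  a := Smash.a
  X := Smash.X
  k := Smash.k
  qd := Smash.qd
  eQ := Smash.eQ
  fn := Smash.fn

/-- The projection onto the quantum toroidal algebra. -/
def torMk : D.TFree →ₐ[Coef] D.UTor := RingQuot.mkAlgHom Coef D.TRel

theorem torMk_rel {u v : D.TFree} (huv : D.TRel u v) : D.torMk u = D.torMk v :=
  RingQuot.mkAlgHom_rel Coef huv

/-- The map `a ↦ a ⊗ e^0` on the part of weight `β`. -/
def skewLin (β : D.I → ℤ) : D.UTor →ₗ[Coef] D.Skew where
  toFun a := D.skewElt β 0 a 1
  map_add' a b := by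
    rw [skewElt, TensorProduct.add_tmul]
    exact SkewMonoidAlgebra.single_add _ _ _
  map_smul' c a := by
    rw [skewElt, ← TensorProduct.smul_tmul']
    exact (SkewMonoidAlgebra.smul_single c _ _).symm

theorem skewLin_mul (β β' : D.I → ℤ) (a b : D.UTor) :
    D.skewLin β a * D.skewLin β' b = D.skewLin (β + β') (a * b) := by
  refine (D.skewElt_mul β 0 β' 0 a b 1 1).trans ?_
  rw [map_one, mul_one, add_zero]; rfl

theorem skewLin_one : D.skewLin 0 1 = 1 := rfl

/-- The homomorphism `a ↦ a ⊗ e^0` from the free algebra, sending `a` of weight `β` to the component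
of index `β`. -/
def freeSkew : D.TFree →ₐ[Coef] D.Skew := D.smashVal.comp D.smashTor.lift

/-- Homogeneous elements of weight `β` of the free algebra. -/
def IsHom (β : D.I → ℤ) (u : D.TFree) : Prop :=
  D.freeSkew u = D.skewLin β (D.torMk u)

variable {D}

theorem smashTor_gen (g : D.Gen) : D.smashTor.gen g = Smash.gen g := by
  cases g with
  | a i l => exact dif_pos l.2
  | _ => rfl

namespace IsHom
variable {β β' : D.I → ℤ} {u v : D.TFree}

theorem gen (g : D.Gen) : D.IsHom g.wt (TFree.gen g) := by
  rw [IsHom, freeSkew, AlgHom.comp_apply, TorData.lift_gen, smashTor_gen]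
  rfl

theorem mul (hu : D.IsHom β u) (hv : D.IsHom β' v) : D.IsHom (β + β') (u * v) := by
  rw [IsHom, map_mul, map_mul, hu, hv, skewLin_mul]

theorem add (hu : D.IsHom β u) (hv : D.IsHom β v) : D.IsHom β (u + v) := by
  rw [IsHom, map_add, map_add, hu, hv, map_add]

theorem sub (hu : D.IsHom β u) (hv : D.IsHom β v) : D.IsHom β (u - v) := by
  rw [IsHom, map_sub, map_sub, hu, hv, map_sub]

theorem smul (c : Coef) (hu : D.IsHom β u) : D.IsHom β (c • u) := by
  rw [IsHom, map_smul, map_smul, hu, map_smul]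

theorem zero : D.IsHom β 0 := by rw [IsHom, map_zero, map_zero, map_zero]

theorem one : D.IsHom 0 1 := by rw [IsHom, map_one, map_one, skewLin_one]

theorem sum {κ : Type} (S : Finset κ) {f : κ → D.TFree} (h : ∀ k ∈ S, D.IsHom β (f k)) :
    D.IsHom β (∑ k ∈ S, f k) := by
  classical
  induction S using Finset.induction_on with
  | empty => exact zero
  | insert k S hk ih =>
    rw [Finset.sum_insert hk]
    exact (h k (Finset.mem_insert_self _ _)).add
      (ih fun k' hk' => h k' (Finset.mem_insert_of_mem hk'))

theorem list_prod (L : List D.TFree) (h : ∀ u ∈ L, D.IsHom β u) :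
    D.IsHom (L.length • β) L.prod := by
  induction L with
  | nil => rw [List.length_nil, zero_smul]; exact one
  | cons u L ih =>
    rw [List.length_cons, succ_nsmul', List.prod_cons]
    exact (h u List.mem_cons_self).mul (ih fun v hv => h v (List.mem_cons_of_mem _ hv))

theorem pow (hu : D.IsHom 0 u) (n : ℕ) : D.IsHom 0 (u ^ n) := by
  rw [IsHom, map_pow, map_pow, hu]
  induction n with
  | zero => rw [pow_zero, pow_zero, skewLin_one]
  | succ n ih => rw [pow_succ, pow_succ, ih, skewLin_mul, add_zero]

theorem X (ε : ℤˣ) (i : D.I) (n : ℤ) : D.IsHom (Pi.single i (ε : ℤ)) (TFree.X ε i n) :=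
  gen (.X ε i n)

theorem k (ε : ℤˣ) (i : D.I) : D.IsHom 0 (TFree.k ε i) := gen (.k ε i)

theorem qd (ε : ℤˣ) : D.IsHom 0 (TFree.qd ε) := gen (.qd ε)

theorem a (i : D.I) (l : ℤ) : D.IsHom 0 (TFree.a i l) := by
  rw [TFree.a]
  split_ifs with hl
  · exact gen (.a i ⟨l, hl⟩)
  · exact zero

theorem prod_k (ε : ℤˣ) (c : D.I → ℕ) :
    D.IsHom 0 (List.ofFn fun i => TFree.k ε i ^ c i).prod := by
  have := list_prod (β := 0) (List.ofFn fun i => TFree.k ε i ^ c i) fun u hu => by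
    obtain ⟨i, rfl⟩ := (List.mem_ofFn' _ _).mp hu
    exact (k ε i).pow _
  rwa [smul_zero] at this

theorem Phi (ε : ℤˣ) (i : D.I) (n : ℤ) : D.IsHom 0 (TFree.Phi ε i n) := by
  let ψ : D.UTor →ₐ[Coef] D.Skew := AlgHom.ofLinearMap (D.skewLin 0) D.skewLin_one fun a b => by
    rw [skewLin_mul, add_zero]
  have h1 := map_trigPhi (D.qdiff i) ε (TFree.k ε i) (TFree.a i) D.freeSkew n
  have h2 := map_trigPhi (D.qdiff i) ε (TFree.k ε i) (TFree.a i) (ψ.comp D.torMk) n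
  refine h1.trans (Eq.trans ?_ h2.symm)
  rw [show D.freeSkew (TFree.k ε i) = (ψ.comp D.torMk) (TFree.k ε i) from k ε i,
    show (fun l => D.freeSkew (TFree.a i l)) = fun l => (ψ.comp D.torMk) (TFree.a i l) from
      funext fun l => a i l]

/-- Homogeneous elements of the same weight are identified in the smash product if they are so in
the quantum toroidal algebra. -/
theorem lift_eq (hu : D.IsHom β u) (hv : D.IsHom β v) (huv : D.TRel u v) :
    D.smashTor.lift u = D.smashTor.lift v := by
  refine D.smashVal_injective (?_ : D.freeSkew u = D.freeSkew v)
  rw [hu, hv, D.torMk_rel huv]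

end IsHom

/-- The relations of the quantum toroidal algebra hold in the smash product: both sides of each of
them are homogeneous of the same weight. -/
theorem smashTor_lift_eq {u v : D.TFree} (huv : D.TRel u v) :
    D.smashTor.lift u = D.smashTor.lift v := by
  have huv' := huv
  -- in each case `β` is the common weight
  cases huv with
  | central ε c hc g =>
    refine IsHom.lift_eq (β := g.wt) ?_ ?_ huv'
    · simpa using (IsHom.prod_k ε c).mul (IsHom.gen g)
    · simpa using (IsHom.gen g).mul (IsHom.prod_k ε c)
  | k_inv ε i =>
    exact IsHom.lift_eq (by simpa using (IsHom.k ε i).mul (IsHom.k (-ε) i)) IsHom.one huv'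
  | k_k ε ε' i j =>
      exact IsHom.lift_eq ((IsHom.k ε i).mul (IsHom.k ε' j)) ((IsHom.k ε' j).mul (IsHom.k ε i)) huv'
  | k_a ε i j l =>
      exact IsHom.lift_eq ((IsHom.k ε i).mul (IsHom.a j l)) ((IsHom.a j l).mul (IsHom.k ε i)) huv'
  | qd_inv ε => exact IsHom.lift_eq (by simpa using (IsHom.qd ε).mul (IsHom.qd (-ε))) IsHom.one huv'
  | qd_k ε ε' i =>
      exact IsHom.lift_eq ((IsHom.qd ε).mul (IsHom.k ε' i)) ((IsHom.k ε' i).mul (IsHom.qd ε)) huv'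
  | qd_a i l =>
      exact IsHom.lift_eq ((IsHom.qd 1).mul (IsHom.a i l))
        (((IsHom.a i l).mul (IsHom.qd 1)).smul _) huv'
  | qd_X ε i n =>
    refine IsHom.lift_eq ((IsHom.qd 1).mul (IsHom.X ε i n)) (IsHom.smul _ ?_) huv'
    rw [add_comm]; exact (IsHom.X ε i n).mul (IsHom.qd 1)
  | k_X ε i j n =>
    refine IsHom.lift_eq ((IsHom.k 1 i).mul (IsHom.X ε j n)) (IsHom.smul _ ?_) huv'
    rw [add_comm]; exact (IsHom.X ε j n).mul (IsHom.k 1 i)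
  | a_a i j l m hl hm =>
    refine IsHom.lift_eq (β := 0) (IsHom.sub ?_ ?_) ?_ huv'
    · simpa using (IsHom.a i l).mul (IsHom.a j m)
    · simpa using (IsHom.a j m).mul (IsHom.a i l)
    · split_ifs
      · exact IsHom.one.smul _
      · exact IsHom.zero
  | a_X ε i j l n hl =>
    refine IsHom.lift_eq (β := Pi.single j (ε : ℤ)) (IsHom.sub ?_ ?_) ((IsHom.X ε j _).smul _) huv'
    · simpa using (IsHom.a i l).mul (IsHom.X ε j n)
    · simpa using (IsHom.X ε j n).mul (IsHom.a i l)
  | X_X ε i j n l =>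
    have h1 : ∀ n l, D.IsHom (Pi.single i (ε : ℤ) + Pi.single j (ε : ℤ))
        (TFree.X ε i n * TFree.X ε j l) := fun n l => (IsHom.X ε i n).mul (IsHom.X ε j l)
    have h2 : ∀ n l, D.IsHom (Pi.single i (ε : ℤ) + Pi.single j (ε : ℤ))
        (TFree.X ε j l * TFree.X ε i n) := fun n l => by
      rw [add_comm]; exact (IsHom.X ε j l).mul (IsHom.X ε i n)
    exact IsHom.lift_eq (((h1 _ _).smul _).sub ((h1 _ _).smul _))
      (((h2 _ _).smul _).sub (h2 _ _)) huv'
  | Xp_Xm i j n l =>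
    refine IsHom.lift_eq (β := Pi.single i ((1 : ℤˣ) : ℤ) + Pi.single j ((-1 : ℤˣ) : ℤ))
      (((IsHom.X 1 i n).mul (IsHom.X (-1) j l)).sub ?_) ?_ huv'
    · rw [add_comm]; exact (IsHom.X (-1) j l).mul (IsHom.X 1 i n)
    · split_ifs with hij
      · subst hij
        rw [← Pi.single_add, show (((1 : ℤˣ) : ℤ) + ((-1 : ℤˣ) : ℤ)) = 0 by simp, Pi.single_zero]
        exact (((IsHom.Phi 1 i _).smul _).sub ((IsHom.Phi (-1) i _).smul _)).smul _
      · exact IsHom.zero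
  | serre ε i j hij s hs n l =>
    refine IsHom.lift_eq (β := s • Pi.single i (ε : ℤ) + Pi.single j (ε : ℤ))
      (IsHom.sum _ fun σ _ => IsHom.sum _ fun r hr => IsHom.smul _ ?_) IsHom.zero huv'
    have h1 : ∀ u ∈ List.ofFn fun t => TFree.X ε i (n (σ t)), D.IsHom (Pi.single i (ε : ℤ)) u :=
      fun u hu => by
        obtain ⟨t, rfl⟩ := (List.mem_ofFn' _ _).mp hu
        exact IsHom.X _ _ _
    have h2 := ((IsHom.list_prod _ fun u hu => h1 u (List.mem_of_mem_take (i := r) hu)).mul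
      (IsHom.X ε j l)).mul (IsHom.list_prod _ fun u hu => h1 u (List.mem_of_mem_drop (i := r) hu))
    rw [Finset.mem_range] at hr
    rw [List.length_take, List.length_drop, List.length_ofFn, min_eq_left (by omega),
      add_right_comm, ← add_smul, show r + (s - r) = s by omega] at h2
    exact h2

theorem latVec_zero_zero : D.latVec (0, 0) = 0 := map_zero D.latVec

/-- The generators of the smash product satisfy its relations. -/
theorem smashTor_isTor : D.smashTor.IsTor where
  a_zero i := (dif_neg (not_not.mpr rfl) : Smash.a i 0 = 0)
  rel u v := smashTor_lift_eq
  eQ_zero := D.smashVal_injective rfl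
  eQ_add α β := D.smashVal_injective <| by
    rw [map_mul]
    refine Eq.trans ?_ (D.skewElt_mul 0 α 0 β 1 1 1 1).symm
    rw [map_one, mul_one, mul_one, add_zero]; rfl
  eQ_gen α g := D.smashVal_injective <| by
    rw [smashTor_gen, map_mul, map_mul]
    refine (D.skewElt_mul 0 α g.wt 0 1 _ 1 1).trans
      (Eq.trans ?_ (D.skewElt_mul g.wt 0 0 α _ 1 1 1).symm)
    rw [map_one, map_one, mul_one, one_mul, mul_one, add_comm, add_comm α]
  fn_add f g := D.smashVal_injective <| by
    rw [map_add]
    show D.skewElt 0 0 1 (f + g) = D.skewElt 0 0 1 f + D.skewElt 0 0 1 g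
    rw [skewElt, TensorProduct.tmul_add]
    exact SkewMonoidAlgebra.single_add _ _ _
  fn_mul f g := D.smashVal_injective <| by
    rw [map_mul]
    refine Eq.trans ?_ (D.skewElt_mul 0 0 0 0 1 1 f g).symm
    rw [latVec_zero_zero, neg_zero, shift_zero, mul_one, add_zero]; rfl
  fn_const z := D.smashVal_injective <| by
    rw [AlgHom.commutes, Algebra.algebraMap_eq_smul_one, Algebra.algebraMap_eq_smul_one]
    show D.skewElt 0 0 1 (z • 1) = scal z • D.skewElt 0 0 1 1
    have h1 : scal z • (1 : D.UTor) = z • (1 : D.UTor) := (algebraMap_smul Coef z (1 : D.UTor))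
    rw [skewElt, TensorProduct.tmul_smul, TensorProduct.smul_tmul', ← h1,
        ← TensorProduct.smul_tmul']
    exact (SkewMonoidAlgebra.smul_single (scal z) _ _).symm
  fn_gen f g := D.smashVal_injective <| by
    rw [smashTor_gen, map_mul, map_mul]
    refine (D.skewElt_mul 0 0 g.wt 0 1 _ f 1).trans
      (Eq.trans ?_ (D.skewElt_mul g.wt 0 0 0 _ 1 1 _).symm)
    rw [map_one, mul_one, one_mul, mul_one, add_comm, one_mul, shift_shift, neg_add_cancel,
      shift_zero]
    rfl
  eQ_fn α f := D.smashVal_injective <| by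
    rw [map_mul, map_mul]
    refine (D.skewElt_mul 0 α 0 0 1 1 1 f).trans (Eq.trans ?_ (D.skewElt_mul 0 0 0 α 1 1 _ 1).symm)
    rw [map_one, mul_one, one_mul, add_comm α, mul_one]

namespace TorData
variable {R S : Type} [Ring R] [Algebra Coef R] [Ring S] [Algebra Coef S]

/-- The images of the generators under a homomorphism. -/
def map (T : D.TorData R) (ψ : R →ₐ[Coef] S) : D.TorData S where
  a i l := ψ (T.a i l)
  X ε i n := ψ (T.X ε i n)
  k ε i := ψ (T.k ε i)
  qd ε := ψ (T.qd ε)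
  eQ α := ψ (T.eQ α)
  fn f := ψ (T.fn f)

theorem map_gen (T : D.TorData R) (ψ : R →ₐ[Coef] S) (g : D.Gen) :
    (T.map ψ).gen g = ψ (T.gen g) := by
  cases g <;> rfl

theorem map_lift (T : D.TorData R) (ψ : R →ₐ[Coef] S) : (T.map ψ).lift = ψ.comp T.lift := by
  refine FreeAlgebra.hom_ext (funext fun g => ?_)
  simp [lift, map_gen]

theorem IsTor.map {T : D.TorData R} (h : T.IsTor) (ψ : R →ₐ[Coef] S) : (T.map ψ).IsTor where
  a_zero i := (congrArg ψ (h.a_zero i)).trans (map_zero ψ)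
  rel u v huv := by rw [map_lift, AlgHom.comp_apply, AlgHom.comp_apply, h.rel u v huv]
  eQ_zero := (congrArg ψ h.eQ_zero).trans (map_one ψ)
  eQ_add α β := (congrArg ψ (h.eQ_add α β)).trans (map_mul ψ _ _)
  eQ_gen α g := by rw [map_gen]; exact (h.eQ_gen α g).map ψ
  fn_add f g := (congrArg ψ (h.fn_add f g)).trans (map_add ψ _ _)
  fn_mul f g := (congrArg ψ (h.fn_mul f g)).trans (map_mul ψ _ _)
  fn_const z := (congrArg ψ (h.fn_const z)).trans (ψ.commutes _)
  fn_gen f g := by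
    rw [map_gen]
    have := congrArg ψ (h.fn_gen f g)
    rwa [map_mul, map_mul] at this
  eQ_fn α f := by
    have := congrArg ψ (h.eQ_fn α f)
    rwa [map_mul, map_mul] at this

end TorData

/-! ### Evaluation of the currents in the completed smash product -/

section SmashEval
variable {R : Type} [Ring R] [Algebra Coef R] [Algebra Lam R] [IsScalarTower Coef Lam R]
  {π : D.Smash⟦X⟧ →ₐ[Coef] R} {N : ℕ}

/-- The images of the generators of the smash product. -/
def smashData (π : D.Smash⟦X⟧ →ₐ[Coef] R) : D.TorData R :=
  D.smashTor.map (π.comp (constAlgHom D.Smash))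

theorem smashData_isTor : (smashData π).IsTor := smashTor_isTor.map _

theorem uPlus_eq (i : D.I) : Smash.uPlus i = inZ (pexp (posSer fun n =>
    ofCoef (pp ^ n * D.hP i n) * PowerSeries.C (Smash.a (D := D) i (-n)))) := by
  simp only [Smash.uPlus, pp_pow_mul_hP]

theorem uMinus_eq (i : D.I) : Smash.uMinus i = inZInv (pexp (posSer fun n =>
    ofCoef (pp ^ n * D.hM i n) * PowerSeries.C (Smash.a (D := D) i n))) := by
  simp only [Smash.uMinus, pp_pow_mul_hM]

theorem uPlus_of_pos (i : D.I) {n : ℤ} (hn : 0 < n) : Smash.uPlus (D := D) i n = 0 :=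
  inZ_of_pos _ hn

theorem uMinus_of_neg (i : D.I) {n : ℤ} (hn : n < 0) : Smash.uMinus (D := D) i n = 0 :=
  inZInv_of_neg _ hn

theorem X_pow_dvd_uPlus (i : D.I) (m : ℕ) : PowerSeries.X ^ m ∣ Smash.uPlus (D := D) i (-m) := by
  rw [uPlus_eq, inZ_neg_natCast]
  exact X_pow_dvd_coeff_pexp (fun n => rfl) _ m

theorem X_pow_dvd_uMinus (i : D.I) (m : ℕ) : PowerSeries.X ^ m ∣ Smash.uMinus (D := D) i m := by
  rw [uMinus_eq, inZInv_natCast]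
  exact X_pow_dvd_coeff_pexp (fun n => rfl) _ m

theorem map_uPlus (hπ : IsEval π N) (i : D.I) (m : ℕ) :
    π (Smash.uPlus i (-m)) = pR R ^ m * coeff m (pexp (posSer ((smashData π).cP i))) := by
  rw [uPlus_eq, inZ_neg_natCast, hπ.map_coeff_pexp, coeff_pexp_pp_smul fun n _ => rfl]
  rfl

theorem map_uMinus (hπ : IsEval π N) (i : D.I) (m : ℕ) :
    π (Smash.uMinus i m) = pR R ^ m * coeff m (pexp (posSer ((smashData π).cM i))) := by
  rw [uMinus_eq, inZInv_natCast, hπ.map_coeff_pexp, coeff_pexp_pp_smul fun n _ => rfl]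
  rfl

theorem map_Phi (ε : ℤˣ) (i : D.I) (n : ℤ) : π (Smash.Phi ε i n) =
    trigPhi (D.qdiff i) ε ((smashData π).k ε i) ((smashData π).a i) n := by
  rw [Smash.Phi, map_trigPhi]; rfl

/-- The prescribed image of `x_i^+(z)`, at `p ^ N = 0`, is the twisted current. -/
theorem map_x_one (hπ : IsEval π N) (i : D.I) (n : ℤ) :
    π (mulDist (Smash.uPlus i) (Smash.cur 1 i) n * PowerSeries.C (Smash.eQ (-Pi.single i 1))) =
      (smashData π).x N 1 i n := by
  rw [map_mul, hπ.map_mulDist_left (fun n => uPlus_of_pos i) (X_pow_dvd_uPlus i),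
    TorData.x_one, twist, Finset.sum_mul]
  refine Finset.sum_congr rfl fun m _ => ?_
  rw [map_uPlus hπ, one_mul, mul_assoc, mul_assoc]
  rfl

/-- The prescribed image of `x_i^-(z)`, at `p ^ N = 0`, is the twisted current. -/
theorem map_x_neg_one (hπ : IsEval π N) (i : D.I) (n : ℤ) :
    π (mulDist (Smash.cur (-1) i) (Smash.uMinus i) n) = (smashData π).x N (-1) i n := by
  rw [hπ.map_mulDist_right (fun n => uMinus_of_neg i) (X_pow_dvd_uMinus i),
    TorData.x_neg_one, twistR]
  refine Finset.sum_congr rfl fun m _ => ?_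
  rw [map_uMinus hπ, ← mul_assoc, ← ((commute_pR _).pow_left m).eq, mul_assoc, neg_one_mul,
    ← sub_eq_add_neg]
  rfl

omit [Algebra Lam R] [IsScalarTower Coef Lam R] in
theorem regroup_scaled {c₁ c₂ c₃ : Coef} (hc : c₁ * c₂ = c₃) {P P' u t v e : R}
    (hP' : ∀ r, Commute P' r) (hev : Commute e v) :
    c₁ • (P * u) * t * (c₂ • (P' * v)) * e = P * (u * (P' * (c₃ • (t * e) * v))) := by
  have h1 : P * u * t * (P' * v) * e = P * (u * (P' * (t * e * v))) := by
    rw [mul_assoc t, hev.eq, ← mul_assoc P', (hP' t).eq]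
    simp only [mul_assoc]
  rw [← hc]
  simp only [smul_mul_assoc, mul_smul_comm, smul_smul]
  rw [h1, mul_comm]

/-- The prescribed image `u_i^+(q^{±c/2} z) Φ_i^±(z) u_i^-(q^{∓c/2} z) e^{-Q_i}` of `φ_i^±(z)`, at
`p ^ N = 0`. -/
theorem map_phi_formula (hπ : IsEval π N) (ε : ℤˣ) (i : D.I) (n : ℤ) :
    π (mulDist (mulDist (scaleArg ε (Smash.uPlus i)) (Smash.Phi ε i))
          (scaleArg (-ε) (Smash.uMinus i)) n * PowerSeries.C (Smash.eQ (-Pi.single i 1))) =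
      (smashData π).phi N ε i n := by
  have hb := (smashData_isTor (π := π)).isBase
  have hdvd : ∀ {m : ℕ} (c : Coef) (f : D.Smash⟦X⟧), PowerSeries.X ^ m ∣ f →
      PowerSeries.X ^ m ∣ c • f := by
    rintro m c _ ⟨g, rfl⟩
    exact ⟨c • g, (mul_smul_comm _ _ _).symm⟩
  have h1 : ∀ n, π (mulDist (scaleArg ε (Smash.uPlus i)) (Smash.Phi ε i) n) =
      ∑ m ∈ Finset.range N, π (scaleArg ε (Smash.uPlus i) (-m)) * π (Smash.Phi ε i (n + m)) :=
    hπ.map_mulDist_left (fun n hn => by rw [scaleArg, uPlus_of_pos i hn, smul_zero])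
      fun m => hdvd _ _ (X_pow_dvd_uPlus i m)
  rw [map_mul, hπ.map_mulDist_right (fun n hn => by rw [scaleArg, uMinus_of_neg i hn, smul_zero])
    fun m => hdvd _ _ (X_pow_dvd_uMinus i m)]
  simp only [h1, scaleArg, map_smul, map_uPlus hπ, map_uMinus hπ, map_Phi, TorData.phi,
    Finset.sum_mul, Finset.mul_sum]
  rw [Finset.sum_comm]
  refine Finset.sum_congr rfl fun m _ => Finset.sum_congr rfl fun r _ => ?_
  have he : π (PowerSeries.C (Smash.eQ (-Pi.single i 1))) = (smashData π).e i := rfl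
  have hc : Commute ((smashData π).e i) (coeff r (pexp (posSer ((smashData π).cM i)))) :=
    commute_coeff_pexp (fun n => by
      rw [coeff_posSer]
      split_ifs
      · exact Commute.zero_right _
      · exact (hb.eQ_a _ _ _).smul_right _) r
  rw [he, show n - (r : ℤ) + m = n + m - r by ring]
  refine regroup_scaled ?_ (fun r => (commute_pR r).pow_left _) hc
  rw [← cpow_add]
  congr 1
  ring

end SmashEval
end Hom

end Datum
end EllTor

namespace EllTor

/-! ### Quotients in which a power of `p` vanishes -/

section Quot
variable {A : Type} [Ring A] [Algebra Coef A]

theorem commute_ofCoef (f : Lam) (g : A⟦X⟧) : ofCoef f * g = g * ofCoef f := by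
  ext n
  rw [PowerSeries.coeff_mul, PowerSeries.coeff_mul]
  refine Finset.sum_bij' (fun x _ => x.swap) (fun x _ => x.swap) ?_ ?_ (fun _ _ => rfl)
    (fun _ _ => rfl) fun x _ => ?_
  · intro x hx; simpa [add_comm] using hx
  · intro x hx; simpa [add_comm] using hx
  · rw [ofCoef, PowerSeries.coeff_map, Prod.fst_swap, Prod.snd_swap, PowerSeries.coeff_map]
    exact Algebra.commutes _ _

/-- Power series over an algebra over `ℂ[q^{±c/2}]` form an algebra over `ℂ[q^{±c/2}][[p]]`. -/
@[reducible] def seriesAlgebra (A : Type) [Ring A] [Algebra Coef A] : Algebra Lam A⟦X⟧ :=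
  ofCoef.toAlgebra' commute_ofCoef

/-- The algebra structure over `ℂ[q^{±c/2}][[p]]` of a quotient of `A[[p]]`. -/
@[reducible] def quotAlgebra (c : RingCon A⟦X⟧) : Algebra Lam c.Quotient :=
  letI := seriesAlgebra A
  inferInstance

attribute [local instance] quotAlgebra

instance (c : RingCon A⟦X⟧) : IsScalarTower Coef Lam c.Quotient :=
  IsScalarTower.of_algebraMap_eq fun x => congrArg c.mk' (ofCoef_C x).symm

/-- In a quotient of `A[[p]]` in which `p ^ N = 0`, series are evaluated at the class of `p`. -/
theorem isEval_mk {c : RingCon A⟦X⟧} {N : ℕ} (hc : c (PowerSeries.X ^ N) 0) :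
    IsEval (RingCon.mkₐ Coef c) N where
  map_ofCoef f := rfl
  pow_eq_zero := by
    have : pR c.Quotient = c.mk' PowerSeries.X := congrArg c.mk' ofCoef_X
    rw [this, ← map_pow]
    exact (RingCon.eq c).mpr hc

/-- Congruence modulo `p ^ N`. -/
def truncCon (A : Type) [Ring A] (N : ℕ) : RingCon A⟦X⟧ where
  r f g := ∀ n < N, coeff n f = coeff n g
  iseqv := ⟨fun _ _ _ => rfl, fun h n hn => (h n hn).symm,
    fun h h' n hn => (h n hn).trans (h' n hn)⟩
  add' h h' n hn := by rw [map_add, map_add, h n hn, h' n hn]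
  mul' h h' n hn := by
    rw [PowerSeries.coeff_mul, PowerSeries.coeff_mul]
    refine Finset.sum_congr rfl fun x hx => ?_
    have := Finset.HasAntidiagonal.mem_antidiagonal.mp hx
    rw [h _ (by omega), h' _ (by omega)]

theorem truncCon_X_pow (N : ℕ) : truncCon A N (PowerSeries.X ^ N) 0 := fun n hn => by
  rw [PowerSeries.coeff_X_pow, if_neg hn.ne, map_zero]

theorem isEval_trunc (N : ℕ) : IsEval (RingCon.mkₐ Coef (truncCon A N)) N :=
  isEval_mk (truncCon_X_pow N)

/-- A series is determined by its classes modulo the powers of `p`. -/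
theorem eq_of_trunc_eq {f g : A⟦X⟧}
    (h : ∀ N, RingCon.mkₐ Coef (truncCon A N) f = RingCon.mkₐ Coef (truncCon A N) g) : f = g :=
  PowerSeries.ext fun n => (RingCon.eq _).mp (h (n + 1)) n n.lt_succ_self

end Quot

/-! ### Extension of a homomorphism to power series -/

section Diag
variable {A B : Type} [Ring A] [Algebra Coef A] [Ring B] [Algebra Coef B]

attribute [local instance] quotAlgebra

/-- `∑ a_i p^i ↦ ∑ φ(a_i) p^i`. -/
def diagFun (φ : A →ₐ[Coef] B⟦X⟧) (f : A⟦X⟧) : B⟦X⟧ :=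
  PowerSeries.mk fun n => ∑ i ∈ Finset.range (n + 1), coeff (n - i) (φ (coeff i f))

/-- The value at `∑ a_i p^i` modulo `p ^ N`. -/
theorem mk_diagFun (φ : A →ₐ[Coef] B⟦X⟧) (N : ℕ) (f : A⟦X⟧) :
    RingCon.mkₐ Coef (truncCon B N) (diagFun φ f) = evp N (PowerSeries.map
      (((RingCon.mkₐ Coef (truncCon B N)).comp φ : A →ₐ[Coef] (truncCon B N).Quotient) :
        A →+* (truncCon B N).Quotient) f) := by
  have h1 : evp N (PowerSeries.map
      (((RingCon.mkₐ Coef (truncCon B N)).comp φ : A →ₐ[Coef] (truncCon B N).Quotient) :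
        A →+* (truncCon B N).Quotient) f) =
      RingCon.mkₐ Coef (truncCon B N)
        (∑ i ∈ Finset.range N, PowerSeries.X ^ i * φ (coeff i f)) := by
    rw [map_sum]
    refine Finset.sum_congr rfl fun i _ => ?_
    rw [map_mul, map_pow, (isEval_trunc (A := B) N).map_X, PowerSeries.coeff_map]
    rfl
  rw [h1]
  refine (RingCon.eq _).mpr fun n hn => ?_
  rw [diagFun, PowerSeries.coeff_mk, map_sum]
  simp only [PowerSeries.coeff_X_pow_mul']
  rw [← Finset.sum_filter]
  refine Finset.sum_congr ?_ fun _ _ => rfl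
  ext i
  simp only [Finset.mem_range, Finset.mem_filter]
  omega

theorem diagFun_ofCoef (φ : A →ₐ[Coef] B⟦X⟧) (f : Lam) : diagFun φ (ofCoef f) = ofCoef f := by
  ext n
  rw [diagFun, PowerSeries.coeff_mk, Finset.sum_eq_single n]
  · rw [ofCoef, ofCoef, PowerSeries.coeff_map, PowerSeries.coeff_map, AlgHom.commutes,
      Nat.sub_self, PowerSeries.algebraMap_apply, PowerSeries.coeff_zero_C]
  · intro i hi hin
    rw [ofCoef, PowerSeries.coeff_map, AlgHom.commutes, PowerSeries.algebraMap_apply,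
      PowerSeries.coeff_C, if_neg]
    have := Finset.mem_range.mp hi
    omega
  · intro hn
    exact absurd (Finset.self_mem_range_succ n) hn

/-- The extension of a homomorphism `A → B[[p]]` to `A[[p]]`, with `p ↦ p`. -/
def diagHom (φ : A →ₐ[Coef] B⟦X⟧) : A⟦X⟧ →ₐ[Coef] B⟦X⟧ where
  toFun := diagFun φ
  map_one' := by
    have := diagFun_ofCoef φ 1
    rwa [map_one, map_one] at this
  map_mul' f g := eq_of_trunc_eq fun N => by
    rw [map_mul, mk_diagFun, mk_diagFun, mk_diagFun, map_mul,
      evp_mul (isEval_trunc (A := B) N).pow_eq_zero]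
  map_zero' := by
    have := diagFun_ofCoef φ 0
    rwa [map_zero, map_zero] at this
  map_add' f g := eq_of_trunc_eq fun N => by
    rw [map_add, mk_diagFun, mk_diagFun, mk_diagFun, map_add, evp_add]
  commutes' c := by
    rw [← ofCoef_C, ← ofCoef_C, diagFun_ofCoef]

theorem coeff_diagHom (φ : A →ₐ[Coef] B⟦X⟧) (f : A⟦X⟧) (n : ℕ) : coeff n (diagHom φ f) =
    ∑ i ∈ Finset.range (n + 1), coeff (n - i) (φ (coeff i f)) :=
  PowerSeries.coeff_mk n fun n => ∑ i ∈ Finset.range (n + 1), coeff (n - i) (φ (coeff i f))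

theorem diagHom_ofCoef (φ : A →ₐ[Coef] B⟦X⟧) (f : Lam) : diagHom φ (ofCoef f) = ofCoef f :=
  diagFun_ofCoef φ f

theorem diagHom_C (φ : A →ₐ[Coef] B⟦X⟧) (a : A) : diagHom φ (PowerSeries.C a) = φ a := by
  ext n
  rw [coeff_diagHom, Finset.sum_eq_single 0]
  · rw [PowerSeries.coeff_zero_C, Nat.sub_zero]
  · intro i _ hi
    rw [PowerSeries.coeff_C, if_neg hi, map_zero, map_zero]
  · intro h
    exact absurd (Finset.mem_range.mpr n.succ_pos) h

/-- If the `φ(a_i) = b_i` do not involve `p`, then `∑ a_i p^i ↦ ∑ b_i p^i`. -/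
theorem diagHom_mk {φ : A →ₐ[Coef] B⟦X⟧} {a : ℕ → A} {b : ℕ → B}
    (h : ∀ n, φ (a n) = PowerSeries.C (b n)) :
    diagHom φ (PowerSeries.mk a) = PowerSeries.mk b := by
  ext n
  rw [coeff_diagHom, Finset.sum_eq_single n]
  · rw [PowerSeries.coeff_mk, PowerSeries.coeff_mk, h, Nat.sub_self, PowerSeries.coeff_zero_C]
  · intro i hi hin
    have := Finset.mem_range.mp hi
    rw [PowerSeries.coeff_mk, h, PowerSeries.coeff_C, if_neg (by omega)]
  · intro hn
    exact absurd (Finset.self_mem_range_succ n) hn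

/-- A homomorphism that is surjective modulo `p` is surjective, by successive approximation. -/
theorem diagHom_surjective {φ : A →ₐ[Coef] B⟦X⟧} (h : ∀ b, ∃ a, coeff 0 (φ a) = b) :
    Function.Surjective (diagHom φ) := by
  intro F
  choose σ hσ using h
  let step : B⟦X⟧ → B⟦X⟧ := fun G => PowerSeries.mk fun k => coeff (k + 1) (G - φ (σ (coeff 0 G)))
  let G : ℕ → B⟦X⟧ := fun n => step^[n] F
  have hG : ∀ n k, coeff k (G (n + 1)) =
      coeff (k + 1) (G n) - coeff (k + 1) (φ (σ (coeff 0 (G n)))) := fun n k => by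
    simp only [G, Function.iterate_succ_apply', step, PowerSeries.coeff_mk, map_sub]
  -- `G n = ∑ k, φ(a (n + k)) p ^ k`, where `a n = σ (coeff 0 (G n))`, compared degree by degree
  have key : ∀ m n, coeff m (G n) =
      ∑ i ∈ Finset.range (m + 1), coeff (m - i) (φ (σ (coeff 0 (G (n + i))))) := by
    intro m
    induction m with
    | zero => intro n; simp [hσ]
    | succ m ih =>
      intro n
      rw [Finset.sum_range_succ', eq_comm, Nat.sub_zero, Nat.add_zero, ← eq_sub_iff_add_eq]
      simp only [Nat.add_zero]
      rw [← hG, ih]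
      refine Finset.sum_congr rfl fun i _ => ?_
      rw [Nat.add_sub_add_right, show n + (i + 1) = n + 1 + i by omega]
  refine ⟨PowerSeries.mk fun n => σ (coeff 0 (G n)), PowerSeries.ext fun m => ?_⟩
  rw [coeff_diagHom]
  simp only [PowerSeries.coeff_mk]
  have := key m 0
  simp only [Nat.zero_add] at this
  exact this.symm

end Diag

section Unique
variable {A R : Type} [Ring A] [Algebra Coef A] [Ring R] [Algebra Coef R] [Algebra Lam R]
  [IsScalarTower Coef Lam R] {N : ℕ}

/-- Where `p` is nilpotent, a homomorphism sending series to the sums of their terms is determined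
by its values on constants. -/
theorem IsEval.ext {π π' : A⟦X⟧ →ₐ[Coef] R} (h : IsEval π N) (h' : IsEval π' N)
    (hC : π.comp (constAlgHom A) = π'.comp (constAlgHom A)) : π = π' :=
  AlgHom.ext fun f => by
    rw [h.map_eq_sum, h'.map_eq_sum]
    exact Finset.sum_congr rfl fun e _ =>
      congrArg (pR R ^ e * ·) (DFunLike.congr_fun hC (coeff e f))

theorem IsEval.comp_diagHom {B : Type} [Ring B] [Algebra Coef B] {π : B⟦X⟧ →ₐ[Coef] R}
    (h : IsEval π N) (φ : A →ₐ[Coef] B⟦X⟧) : IsEval (π.comp (diagHom φ)) N where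
  map_ofCoef f := by rw [AlgHom.comp_apply, diagHom_ofCoef, h.map_ofCoef]
  pow_eq_zero := h.pow_eq_zero

/-- A homomorphism `A → R` extended to `A[[p]]`, if `p ^ N = 0` in `R`. -/
def evalHom (hN : pR R ^ N = 0) (L : A →ₐ[Coef] R) : A⟦X⟧ →ₐ[Coef] R where
  toRingHom := (evpHom hN).comp (PowerSeries.map (L : A →+* R))
  commutes' c := by
    show evp N (PowerSeries.map (L : A →+* R) (algebraMap Coef A⟦X⟧ c)) = _
    rw [PowerSeries.algebraMap_apply, PowerSeries.map_C, evp_C hN]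
    exact L.commutes c

theorem evalHom_C (hN : pR R ^ N = 0) (L : A →ₐ[Coef] R) (a : A) :
    evalHom hN L (PowerSeries.C a) = L a := by
  show evp N (PowerSeries.map (L : A →+* R) (PowerSeries.C a)) = _
  rw [PowerSeries.map_C, evp_C hN]; rfl

theorem isEval_evalHom (hN : pR R ^ N = 0) (L : A →ₐ[Coef] R) : IsEval (evalHom hN L) N where
  map_ofCoef f := by
    rw [algebraMap_eq_sum hN]
    show evp N (PowerSeries.map (L : A →+* R) (ofCoef f)) = _
    refine Finset.sum_congr rfl fun e _ => ?_
    rw [PowerSeries.coeff_map, ofCoef, PowerSeries.coeff_map]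
    exact congrArg (pR R ^ e * ·) (L.commutes _)
  pow_eq_zero := hN

end Unique

end EllTor

namespace EllTor
namespace Datum

/-! ### Homomorphisms from the smash product -/

section Smash
variable {D : Datum}

/-- Induction on homogeneous elements of the quantum toroidal algebra. -/
theorem wtSpace_induction {p : (D.I → ℤ) → D.UTor → Prop} (h_zero : ∀ β, p β 0)
    (h_add : ∀ β a b, p β a → p β b → p β (a + b)) (h_smul : ∀ β (c : Coef) a, p β a → p β (c • a))
    (h_one : p 0 1) (h_mul : ∀ (g : D.Gen) β a, p β a → p (g.wt + β) (UTor.gen D g * a))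
    {β : D.I → ℤ} {a : D.UTor} (ha : a ∈ D.wtSpace β) : p β a := by
  refine Submodule.span_induction ?_ (h_zero β) (fun a b _ _ => h_add β a b)
    (fun c a _ => h_smul β c a) ha
  clear ha a
  rintro _ ⟨w, rfl, rfl⟩
  induction w with
  | nil => exact h_one
  | cons g w ih =>
    rw [List.map_cons, List.sum_cons, List.map_cons, List.prod_cons]
    exact h_mul g _ _ ih

/-- The set of the elements `g(h, P) a ⊗ e^{Q_α}`, `a` homogeneous, is closed under
multiplication. -/
def smashMonoid (D : Datum) : Submonoid D.Skew where
  carrier := D.smashSet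
  one_mem' := ⟨0, 0, 1, 1, mem_wtSpace_one, rfl⟩
  mul_mem' := by
    rintro _ _ ⟨β, α, a, g, ha, rfl⟩ ⟨β', α', a', g', ha', rfl⟩
    exact ⟨_, _, _, _, mem_wtSpace_mul ha ha', (D.skewElt_mul _ _ _ _ _ _ _ _).symm⟩

/-- As a module, the smash product is spanned by the elements `g(h, P) a ⊗ e^{Q_α}`. -/
theorem smashAlg_eq_span : Subalgebra.toSubmodule D.smashAlg = Submodule.span Coef D.smashSet := by
  rw [smashAlg, Algebra.adjoin_eq_span]
  congr 1
  exact congrArg (fun S : Submonoid D.Skew => (S : Set D.Skew)) (smashMonoid D).closure_eq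

namespace TorData
variable {R : Type} [Ring R] [Algebra Coef R] {T : D.TorData R}

theorem ext_fields {T' : D.TorData R} (ha : T.a = T'.a) (hX : T.X = T'.X) (hk : T.k = T'.k)
    (hqd : T.qd = T'.qd) (heQ : T.eQ = T'.eQ) (hfn : T.fn = T'.fn) : T = T' := by
  cases T; cases T'
  simp only at ha hX hk hqd heQ hfn
  rw [ha, hX, hk, hqd, heQ, hfn]

namespace IsTor
variable (h : T.IsTor)

/-- The homomorphism from the quantum toroidal algebra. -/
def torHom : D.UTor →ₐ[Coef] R := RingQuot.liftAlgHom Coef ⟨T.lift, fun u v huv => h.rel u v huv⟩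

theorem torHom_gen (g : D.Gen) : h.torHom (UTor.gen D g) = T.gen g :=
  (RingQuot.liftAlgHom_mkAlgHom_apply Coef T.lift (fun u v huv => h.rel u v huv) _).trans
    (lift_gen g)

/-- Functions are shifted by the weight when moved past the image of a homogeneous element. -/
theorem fn_torHom {β : D.I → ℤ} {a : D.UTor} (ha : a ∈ D.wtSpace β) (f : D.Mer) :
    T.fn f * h.torHom a = h.torHom a * T.fn (D.shift (D.latVec (β, 0)) f) := by
  refine wtSpace_induction (p := fun β a => ∀ f,
    T.fn f * h.torHom a = h.torHom a * T.fn (D.shift (D.latVec (β, 0)) f)) ?_ ?_ ?_ ?_ ?_ ha f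
  · intro β f; rw [map_zero, mul_zero, zero_mul]
  · intro β a b ha hb f; rw [map_add, mul_add, add_mul, ha, hb]
  · intro β c a ha f; rw [map_smul, mul_smul_comm, smul_mul_assoc, ha]
  · intro f; rw [latVec_zero_zero, shift_zero, map_one, mul_one, one_mul]; rfl
  · intro g β a ha f
    rw [map_mul, torHom_gen, ← mul_assoc, h.fn_gen, mul_assoc, ha, shift_shift, ← map_add,
      Prod.mk_add_mk, add_zero, add_comm β, mul_assoc]

theorem eQ_torHom (α : D.I → ℤ) {β : D.I → ℤ} {a : D.UTor} (ha : a ∈ D.wtSpace β) :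
    Commute (T.eQ α) (h.torHom a) := by
  refine wtSpace_induction (p := fun _ a => Commute (T.eQ α) (h.torHom a)) ?_ ?_ ?_ ?_ ?_ ha
  · intro β; rw [map_zero]; exact Commute.zero_right _
  · intro β a b ha hb; rw [map_add]; exact ha.add_right hb
  · intro β c a ha; rw [map_smul]; exact ha.smul_right c
  · rw [map_one]; exact Commute.one_right _
  · intro g β a ha; rw [map_mul, torHom_gen]; exact (h.eQ_gen α g).mul_right ha

/-- The additive map `a ⊗ g ↦ g a`. -/
def tensorHom : D.UTor ⊗[ℂ] D.Mer →+ R :=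
  TensorProduct.liftAddHom
    { toFun := fun a =>
        { toFun := fun g => T.fn g * h.torHom a
          map_zero' := by
            have := h.fn_const 0
            rw [map_zero] at this
            rw [this, show scal 0 = 0 from map_zero _, map_zero, zero_mul]
          map_add' := fun f g => by rw [h.fn_add, add_mul] }
      map_zero' := by ext g; exact (congrArg _ (map_zero _)).trans (mul_zero _)
      map_add' := fun a b => by ext g; exact (congrArg _ (map_add _ _ _)).trans (mul_add _ _ _) }
    fun z a g => by
      show T.fn g * h.torHom (z • a) = T.fn (z • g) * h.torHom a
      rw [← algebraMap_smul Coef z a, map_smul, Algebra.smul_def z g, h.fn_mul, h.fn_const,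
        mul_smul_comm, mul_assoc, ← Algebra.smul_def]
      rfl

/-- The additive map `g a ⊗ e^{Q_α} ↦ g a e^{Q_α}`. -/
def skewHom : D.Skew →+ R :=
  SkewMonoidAlgebra.liftNC h.tensorHom fun x : D.Lat => T.eQ x.toAdd.2

theorem skewHom_elt (β α : D.I → ℤ) (a : D.UTor) (g : D.Mer) :
    h.skewHom (D.skewElt β α a g) = T.fn g * h.torHom a * T.eQ α :=
  SkewMonoidAlgebra.liftNC_single _ _ _ _

/-- Scalars in `q^{±c/2}` are respected on the smash product. -/
theorem skewHom_smul (c : Coef) {x : D.Skew} (hx : x ∈ Submodule.span Coef D.smashSet) :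
    h.skewHom (c • x) = c • h.skewHom x := by
  have key : ∀ (c : Coef) (β α) (a : D.UTor) (g : D.Mer),
      h.skewHom (c • D.skewElt β α a g) = c • h.skewHom (D.skewElt β α a g) := by
    intro c β α a g
    have : c • D.skewElt β α a g = D.skewElt β α (c • a) g := by
      rw [skewElt, skewElt, ← TensorProduct.smul_tmul']
      exact SkewMonoidAlgebra.smul_single c _ _
    rw [this, skewHom_elt, skewHom_elt, map_smul, mul_smul_comm, smul_mul_assoc]
  revert c
  refine Submodule.span_induction ?_ ?_ ?_ ?_ hx
  · rintro _ ⟨β, α, a, g, _, rfl⟩ c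
    exact key c β α a g
  · intro c; rw [smul_zero, map_zero, smul_zero]
  · intro x y _ _ hx hy c; rw [smul_add, map_add, map_add, hx, hy, smul_add]
  · intro c' x _ hx c; rw [smul_smul, hx, hx, smul_smul]

theorem skewHom_mul_elt {β α β' α' : D.I → ℤ} {a b : D.UTor} (ha : a ∈ D.wtSpace β)
    (hb : b ∈ D.wtSpace β') (g f : D.Mer) :
    h.skewHom (D.skewElt β α a g * D.skewElt β' α' b f) =
      h.skewHom (D.skewElt β α a g) * h.skewHom (D.skewElt β' α' b f) := by
  have h1 : T.eQ α * T.fn f = T.fn (D.shift (-D.latVec (0, α)) f) * T.eQ α := h.eQ_fn α f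
  have h2 : h.torHom a * T.fn (D.shift (-D.latVec (0, α)) f) =
      T.fn (D.shift (-D.latVec (β, α)) f) * h.torHom a := by
    have h3 : D.latVec (β, α) = D.latVec (β, 0) + D.latVec (0, α) := by
      rw [← map_add, Prod.mk_add_mk, add_zero, zero_add]
    rw [h.fn_torHom ha, shift_shift, h3, neg_add, add_neg_cancel_left]
  rw [skewElt_mul, skewHom_elt, skewHom_elt, skewHom_elt, map_mul, h.fn_mul, h.eQ_add]
  calc _ = T.fn g * (T.fn (D.shift (-D.latVec (β, α)) f) * h.torHom a) *
        (h.torHom b * T.eQ α) * T.eQ α' := by simp only [mul_assoc]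
    _ = T.fn g * h.torHom a * (T.eQ α * T.fn f) * h.torHom b * T.eQ α' := by
        rw [← h2, h1, ← (h.eQ_torHom α hb).eq]; simp only [mul_assoc]
    _ = _ := by simp only [mul_assoc]

/-- The additive map is multiplicative on the smash product, where the shift of the functions agrees
with the weight of the elements; on the whole skew group algebra it need not be. -/
theorem skewHom_mul {x y : D.Skew} (hx : x ∈ Submodule.span Coef D.smashSet)
    (hy : y ∈ Submodule.span Coef D.smashSet) : h.skewHom (x * y) = h.skewHom x * h.skewHom y := by
  have hspan : ∀ {x y : D.Skew}, x ∈ Submodule.span Coef D.smashSet →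
      y ∈ Submodule.span Coef D.smashSet → x * y ∈ Submodule.span Coef D.smashSet := by
    intro x y hx hy
    rw [← smashAlg_eq_span] at *
    exact D.smashAlg.mul_mem hx hy
  refine Submodule.span_induction (p := fun x _ => h.skewHom (x * y) = h.skewHom x * h.skewHom y)
    ?_ ?_ ?_ ?_ hx
  · rintro _ ⟨β, α, a, g, ha, rfl⟩
    have hs : D.skewElt β α a g ∈ Submodule.span Coef D.smashSet :=
      Submodule.subset_span ⟨β, α, a, g, ha, rfl⟩
    refine Submodule.span_induction (p := fun y _ => h.skewHom (_ * y) = h.skewHom _ * h.skewHom y)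
      ?_ ?_ ?_ ?_ hy
    · rintro _ ⟨β', α', b, f, hb, rfl⟩
      exact h.skewHom_mul_elt ha hb g f
    · rw [mul_zero, map_zero, mul_zero]
    · intro y y' _ _ h1 h2; rw [mul_add, map_add, map_add, h1, h2, mul_add]
    · intro c y hy h1
      rw [mul_smul_comm, h.skewHom_smul c (hspan hs hy), h.skewHom_smul c hy, h1, mul_smul_comm]
  · rw [zero_mul, map_zero, zero_mul]
  · intro x x' _ _ h1 h2; rw [add_mul, map_add, map_add, h1, h2, add_mul]
  · intro c x hx h1
    rw [smul_mul_assoc, h.skewHom_smul c (hspan hx hy), h.skewHom_smul c hx, h1, smul_mul_assoc]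

theorem smashVal_mem_span (x : D.Smash) : D.smashVal x ∈ Submodule.span Coef D.smashSet := by
  rw [← smashAlg_eq_span]; exact x.2

include h in
theorem fn_one : T.fn 1 = 1 := by
  have := h.fn_const 1
  rwa [map_one, scal_one, map_one] at this

/-- The homomorphism from the smash product determined by elements satisfying its relations. -/
def smashHom : D.Smash →ₐ[Coef] R :=
  AlgHom.ofLinearMap
    { toFun := fun x => h.skewHom (D.smashVal x)
      map_add' := fun x y => by rw [map_add, map_add]
      map_smul' := fun c x => by
        rw [map_smul, h.skewHom_smul c (smashVal_mem_span x), RingHom.id_apply] }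
    (by
      show h.skewHom (D.smashVal 1) = 1
      rw [map_one]
      refine (h.skewHom_elt 0 0 1 1).trans ?_
      rw [map_one, h.fn_one, h.eQ_zero, mul_one, mul_one])
    fun x y => by
      show h.skewHom (D.smashVal (x * y)) = h.skewHom (D.smashVal x) * h.skewHom (D.smashVal y)
      rw [map_mul, h.skewHom_mul (smashVal_mem_span x) (smashVal_mem_span y)]

theorem smashHom_elt (β α : D.I → ℤ) (a : D.UTor) (ha : a ∈ D.wtSpace β) (g : D.Mer) :
    h.smashHom (Smash.elt β α a ha g) = T.fn g * h.torHom a * T.eQ α := h.skewHom_elt β α a g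

theorem smashHom_gen (g : D.Gen) : h.smashHom (Smash.gen g) = T.gen g := by
  rw [Smash.gen, smashHom_elt, torHom_gen, h.fn_one, h.eQ_zero, one_mul, mul_one]

/-- The images of the generators under the homomorphism determined by `T`. -/
theorem map_smashHom : D.smashTor.map h.smashHom = T := by
  have ha : (D.smashTor.map h.smashHom).a = T.a := by
    ext i l
    show h.smashHom (Smash.a i l) = _
    rw [Smash.a]
    split_ifs with hl
    · exact h.smashHom_gen (.a i ⟨l, hl⟩)
    · rw [map_zero, not_not.mp hl, h.a_zero]
  have hX : (D.smashTor.map h.smashHom).X = T.X := by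
    ext ε i n; exact h.smashHom_gen (.X ε i n)
  have hk : (D.smashTor.map h.smashHom).k = T.k := by
    ext ε i; exact h.smashHom_gen (.k ε i)
  have hqd : (D.smashTor.map h.smashHom).qd = T.qd := by
    ext ε; exact h.smashHom_gen (.qd ε)
  have heQ : (D.smashTor.map h.smashHom).eQ = T.eQ := by
    ext α
    refine (h.smashHom_elt 0 α 1 mem_wtSpace_one 1).trans ?_
    rw [map_one, h.fn_one, one_mul, one_mul]
  have hfn : (D.smashTor.map h.smashHom).fn = T.fn := by
    ext g
    refine (h.smashHom_elt 0 0 1 mem_wtSpace_one g).trans ?_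
    rw [map_one, h.eQ_zero, mul_one, mul_one]
  exact TorData.ext_fields ha hX hk hqd heQ hfn

end IsTor
end TorData

/-- The smash product is generated by the `a^∨_{i,l}`, `X^±_{i,n}`, `k_i^{±1}`, `q^{±d}`, `F` and
the `e^{Q_α}`. -/
theorem smash_subalgebra_eq_top (S : Subalgebra Coef D.Smash) (hgen : ∀ g, Smash.gen g ∈ S)
    (heQ : ∀ α, Smash.eQ α ∈ S) (hfn : ∀ f, Smash.fn f ∈ S) : S = ⊤ := by
  have h1 : ∀ {β : D.I → ℤ} {a : D.UTor},
      a ∈ D.wtSpace β →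
      D.skewElt β 0 a 1 ∈ S.map D.smashVal := by
    intro β a ha
    refine wtSpace_induction (p := fun β a => D.skewLin β a ∈ S.map D.smashVal) ?_ ?_ ?_ ?_ ?_ ha
    · intro β; rw [map_zero]; exact zero_mem _
    · intro β a b ha hb; rw [map_add]; exact add_mem ha hb
    · intro β c a ha; rw [map_smul]; exact Subalgebra.smul_mem _ ha c
    · rw [skewLin_one]; exact one_mem _
    · intro g β a ha
      rw [← skewLin_mul]
      exact mul_mem ⟨_, hgen g, rfl⟩ ha
  have h2 : D.smashAlg ≤ S.map D.smashVal := by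
    refine Algebra.adjoin_le ?_
    rintro _ ⟨β, α, a, g, ha, rfl⟩
    have := mul_mem (mul_mem (⟨_, hfn g, rfl⟩ : D.skewElt 0 0 1 g ∈ S.map D.smashVal) (h1 ha))
      (⟨_, heQ α, rfl⟩ : D.skewElt 0 α 1 1 ∈ S.map D.smashVal)
    rw [skewElt_mul, skewElt_mul] at this
    simpa using this
  refine eq_top_iff.mpr fun x _ => ?_
  obtain ⟨y, hy, hxy⟩ := h2 x.2
  rwa [← D.smashVal_injective (hxy : D.smashVal y = D.smashVal x)]

end Smash
end Datum
end EllTor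

namespace EllTor
namespace Datum

/-! ### The isomorphism -/

section Iso
variable {D : Datum}

attribute [local instance] quotAlgebra

/-- The images of the generators of the elliptic algebra. -/
def ellGen (D : Datum) : D.EGen → D.Smash⟦X⟧
  | .al i l => ofCoef (alS l) * PowerSeries.C (Smash.a i l)
  | .x ε i n => if ε = 1 then
      mulDist (Smash.uPlus i) (Smash.cur 1 i) n * PowerSeries.C (Smash.eQ (-Pi.single i 1))
    else mulDist (Smash.cur (-1) i) (Smash.uMinus i) n
  | .K ε i => PowerSeries.C (Smash.k ε i) * PowerSeries.C (Smash.eQ (-Pi.single i 1))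
  | .qd ε => PowerSeries.C (Smash.qd ε)
  | .eQ α => PowerSeries.C (Smash.eQ α)
  | .fn f => PowerSeries.C (Smash.fn f)

/-- The homomorphism from the free algebra. -/
def ellHom (D : Datum) : D.EFree →ₐ[Coef] D.Smash⟦X⟧ := FreeAlgebra.lift Coef D.ellGen

theorem ellHom_gen (g : D.EGen) : D.ellHom (EFree.gen g) = D.ellGen g :=
  FreeAlgebra.lift_ι_apply _ _

theorem smash_a_zero (i : D.I) : (Smash.a i 0 : D.Smash) = 0 := dif_neg (not_not.mpr rfl)

theorem ellHom_al (i : D.I) (l : ℤ) :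
    D.ellHom (EFree.al i l) = ofCoef (alS l) * PowerSeries.C (Smash.a i l) := by
  rw [EFree.al]
  split_ifs with hl
  · exact ellHom_gen _
  · rw [map_zero, not_not.mp hl, smash_a_zero, map_zero, mul_zero]

theorem ellHom_x_one (i : D.I) (n : ℤ) : D.ellHom (EFree.x 1 i n) =
    mulDist (Smash.uPlus i) (Smash.cur 1 i) n * PowerSeries.C (Smash.eQ (-Pi.single i 1)) := by
  rw [EFree.x, ellHom_gen, ellGen, if_pos rfl]

theorem ellHom_x_neg_one (i : D.I) (n : ℤ) : D.ellHom (EFree.x (-1) i n) =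
    mulDist (Smash.cur (-1) i) (Smash.uMinus i) n := by
  rw [EFree.x, ellHom_gen, ellGen, if_neg (by decide)]

/-- The homomorphism from the free topological algebra. -/
abbrev ellExt (D : Datum) : D.EFree⟦X⟧ →ₐ[Coef] D.Smash⟦X⟧ := diagHom D.ellHom

section Eval
variable {R : Type} [Ring R] [Algebra Coef R] [Algebra Lam R] [IsScalarTower Coef Lam R]
  {N : ℕ}

/-- In every quotient in which `p ^ N = 0`, the generators are sent to the twisted currents. -/
theorem isCompat_ellExt {π : D.Smash⟦X⟧ →ₐ[Coef] R} (hπ : IsEval π N) :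
    (smashData π).IsCompat (π.comp D.ellExt) N where
  al i l := by
    rw [AlgHom.comp_apply, diagHom_C, ellHom_al, hπ.map_ofCoef_mul]; rfl
  x ε i n := by
    rw [AlgHom.comp_apply, diagHom_C]
    rcases Int.units_eq_one_or ε with rfl | rfl
    · rw [ellHom_x_one, map_x_one hπ]
    · rw [ellHom_x_neg_one, map_x_neg_one hπ]
  K ε i := by
    rw [AlgHom.comp_apply, diagHom_C, EFree.K, ellHom_gen]
    exact map_mul π _ _
  qd ε := by rw [AlgHom.comp_apply, diagHom_C, EFree.qd, ellHom_gen]; rfl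
  eQ α := by rw [AlgHom.comp_apply, diagHom_C, EFree.eQ, ellHom_gen]; rfl
  fn f := by rw [AlgHom.comp_apply, diagHom_C, EFree.fn, ellHom_gen]; rfl

/-- The defining relations of the elliptic algebra hold in every quotient in which `p ^ N = 0`. -/
theorem map_ellExt_eq (hD : D.Admissible) {π : D.Smash⟦X⟧ →ₐ[Coef] R} (hπ : IsEval π N)
    {u v : D.EFree⟦X⟧} (huv : D.ERel u v) : π (D.ellExt u) = π (D.ellExt v) :=
  smashData_isTor.map_eq_of_eRel hD (hπ.comp_diagHom D.ellHom) (isCompat_ellExt hπ) huv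

/-- Two evaluations that send the generators to the same currents agree. -/
theorem TorData.IsCompat.ext {T : D.TorData R} {π π' : D.EFree⟦X⟧ →ₐ[Coef] R} (hπ : IsEval π N)
    (hπ' : IsEval π' N) (h : T.IsCompat π N) (h' : T.IsCompat π' N) : π = π' := by
  refine hπ.ext hπ' (FreeAlgebra.hom_ext (funext fun g => ?_))
  show π (PowerSeries.C (EFree.gen g)) = π' (PowerSeries.C (EFree.gen g))
  cases g with
  | al i l =>
    have := (h.al i l).trans (h'.al i l).symm
    rwa [show EFree.al i (l : ℤ) = EFree.gen (.al i l) from dif_pos l.2] at this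
  | x ε i n => exact (h.x ε i n).trans (h'.x ε i n).symm
  | K ε i => exact (h.K ε i).trans (h'.K ε i).symm
  | qd ε => exact (h.qd ε).trans (h'.qd ε).symm
  | eQ α => exact (h.eQ α).trans (h'.eQ α).symm
  | fn f => exact (h.fn f).trans (h'.fn f).symm

end Eval

/-- The congruence generated by the relations and `p ^ N = 0`. -/
def eCon (D : Datum) (N : ℕ) : RingCon D.EFree⟦X⟧ :=
  ringConGen fun u v => D.ERel u v ∨ (u = PowerSeries.X ^ N ∧ v = 0)

/-- The relations of the elliptic algebra generate a congruence modulo each power of `p`; the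
`p`-adically closed congruence is the intersection. -/
theorem eCon_iff {u v : D.EFree⟦X⟧} : D.ECon u v ↔ ∀ N, D.eCon N u v := by
  rw [ECon, RingCon.coe_iInf]
  simp only [iInf_apply, iInf_Prop_eq]
  rfl

theorem isEll_mk (N : ℕ) : IsEll (R := (D.eCon N).Quotient) (RingCon.mkₐ Coef (D.eCon N)) N where
  toIsEval := isEval_mk (RingCon.le_ringConGen _ _ (Or.inr ⟨rfl, rfl⟩))
  rel _ _ huv := (RingCon.eq _).mpr (RingCon.le_ringConGen _ _ (Or.inl huv))

/-- The homomorphism factors through the elliptic algebra, since a series over the smash product is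
determined by its classes modulo the powers of `p`. -/
theorem ellExt_eq_of_eCon (hD : D.Admissible) {u v : D.EFree⟦X⟧} (huv : D.ECon u v) :
    D.ellExt u = D.ellExt v := by
  refine eq_of_trunc_eq fun N => ?_
  have h1 : D.eCon N ≤ RingCon.ker
      ((RingCon.mkₐ Coef (truncCon D.Smash N)).comp D.ellExt).toRingHom := by
    refine RingCon.ringConGen_le.mpr fun u v huv => ?_
    rcases huv with huv | ⟨rfl, rfl⟩
    · exact map_ellExt_eq hD (isEval_trunc N) huv
    · have hX := ((isEval_trunc (A := D.Smash) N).comp_diagHom D.ellHom)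
      show (RingCon.mkₐ Coef (truncCon D.Smash N)).comp D.ellExt _ =
        (RingCon.mkₐ Coef (truncCon D.Smash N)).comp D.ellExt _
      rw [map_pow, hX.map_X, hX.pow_eq_zero, map_zero]
  exact h1 (eCon_iff.mp huv N)

/-- The inverse modulo `p ^ N`: the untwisted generators satisfy the relations of the smash
product. -/
theorem eCon_of_ellExt_eq (hD : D.Admissible) {u v : D.EFree⟦X⟧} (huv : D.ellExt u = D.ellExt v) :
    D.ECon u v := by
  refine eCon_iff.mpr fun N => (RingCon.eq _).mp ?_
  have h := isEll_mk (D := D) N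
  have hT := h.isTor hD
  have hΘ := isEval_evalHom h.pow_eq_zero hT.smashHom
  have h1 : smashData (evalHom h.pow_eq_zero hT.smashHom) =
      ellData (RingCon.mkₐ Coef (D.eCon N)) N := by
    rw [smashData, show (evalHom h.pow_eq_zero hT.smashHom).comp (constAlgHom D.Smash) = hT.smashHom
      from AlgHom.ext fun a => evalHom_C h.pow_eq_zero _ a, hT.map_smashHom]
  have h2 := isCompat_ellExt hΘ
  rw [h1] at h2
  have h3 := TorData.IsCompat.ext h.toIsEval (hΘ.comp_diagHom D.ellHom) (h.isCompat hD) h2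
  show RingCon.mkₐ Coef (D.eCon N) u = RingCon.mkₐ Coef (D.eCon N) v
  rw [h3, AlgHom.comp_apply, AlgHom.comp_apply]
  exact congrArg _ huv

/-- Evaluation at `p = 0`. -/
def coeffZeroHom (D : Datum) : D.Smash⟦X⟧ →ₐ[Coef] D.Smash where
  toRingHom := PowerSeries.constantCoeff
  commutes' c := by
    rw [PowerSeries.algebraMap_apply]
    exact PowerSeries.constantCoeff_C _

/-- Surjectivity modulo `p`: at `p = 0` the twisted currents are `X_i^+(z) e^{-Q_i}` and `X_i^-(z)`,
and the images of the generators generate the smash product. -/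
theorem exists_ellHom (b : D.Smash) : ∃ a, coeff 0 (D.ellHom a) = b := by
  -- at `N = 1`, with `p` acting on the smash product as `0`
  let _ : Algebra Lam D.Smash :=
    Algebra.compHom D.Smash (PowerSeries.constantCoeff : Lam →+* Coef)
  have : IsScalarTower Coef Lam D.Smash := IsScalarTower.of_algebraMap_eq fun c => by
    show _ = algebraMap Coef D.Smash (PowerSeries.constantCoeff (PowerSeries.C c))
    rw [PowerSeries.constantCoeff_C]
  have hπ : IsEval D.coeffZeroHom 1 := by
    refine ⟨fun f => ?_, ?_⟩
    · show PowerSeries.constantCoeff (ofCoef f) = _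
      rw [ofCoef, ← PowerSeries.coeff_zero_eq_constantCoeff_apply, PowerSeries.coeff_map,
        PowerSeries.coeff_zero_eq_constantCoeff_apply]
      rfl
    · show algebraMap Coef D.Smash (PowerSeries.constantCoeff (PowerSeries.X : Lam)) ^ 1 = 0
      simp
  have hC := isCompat_ellExt hπ
  have hT : smashData D.coeffZeroHom = D.smashTor :=
    TorData.ext_fields (by ext; exact PowerSeries.constantCoeff_C _)
      (by ext; exact PowerSeries.constantCoeff_C _) (by ext; exact PowerSeries.constantCoeff_C _)
      (by ext; exact PowerSeries.constantCoeff_C _) (by ext; exact PowerSeries.constantCoeff_C _)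
      (by ext; exact PowerSeries.constantCoeff_C _)
  rw [hT] at hC
  have hB := smashTor_isTor (D := D).isBase
  let S : Subalgebra Coef D.Smash := (D.coeffZeroHom.comp D.ellHom).range
  have hval : ∀ a, D.coeffZeroHom (D.ellExt (PowerSeries.C a)) ∈ S := fun a => by
    rw [diagHom_C]; exact ⟨a, rfl⟩
  have heQ : ∀ α, Smash.eQ α ∈ S := fun α => by
    have := hval (EFree.eQ α); rwa [← AlgHom.comp_apply, hC.eQ] at this
  have he : ∀ i u, u * Smash.eQ (-Pi.single i 1) ∈ S → u ∈ S := fun i u hu => by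
    have := mul_mem hu (heQ (Pi.single i 1))
    rwa [mul_assoc, show Smash.eQ (-Pi.single i 1) * Smash.eQ (Pi.single i 1) = (1 : D.Smash) by
      rw [← smashTor_isTor.eQ_zero, ← neg_add_cancel (Pi.single i 1)]
      exact (smashTor_isTor.eQ_add _ _).symm, mul_one] at this
  have htop : S = ⊤ := by
    refine smash_subalgebra_eq_top S (fun g => ?_) heQ fun f => ?_
    · cases g with
      | a i l =>
        have := hval (EFree.al i l)
        rw [← AlgHom.comp_apply, hC.al, TorData.al] at this
        have h2 := S.smul_mem this (PowerSeries.constantCoeff (alS' l))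
        rw [show PowerSeries.constantCoeff (alS' l) • (alS l • D.smashTor.a i l) =
          (alS' l * alS l) • D.smashTor.a i l from (mul_smul (alS' l) _ _).symm,
          mul_comm, alS_mul_alS' l.2, one_smul] at h2
        rwa [show D.smashTor.a i l = Smash.gen (.a i l) from dif_pos l.2] at h2
      | X ε i n =>
        have := hval (EFree.x ε i n)
        rw [← AlgHom.comp_apply, hC.x] at this
        rcases Int.units_eq_one_or ε with rfl | rfl
        · rw [TorData.x_one, twist, Finset.sum_range_one] at this
          simp only [pow_zero, one_mul, coeff_zero_pexp, Nat.cast_zero, mul_zero, add_zero] at this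
          exact he i _ this
        · rw [TorData.x_neg_one, twistR, Finset.sum_range_one] at this
          simp only [pow_zero, one_mul, mul_one, coeff_zero_pexp, Nat.cast_zero, mul_zero,
            add_zero] at this
          exact this
      | k ε i =>
        have := hval (EFree.K ε i)
        rw [← AlgHom.comp_apply, hC.K] at this
        exact he i _ this
      | qd ε => have := hval (EFree.qd ε); rwa [← AlgHom.comp_apply, hC.qd] at this
    · have := hval (EFree.fn f); rwa [← AlgHom.comp_apply, hC.fn] at this
  have hb : b ∈ S := htop ▸ Algebra.mem_top
  obtain ⟨a, ha⟩ := hb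
  exact ⟨a, (PowerSeries.coeff_zero_eq_constantCoeff_apply _).trans ha⟩

/-- The homomorphism from the elliptic quantum toroidal algebra to the completed smash product. -/
def ellMap (hD : D.Admissible) : D.UEll →ₐ[Coef] D.Smash⟦X⟧ :=
  RingCon.liftₐ D.ECon D.ellExt fun _ _ huv => ellExt_eq_of_eCon hD huv

theorem ellMap_bijective (hD : D.Admissible) : Function.Bijective (ellMap hD) := by
  constructor
  · intro a b hab
    obtain ⟨u, rfl⟩ := RingCon.mk'_surjective D.ECon a
    obtain ⟨v, rfl⟩ := RingCon.mk'_surjective D.ECon b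
    exact (RingCon.eq _).mpr (eCon_of_ellExt_eq hD hab)
  · intro F
    obtain ⟨u, rfl⟩ := diagHom_surjective exists_ellHom F
    exact ⟨UEll.cls u, rfl⟩

/-- The isomorphism of the elliptic quantum toroidal algebra with the completed smash product. -/
def ellEquiv (hD : D.Admissible) : D.UEll ≃ₐ[Coef] D.Smash⟦X⟧ :=
  AlgEquiv.ofBijective (ellMap hD) (ellMap_bijective hD)

theorem ellEquiv_cls (hD : D.Admissible) (u : D.EFree⟦X⟧) :
    ellEquiv hD (UEll.cls u) = D.ellExt u := rfl

/-- The image of `φ_i^±(z)`. -/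
theorem ellExt_phi (ε : ℤˣ) (i : D.I) (n : ℤ) : D.ellExt (EFree.phi ε i n) =
    mulDist (mulDist (scaleArg ε (Smash.uPlus i)) (Smash.Phi ε i))
      (scaleArg (-ε) (Smash.uMinus i)) n * PowerSeries.C (Smash.eQ (-Pi.single i 1)) := by
  refine eq_of_trunc_eq fun N => ?_
  have hπ := isEval_trunc (A := D.Smash) N
  have hC := isCompat_ellExt hπ
  rw [map_phi_formula hπ]
  exact smashData_isTor.isBase.map_phi (hπ.comp_diagHom D.ellHom) hC.al hC.K ε i n

/-! ### Untwisted affine data -/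

theorem mMatrix_anti (t : SimpleType) (i j : Fin (t.rank + 1)) :
    t.mMatrix j i = -t.mMatrix i j := by
  cases t <;> simp only [SimpleType.mMatrix, neg_zero]
  simp only [eq_comm]
  ring

/-- Untwisted affine data are admissible; `q_i ≠ q_i^{-1}` because `q` is not a root of unity. -/
theorem admissible_datum (t : SimpleType) {d : Fin (t.rank + 1) → ℕ} (hd_pos : ∀ i, 0 < d i)
    (hd_symm : ∀ i j, (d i : ℤ) * t.affineCartan i j = (d j : ℤ) * t.affineCartan j i)
    {q κ : ℂ} (hq0 : q ≠ 0) (hq : ∀ n : ℕ, 0 < n → q ^ n ≠ 1) :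
    (t.datum d q κ).Admissible where
  q_ne := hq0
  qdiff_ne i h := by
    have h1 : q ^ d i ≠ 0 := pow_ne_zero _ hq0
    have h2 : q ^ d i = (q ^ d i)⁻¹ := sub_eq_zero.mp h
    refine hq (d i + d i) (by have := hd_pos i; omega) ?_
    rw [pow_add]
    nth_rewrite 2 [h2]
    exact mul_inv_cancel₀ h1
  b_symm := hd_symm
  m_anti i j := mMatrix_anti t j i

end Iso
end Datum
end EllTor

end

open EllTor EllTor.Datum in
theorem mainTheorem1 (t : EllTor.SimpleType) (d : Fin (t.rank + 1) → ℕ) (hd_pos : ∀ i, 0 < d i)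
    (hd_symm : ∀ i j, (d i : ℤ) * t.affineCartan i j = (d j : ℤ) * t.affineCartan j i)
    (q κ : ℂ) (hq0 : q ≠ 0) (hq : ∀ n : ℕ, 0 < n → q ^ n ≠ 1) (hκ : κ ≠ 0) :
    ∃ Ψ : (t.datum d q κ).UEll ≃ₐ[Coef] (t.datum d q κ).Smash⟦X⟧,
      (∀ g : (t.datum d q κ).Mer⟦X⟧,
        Ψ (UEll.fn g) = PowerSeries.mk fun n => Smash.fn (PowerSeries.coeff n g)) ∧
      (∀ ε : ℤˣ, Ψ (UEll.qd ε) = PowerSeries.C (Smash.qd ε)) ∧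
      (∀ α, Ψ (UEll.eQ α) = PowerSeries.C (Smash.eQ α)) ∧
      (∀ i n, Ψ (UEll.x 1 i n) =
        mulDist (Smash.uPlus i) (Smash.cur 1 i) n * PowerSeries.C (Smash.eQ (-Pi.single i 1))) ∧
      (∀ i n, Ψ (UEll.x (-1) i n) = mulDist (Smash.cur (-1) i) (Smash.uMinus i) n) ∧
      (∀ (ε : ℤˣ) i n, Ψ (UEll.phi ε i n) =
        mulDist (mulDist (scaleArg ε (Smash.uPlus i)) (Smash.Phi ε i))
          (scaleArg (-ε) (Smash.uMinus i)) n * PowerSeries.C (Smash.eQ (-Pi.single i 1))) ∧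
      (∀ (ε : ℤˣ) i, Ψ (UEll.K ε i) =
        PowerSeries.C (Smash.k ε i) * PowerSeries.C (Smash.eQ (-Pi.single i 1))) ∧
      (∀ i (n : ℕ), 0 < n →
        Ψ (UEll.al i n) = cpow (-n) • PowerSeries.C (Smash.a i n)) ∧
      (∀ i (n : ℕ), 0 < n →
        Ψ (UEll.al i (-n)) =
          ofCoef (PowerSeries.C (cpow (-n)) * ((1 - pp ^ n) * invOneSub pstar n)) *
            PowerSeries.C (Smash.a i (-n))) := by
  have hD := admissible_datum (κ := κ) t hd_pos hd_symm hq0 hq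
  refine ⟨ellEquiv hD, fun g => ?_, fun ε => ?_, fun α => ?_, fun i n => ?_, fun i n => ?_,
    fun ε i n => ?_, fun ε i => ?_, fun i n hn => ?_, fun i n hn => ?_⟩
  · rw [UEll.fn, ellEquiv_cls]
    exact diagHom_mk fun n => ellHom_gen _
  · rw [UEll.qd, ellEquiv_cls, diagHom_C]
    exact ellHom_gen _
  · rw [UEll.eQ, ellEquiv_cls, diagHom_C]
    exact ellHom_gen _
  · rw [UEll.x, ellEquiv_cls, diagHom_C, ellHom_x_one]
  · rw [UEll.x, ellEquiv_cls, diagHom_C, ellHom_x_neg_one]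
  · rw [UEll.phi, ellEquiv_cls, ellExt_phi]
  · rw [UEll.K, ellEquiv_cls, diagHom_C]
    exact ellHom_gen _
  · rw [UEll.al, ellEquiv_cls, diagHom_C, ellHom_al, alS, if_pos (by omega), mul_one, Nat.abs_cast,
      ofCoef_C_mul]
  · rw [UEll.al, ellEquiv_cls, diagHom_C, ellHom_al, alS, if_neg (by omega), abs_neg, Nat.abs_cast,
      Int.natAbs_neg, Int.natAbs_natCast]
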